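/- Let $A$ be a finite-dimensional unital associative algebra over a field $K$ with a symmetric, non-degenerate bilinear form $\langle\,,\rangle$ that is invariant, $\langle ab,c\rangle=\langle a,bc\rangle$. Let $C^n(A,A)=\mathrm{Hom}_K(A^{\otimes n},A)$ be the Hochschild cochains, $C^\bullet=\bigoplus_{n\ge 0} C^n(A,A)$, with Hochschild coboundary $\delta$, cohomology $HH^\bullet(A,A)$, and cup product $(f\smile g)(a_1,\dots,a_{p+q})=f(a_1,\dots,a_p)\,g(a_{p+1},\dots,a_{p+q})$. Let $\Delta:C^n(A,A)\to C^{n-1}(A,A)$ be the dualized Connes $B$-operator, defined by $$\langle \Delta f(a_1,\dots,a_{n-1}),a_n\rangle=\sum_{i=1}^n(-1)^{i(n-1)}\langle f(a_i,\dots,a_n,a_1,\dots,a_{i-1}),1\rangle ,\qquad n\ge 1,$$ and $\Delta=0$ on $C^0(A,A)$. Let $\overline{C}^\bullet\subset C^\bullet$ be the normalized cochains, i.e. those that vanish as soon as one argument is $1$. With $\gamma_k$ the $k$-fold cup product and with the Koszul sign rule (a cochain in $C^n(A,A)$ has degree $n$), put $$m_1=\Delta,\qquad m_2=\Delta(\gamma_2)-\gamma_2(\Delta\otimes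 id)-\gamma_2(id\otimes\Delta),$$ $$m_k=\Delta(\gamma_k)-\gamma_2(\Delta(\gamma_{k-1})\otimes id)-\gamma_2(id\otimes\Delta(\gamma_{k-1}))+\gamma_3(id\otimes\Delta(\gamma_{k-2})\otimes id)\qquad(k\ge 3).$$ A homologically graded $A_\infty$-structure on $V[-1]$, for a graded vector space $V$, is a family of multilinear maps $m_k:V^{\otimes k}\to V$, $k\geq 1$, of degree $-1$ with $$\sum_{i+k+j=n,\;k\ge1,\;i,j\ge0} m_{i+1+j}(id^{\otimes i}\otimes m_k\otimes id^{\otimes j})=0\qquad\text{for all } n\ge 1 .$$ Theorem. (a) $\overline{C}^\bullet$ is a subcomplex of $(C^\bullet,\delta)$ whose inclusion induces an isomorphism on cohomology. (b) The maps $m_k$ restrict to $\overline{C}^\bullet$ and form a homologically graded $A_\infty$-structure on $\overline{C}^\bullet[-1]$, with $m_1=\Delta$. (c) The maps $m_k$ on $C^\bullet$ send cocycles to cocycles, descend to $HH^\bullet(A,A)$, and form a homologically graded $A_\infty$-structure on $HH^\bullet(A,A)[-1]$. (d) On $HH^\bullet(A,A)$, $m_1$ is the map induced by $\Delta$, and $m_2$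 is the Gerstenhaber bracket up to sign: for classes $x\in HH^p(A,A)$ and $y\in HH^q(A,A)$, with $p+q\ge 1$, $$m_2(x,y)=(-1)^{(p-1)q+1}[x,y],$$ where $[f,g]=f\circ g-(-1)^{(p-1)(q-1)}g\circ f$ and $(f\circ g)(a_1,\dots,a_{p+q-1})=\sum_{i=0}^{p-1}(-1)^{i(q-1)}f(a_1,\dots,a_i,g(a_{i+1},\dots,a_{i+q}),a_{i+q+1},\dots,a_{p+q-1})$ for $f\in C^p(A,A)$, $g\in C^q(A,A)$. -/

import Mathlib

set_option maxSynthPendingDepth 3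

open scoped DirectSum

namespace HochschildBV

noncomputable section

/-! ## Generic part: graded modules, homologically graded `A_∞`-structures, the operations `m_n` -/

section Generic

variable (K : Type*) [Field K] (V : ℕ → Type*) [∀ i, AddCommGroup (V i)] [∀ i, Module K (V i)]

/-- The Koszul sign operator of a graded module: multiplication by `(-1)^n` in degree `n`. -/
def parity : (⨁ i, V i) →ₗ[K] (⨁ i, V i) :=
  DirectSum.lmap (fun n => ((-1 : K) ^ n) • (LinearMap.id : V n →ₗ[K] V n))

variable {K V}

/-- The `i + 1 + j` arguments, as a function of their position `l`, that remain when `op k` is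
applied to `k` consecutive entries `a_i, …, a_{i+k-1}` of the word `a_0 a_1 a_2 …`. An operation of
odd degree has moved past `a_0, …, a_{i-1}`, which gives the Koszul sign
`(-1)^{|a_0| + … + |a_{i-1}|}`. -/
def insertArgs (op : ∀ n, MultilinearMap K (fun _ : Fin n => ⨁ i, V i) (⨁ i, V i))
    (a : ℕ → ⨁ i, V i) (i k l : ℕ) : ⨁ i, V i :=
  if l < i then parity K V (a l)
  else if l = i then op k (fun r : Fin k => a (i + r))
  else a (l + k - 1)

variable (K V)

/-- A homologically graded `A_∞`-structure on the shift `V[-1]` of the graded module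
`V = ⨁ i, V i`: multilinear operations `op n`, `n ≥ 1`, of degree `-1` on `V`, with
`∑_{i+k+j=n, k≥1} op_{i+1+j} (id^{⊗ i} ⊗ op_k ⊗ id^{⊗ j}) = 0` for all `n ≥ 1`, where the tensor
products of maps follow the Koszul sign rule. The differential of the structure is `op 1`;
`op 0` plays no role. -/
structure HomologicalAInfinity where
  /-- the operations -/
  op : ∀ n, MultilinearMap K (fun _ : Fin n => ⨁ i, V i) (⨁ i, V i)
  /-- each operation has degree `-1` -/
  op_degree : ∀ n, 1 ≤ n → ∀ (d : Fin n → ℕ) (x : ∀ i, V (d i)) (p : ℕ), p + 1 ≠ ∑ i, d i →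
    op n (fun i => DirectSum.lof K ℕ V (d i) (x i)) p = 0
  /-- the quadratic relations -/
  op_relation : ∀ n, 1 ≤ n → ∀ a : ℕ → ⨁ i, V i,
    ∑ i ∈ Finset.range n, ∑ k ∈ Finset.Icc 1 (n - i),
      op (i + 1 + (n - i - k)) (fun l => insertArgs op a i k l) = 0

end Generic

section Construction

variable {K : Type*} [Field K] {W : Type*} [AddCommGroup W] [Module K W]

/-- The product `γ_{n+1}` of `n + 1` ordered elements. -/
def gammaOp (μ : W →ₗ[K] W →ₗ[K] W) : (n : ℕ) → (Fin (n + 1) → W) → W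
  | 0, a => a 0
  | n + 1, a => μ (gammaOp μ n (fun i => a i.castSucc)) (a (Fin.last (n + 1)))

/-- The operations `m_n` built from a product `μ`, an operator `D` of odd degree and the Koszul sign
operator `τ`:
`m_1 = D`,
`m_2 = D γ_2 - γ_2 (D ⊗ id) - γ_2 (id ⊗ D)`,
`m_n = D γ_n - γ_2 (D γ_{n-1} ⊗ id) - γ_2 (id ⊗ D γ_{n-1}) + γ_3 (id ⊗ D γ_{n-2} ⊗ id)`
for `n ≥ 3` (and `m_0 = 0`, which is not used). -/
def mOp (μ : W →ₗ[K] W →ₗ[K] W) (D τ : W →ₗ[K] W) : (n : ℕ) → (Fin n → W) → W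
  | 0, _ => 0
  | 1, a => D (a 0)
  | 2, a => D (μ (a 0) (a 1)) - μ (D (a 0)) (a 1) - μ (τ (a 0)) (D (a 1))
  | n + 3, a =>
      D (gammaOp μ (n + 2) a)
      - μ (D (gammaOp μ (n + 1) (fun i => a i.castSucc))) (a (Fin.last (n + 2)))
      - μ (τ (a 0)) (D (gammaOp μ (n + 1) (fun i => a i.succ)))
      + μ (μ (τ (a 0)) (D (gammaOp μ n (fun i => a i.castSucc.succ)))) (a (Fin.last (n + 2)))

end Construction

/-! ## Hochschild cochains -/

section Hochschild

variable (K : Type*) [Field K] (A : Type*) [Ring A] [Algebra K A]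

/-- Hochschild `n`-cochains: `C^n(A, A) = Hom(A^{⊗ n}, A)`, i.e. multilinear maps in `n`
arguments. -/
abbrev Cochain (n : ℕ) : Type _ := MultilinearMap K (fun _ : Fin n => A) A

variable {K A}

/-- The arguments of `f` in `f ∘_i g`. -/
def compArgs {p q r : ℕ} (h : r + 1 = p + q) (g : Cochain K A q) (i : Fin p) (a : Fin r → A)
    (l : Fin p) : A :=
  if _hl : l < i then a ⟨l, by omega⟩
  else if _hl' : l = i then g (fun s => a ⟨i + s, by omega⟩)
  else a ⟨l + q - 1, by omega⟩

lemma compArgs_update {p q r : ℕ} (h : r + 1 = p + q) (g : Cochain K A q) (i : Fin p)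
    (a : Fin r → A) (t : Fin r) :
    ∃ (l : Fin p) (φ : A →ₗ[K] A), ∀ x : A,
      compArgs h g i (Function.update a t x) = Function.update (compArgs h g i a) l (φ x) := by
  by_cases h1 : (t : ℕ) < i
  · refine ⟨⟨t, by omega⟩, LinearMap.id, fun x => ?_⟩
    funext l
    by_cases e : l = ⟨t, by omega⟩
    · subst e
      simp [compArgs, Fin.lt_def, h1]
    · have e' : (l : ℕ) ≠ t := fun hh => e (Fin.ext hh)
      rw [Function.update_of_ne e]
      unfold compArgs
      split_ifs with h2 h3
      · exact Function.update_of_ne (fun hh => e' (congrArg Fin.val hh)) _ _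
      · congr 1
        funext s
        refine Function.update_of_ne (fun hh => ?_) _ _
        have := congrArg Fin.val hh
        simp at this
        omega
      · refine Function.update_of_ne (fun hh => ?_) _ _
        have := congrArg Fin.val hh
        simp only [Fin.lt_def, Fin.ext_iff] at this h2 h3
        omega
  · by_cases h1' : (t : ℕ) < i + q
    · refine ⟨i, g.toLinearMap (fun s => a ⟨i + s, by omega⟩) ⟨t - i, by omega⟩, fun x => ?_⟩
      funext l
      by_cases e : l = i
      · subst e
        simp only [compArgs, lt_irrefl, dite_false, dite_true, Function.update_self,
          MultilinearMap.toLinearMap_apply]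
        congr 1
        funext s
        by_cases es : s = ⟨t - l, by omega⟩
        · subst es
          rw [Function.update_self]
          have : (⟨(l : ℕ) + ((t : ℕ) - l), by omega⟩ : Fin r) = t := Fin.ext (by simp; omega)
          simp only [this, Function.update_self]
        · rw [Function.update_of_ne es]
          refine Function.update_of_ne (fun hh => es (Fin.ext ?_)) _ _
          have := congrArg Fin.val hh
          simp at this ⊢
          omega
      · rw [Function.update_of_ne e]
        have e' : (l : ℕ) ≠ i := fun hh => e (Fin.ext hh)
        unfold compArgs
        split_ifs with h2
        · refine Function.update_of_ne (fun hh => ?_) _ _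
          have := congrArg Fin.val hh
          simp only [Fin.lt_def] at this h2
          omega
        · refine Function.update_of_ne (fun hh => ?_) _ _
          have := congrArg Fin.val hh
          simp only [Fin.lt_def] at this h2
          omega
    · refine ⟨⟨t + 1 - q, by omega⟩, LinearMap.id, fun x => ?_⟩
      funext l
      by_cases e : l = ⟨t + 1 - q, by omega⟩
      · subst e
        rw [Function.update_self]
        unfold compArgs
        rw [dif_neg (by simp only [Fin.lt_def]; omega),
          dif_neg (by simp only [Fin.ext_iff]; omega)]
        have : (⟨((t : ℕ) + 1 - q) + q - 1, by omega⟩ : Fin r) = t := Fin.ext (by simp; omega)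
        simp only [this, Function.update_self, LinearMap.id_apply]
      · rw [Function.update_of_ne e]
        have e' : (l : ℕ) ≠ t + 1 - q := fun hh => e (Fin.ext hh)
        unfold compArgs
        split_ifs with h2 h3
        · refine Function.update_of_ne (fun hh => ?_) _ _
          have := congrArg Fin.val hh
          simp only [Fin.lt_def] at this h2
          omega
        · congr 1
          funext s
          refine Function.update_of_ne (fun hh => ?_) _ _
          have := congrArg Fin.val hh
          simp at this
          omega
        · refine Function.update_of_ne (fun hh => ?_) _ _
          have := congrArg Fin.val hh
          simp only [Fin.lt_def, Fin.ext_iff] at this h2 h3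
          omega

/-- The partial composition `f ∘_i g`:
`(f ∘_i g)(a) = f(a_0, …, a_{i-1}, g(a_i, …, a_{i+q-1}), a_{i+q}, …)`. It has
`r = p + q - 1` arguments. -/
def compAt {p q r : ℕ} (h : r + 1 = p + q) (f : Cochain K A p) (g : Cochain K A q) (i : Fin p) :
    Cochain K A r where
  toFun a := f (compArgs h g i a)
  map_update_add' := by
    intro _ a t x y
    obtain rfl := Subsingleton.elim ‹DecidableEq (Fin r)› (instDecidableEqFin r)
    obtain ⟨l, φ, hφ⟩ := compArgs_update h g i a t
    simp [hφ]
  map_update_smul' := by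
    intro _ a t c x
    obtain rfl := Subsingleton.elim ‹DecidableEq (Fin r)› (instDecidableEqFin r)
    obtain ⟨l, φ, hφ⟩ := compArgs_update h g i a t
    simp [hφ]

/-- Gerstenhaber's `f ∘ g = ∑_i (-1)^{i (q-1)} f ∘_i g` (with `(-1)^{q-1} = (-1)^{q+1}`). -/
def circ {p q r : ℕ} (h : r + 1 = p + q) (f : Cochain K A p) (g : Cochain K A q) :
    Cochain K A r :=
  ∑ i : Fin p, ((-1 : K) ^ ((i : ℕ) * (q + 1))) • compAt h f g i

/-- The Gerstenhaber bracket `[f, g] = f ∘ g - (-1)^{(p-1)(q-1)} g ∘ f`, of degree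
`r = p + q - 1`. -/
def gerstenhaber {p q r : ℕ} (h : r + 1 = p + q) (f : Cochain K A p) (g : Cochain K A q) :
    Cochain K A r :=
  circ h f g - ((-1 : K) ^ ((p + 1) * (q + 1))) • circ (h.trans (Nat.add_comm p q)) g f

variable (K A)

/-- The multiplication of `A` as a `2`-cochain. -/
def mulCochain : Cochain K A 2 := MultilinearMap.mkPiAlgebraFin K 2 A

/-- The cup product `(f ⌣ g)(a) = f(a_0, …, a_{p-1}) g(a_p, …, a_{p+q-1})`. -/
def cup (p q : ℕ) : Cochain K A p →ₗ[K] Cochain K A q →ₗ[K] Cochain K A (p + q) :=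
  LinearMap.mk₂ K
    (fun f g => ((LinearMap.mul' K A).compMultilinearMap (f.domCoprod g)).domDomCongr
      finSumFinEquiv)
    (by intro f f' g; ext a; simp [add_mul])
    (by intro c f g; ext a; simp)
    (by intro f g g'; ext a; simp [mul_add])
    (by intro c f g; ext a; simp)

lemma cup_apply {p q : ℕ} (f : Cochain K A p) (g : Cochain K A q) (a : Fin (p + q) → A) :
    cup K A p q f g a =
      f (fun i => a (Fin.castAdd q i)) * g (fun i => a (Fin.natAdd p i)) := by
  simp [cup]

/-- `(a_0, …, a_n) ↦ a_0 f(a_1, …, a_n)` -/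
def leftAct {n : ℕ} (f : Cochain K A n) : Cochain K A (n + 1) :=
  (cup K A 1 n (MultilinearMap.mkPiAlgebraFin K 1 A) f).domDomCongr (finCongr (Nat.add_comm 1 n))

/-- `(a_0, …, a_n) ↦ f(a_0, …, a_{n-1}) a_n` -/
def rightAct {n : ℕ} (f : Cochain K A n) : Cochain K A (n + 1) :=
  cup K A n 1 f (MultilinearMap.mkPiAlgebraFin K 1 A)

lemma leftAct_apply {n : ℕ} (f : Cochain K A n) (a : Fin (n + 1) → A) :
    leftAct K A f a = a 0 * f (fun i => a i.succ) := by
  simp only [leftAct, MultilinearMap.domDomCongr_apply, cup_apply,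
    MultilinearMap.mkPiAlgebraFin_apply]
  simp only [List.ofFn_succ, List.ofFn_zero, List.prod_cons, List.prod_nil, mul_one]
  congr 2
  funext i
  congr 1
  ext
  simp

lemma rightAct_apply {n : ℕ} (f : Cochain K A n) (a : Fin (n + 1) → A) :
    rightAct K A f a = f (fun i => a i.castSucc) * a (Fin.last n) := by
  simp only [rightAct, cup_apply, MultilinearMap.mkPiAlgebraFin_apply]
  simp only [List.ofFn_succ, List.ofFn_zero, List.prod_cons, List.prod_nil, mul_one]
  rfl

/-- The Hochschild coboundary
`(δ f)(a_0, …, a_n) = a_0 f(a_1, …, a_n) + ∑_i (-1)^{i+1} f(…, a_i a_{i+1}, …)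
  + (-1)^{n+1} f(a_0, …, a_{n-1}) a_n`. -/
def hochD (n : ℕ) : Cochain K A n →ₗ[K] Cochain K A (n + 1) where
  toFun f := leftAct K A f
    + ∑ i : Fin n, ((-1 : K) ^ ((i : ℕ) + 1)) • compAt (p := n) (q := 2) (r := n + 1) rfl f (mulCochain K A) i
    + ((-1 : K) ^ (n + 1)) • rightAct K A f
  map_add' f g := by
    ext a
    simp [leftAct_apply, rightAct_apply, compAt, mul_add, add_mul, Finset.sum_add_distrib]
    abel
  map_smul' c f := by
    ext a
    simp [leftAct_apply, rightAct_apply, compAt, Finset.smul_sum, smul_comm c]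

/-- Hochschild cocycles. -/
def cocycles (n : ℕ) : Submodule K (Cochain K A n) := LinearMap.ker (hochD K A n)

/-- Hochschild coboundaries. -/
def coboundaries : (n : ℕ) → Submodule K (Cochain K A n)
  | 0 => ⊥
  | n + 1 => LinearMap.range (hochD K A n)

/-- Hochschild cohomology `HH^n(A, A)`. -/
abbrev HH (n : ℕ) : Type _ := cocycles K A n ⧸ (coboundaries K A n).submoduleOf (cocycles K A n)

/-- Normalized cochains: those that vanish as soon as one argument is `1`. -/
def normalized (n : ℕ) : Submodule K (Cochain K A n) where
  carrier := {f | ∀ a : Fin n → A, (∃ i, a i = 1) → f a = 0}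
  add_mem' := by
    intro f g hf hg a ha
    simp [hf a ha, hg a ha]
  zero_mem' := by
    intro a _
    simp
  smul_mem' := by
    intro c f hf a ha
    simp [hf a ha]

/-- The inclusion of the normalized cochains into all cochains, on total spaces. -/
def inclNormalized : (⨁ n, normalized K A n) →ₗ[K] (⨁ n, Cochain K A n) :=
  DirectSum.lmap (fun n => (normalized K A n).subtype)

variable {K A}

/-- `x` is a (total) cocycle whose cohomology class is `c`. -/
def IsClassOf (x : ⨁ n, Cochain K A n) (c : ⨁ n, HH K A n) : Prop :=
  ∃ z : ⨁ n, cocycles K A n,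
    DirectSum.lmap (fun n => (cocycles K A n).subtype) z = x ∧
    DirectSum.lmap (fun n => ((coboundaries K A n).submoduleOf (cocycles K A n)).mkQ) z = c

variable (K A)

/-- The cup product on the total space of cochains. -/
def cupTotal : (⨁ n, Cochain K A n) →ₗ[K] (⨁ n, Cochain K A n) →ₗ[K] (⨁ n, Cochain K A n) :=
  DirectSum.toModule K ℕ _ fun p =>
    (DirectSum.toModule K ℕ _ fun q =>
      ((cup K A p q).compr₂ (DirectSum.lof K ℕ (fun n => Cochain K A n) (p + q))).flip).flip

variable {K A}
variable (B : LinearMap.BilinForm K A)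

/-- The form `(a_0, …, a_n) ↦ ∑_i (-1)^{(i+1) n} ⟨f(a_i, …, a_n, a_0, …, a_{i-1}), 1⟩`
(the index `l + i` is taken modulo `n + 1`). -/
def cyclicSum (n : ℕ) (f : Cochain K A (n + 1)) : MultilinearMap K (fun _ : Fin (n + 1) => A) K :=
  ∑ i : Fin (n + 1), ((-1 : K) ^ (((i : ℕ) + 1) * n)) •
    ((B.flip 1).compMultilinearMap f).domDomCongr (Equiv.addRight i)

lemma cyclicSum_apply (n : ℕ) (f : Cochain K A (n + 1)) (a : Fin (n + 1) → A) :
    cyclicSum B n f a =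
      ∑ i : Fin (n + 1), ((-1 : K) ^ (((i : ℕ) + 1) * n)) * B (f (fun l => a (l + i))) 1 := by
  simp [cyclicSum]

variable [FiniteDimensional K A] (hB : B.Nondegenerate)

/-- The dualized Connes operator `Δ : C^{n+1}(A, A) → C^n(A, A)`, characterized by
`⟨(Δ f)(a_0, …, a_{n-1}), a_n⟩ = ∑_i (-1)^{(i+1) n} ⟨f(a_i, …, a_n, a_0, …, a_{i-1}), 1⟩`. -/
def connes (n : ℕ) : Cochain K A (n + 1) →ₗ[K] Cochain K A n where
  toFun f := (B.toDual hB).symm.toLinearMap.compMultilinearMap (cyclicSum B n f).curryRight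
  map_add' f g := by
    ext a
    simp only [LinearMap.compMultilinearMap_apply, add_apply,
      LinearEquiv.coe_coe, ← map_add]
    congr 1
    ext x
    simp [cyclicSum_apply, mul_add, Finset.sum_add_distrib]
  map_smul' c f := by
    ext a
    simp only [LinearMap.compMultilinearMap_apply, smul_apply,
      LinearEquiv.coe_coe, RingHom.id_apply, ← map_smul]
    congr 1
    ext x
    simp [cyclicSum_apply, Finset.mul_sum, mul_left_comm]

lemma connes_spec (n : ℕ) (f : Cochain K A (n + 1)) (a : Fin (n + 1) → A) :
    B (connes B hB n f (fun i => a i.castSucc)) (a (Fin.last n)) =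
      ∑ i : Fin (n + 1), ((-1 : K) ^ (((i : ℕ) + 1) * n)) * B (f (fun l => a (l + i))) 1 := by
  rw [← cyclicSum_apply]
  simp only [connes, LinearMap.coe_mk, AddHom.coe_mk, LinearMap.compMultilinearMap_apply,
    LinearEquiv.coe_coe, LinearMap.BilinForm.apply_toDual_symm_apply,
    MultilinearMap.curryRight_apply]
  congr 1
  exact Fin.snoc_init_self a

/-- `Δ` on the total space of cochains; it vanishes in degree `0`. -/
def connesTotal : (⨁ n, Cochain K A n) →ₗ[K] (⨁ n, Cochain K A n) :=
  DirectSum.toModule K ℕ _ fun n =>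
    match n with
    | 0 => 0
    | n + 1 => (DirectSum.lof K ℕ (fun n => Cochain K A n) n) ∘ₗ connes B hB n

/-- The operations `m_k` for the cup product and `Δ` on Hochschild cochains. -/
def hochOp (k : ℕ) (x : Fin k → ⨁ n, Cochain K A n) : ⨁ n, Cochain K A n :=
  mOp (cupTotal K A) (connesTotal B hB) (parity K (fun n => Cochain K A n)) k x

end Hochschild

end

end HochschildBV

/-! The operations `m_k` come from `Δ` by Möbius inversion over subwords: for a product `D` is
applied to, `D(a_x ⋯ a_{y-1})` is the sum over all nonempty consecutive subwords of τ(prefix) ·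
m(subword) · suffix (`sum_mWord`), where τ is the Koszul sign. In the quadratic relation the terms
whose outer `D` contains the inner value therefore add up to multiples of `D(D(word))`. In the other
terms the inner value stands outside `D`, as first or last letter, and these cancel by summation by
parts (`sum_mWord_mInsert`). Only associativity, `D 1 = 0`, the oddness of `D` and `D² = 0` on the
words involved are used.

On normalized cochains `Δ² = 0`: in the form, `Δ(Δ f)` pairs `Δ f` with `1`, which puts a `1` among
the arguments of `f` (`connes_connes`). This gives the structure on normalized cochains. For
cohomology, cocycles form a subalgebra in which coboundaries are an ideal, and `Δ` anticommutes with
`δ` (`hochD_connes`: after dualization, both composites sum the same merges of neighbours on a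
circle of letters, and the remaining terms telescope). So the `m_k` descend. Every class has a
normalized representative, because coboundaries of codegeneracies of a cochain can be subtracted to
remove its values on words with a `1`, position by position (`normalize_step`). Hence the relations
pass to cohomology.

For the bracket, the rotations in `Δ(f ⌣ g)` split according to whether the last letter falls into
`f` or `g`. For cocycles, summing partial rotations of the compositions `g ∘_j f` gives a cochain
whose coboundary compares the half belonging to `g` with `g ∘ f` and `f ⌣ Δ g`
(`dualD_homotopyForm`). Adding the two halves, and using that the cup product of cocycles commutes
up to a coboundary (`ev_hochD_circ`), identifies the deviation of `Δ` from a derivation with the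
bracket (`exists_connes_cup_eq`). -/

namespace HochschildBV

noncomputable section

/-! ## The quadratic relations for the operations `m_n` -/

section Words

variable {W : Type*} [Ring W]

/-- The product `a_i a_{i+1} ⋯ a_{j-1}`. -/
def wordProd (a : ℕ → W) (i j : ℕ) : W := ((List.Ico i j).map a).prod

lemma wordProd_of_le (a : ℕ → W) {i j : ℕ} (h : j ≤ i) : wordProd a i j = 1 := by
  simp [wordProd, List.Ico.eq_nil_of_le h]

lemma wordProd_succ (a : ℕ → W) {i j : ℕ} (h : i ≤ j) :
    wordProd a i (j + 1) = wordProd a i j * a j := by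
  simp [wordProd, List.Ico.succ_top h]

lemma wordProd_eq_mul (a : ℕ → W) {i j : ℕ} (h : i < j) :
    wordProd a i j = a i * wordProd a (i + 1) j := by
  simp [wordProd, List.Ico.eq_cons h]

lemma wordProd_mul (a : ℕ → W) {i j k : ℕ} (h : i ≤ j) (h' : j ≤ k) :
    wordProd a i j * wordProd a j k = wordProd a i k := by
  simp [wordProd, ← List.Ico.append_consecutive h h']

lemma wordProd_congr {a b : ℕ → W} {i j : ℕ} (h : ∀ l, i ≤ l → l < j → a l = b l) :
    wordProd a i j = wordProd b i j := by
  unfold wordProd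
  congr 1
  refine List.map_congr_left fun l hl => ?_
  rw [List.Ico.mem] at hl
  exact h l hl.1 hl.2

lemma wordProd_shift (a : ℕ → W) (s i j : ℕ) :
    wordProd (fun l => a (s + l)) i j = wordProd a (s + i) (s + j) := by
  rcases le_total j i with h | h
  · rw [wordProd_of_le _ h, wordProd_of_le _ (by omega)]
  · obtain ⟨k, rfl⟩ := Nat.exists_eq_add_of_le h
    clear h
    induction k with
    | zero => rw [wordProd_of_le _ (by omega), wordProd_of_le _ (by omega)]
    | succ k ih =>
      rw [← add_assoc, wordProd_succ _ (by omega), ih, ← add_assoc, ← add_assoc,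
        wordProd_succ _ (by omega), ← add_assoc]

lemma map_wordProd (τ : W → W) (h1 : τ 1 = 1) (hmul : ∀ x y, τ (x * y) = τ x * τ y)
    (a : ℕ → W) (i j : ℕ) : τ (wordProd a i j) = wordProd (fun l => τ (a l)) i j := by
  rcases le_total j i with h | h
  · rw [wordProd_of_le _ h, wordProd_of_le _ h, h1]
  · obtain ⟨k, rfl⟩ := Nat.exists_eq_add_of_le h
    clear h
    induction k with
    | zero => rw [wordProd_of_le _ (by omega), wordProd_of_le _ (by omega), h1]
    | succ k ih =>
      rw [← add_assoc, wordProd_succ _ (by omega), hmul, ih, wordProd_succ _ (by omega)]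

/-- Each summand is a mixed second difference of `F`, so both sums telescope. The vanishing on and
below the diagonal leaves only the corner. -/
lemma sum_triangle_telescope {M : Type*} [AddCommGroup M] (F : ℕ → ℕ → M)
    (hF : ∀ s e, e ≤ s → F s e = 0) {x y : ℕ} (h : x ≤ y) :
    ∑ s ∈ Finset.Ico x y, ∑ e ∈ Finset.Ico s y,
      (F s (e + 1) - F (s + 1) (e + 1) - F s e + F (s + 1) e) = F x y := by
  have inner : ∀ s ∈ Finset.Ico x y, ∑ e ∈ Finset.Ico s y,
      (F s (e + 1) - F (s + 1) (e + 1) - F s e + F (s + 1) e) = -(F (s + 1) y - F s y) := by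
    intro s hs
    have hs' : s ≤ y := (Finset.mem_Ico.1 hs).2.le
    have h1 := Finset.sum_Ico_sub (fun e => F s e) hs'
    have h2 := Finset.sum_Ico_sub (fun e => F (s + 1) e) hs'
    rw [hF s s le_rfl] at h1
    rw [hF (s + 1) s (by omega)] at h2
    calc _ = ∑ e ∈ Finset.Ico s y, (F s (e + 1) - F s e)
        - ∑ e ∈ Finset.Ico s y, (F (s + 1) (e + 1) - F (s + 1) e) := by
          rw [← Finset.sum_sub_distrib]
          exact Finset.sum_congr rfl fun _ _ => by abel
      _ = _ := by rw [h1, h2]; abel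
  rw [Finset.sum_congr rfl inner, Finset.sum_neg_distrib,
    Finset.sum_Ico_sub (fun s => F s y) h, hF y y le_rfl]
  abel

variable (D τ : W →+ W)

/-- The operation `m_{e-s}` on `a_s, …, a_{e-1}`. -/
def mWord (a : ℕ → W) (s e : ℕ) : W :=
  D (wordProd a s e) - τ (a s) * D (wordProd a (s + 1) e)
    - D (wordProd a s (e - 1)) * a (e - 1) + τ (a s) * D (wordProd a (s + 1) (e - 1)) * a (e - 1)

/-- The word obtained from `a_0 a_1 …` by applying `m_k` to `a_s, …, a_{s+k-1}`. -/
def mInsert (a : ℕ → W) (s k l : ℕ) : W :=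
  if l < s then τ (a l) else if l = s then mWord D τ a s (s + k) else a (l + k - 1)

variable {D τ}

lemma wordProd_mInsert_left (h1 : τ 1 = 1) (hmul : ∀ x y, τ (x * y) = τ x * τ y)
    (a : ℕ → W) (s k x : ℕ) : wordProd (mInsert D τ a s k) x s = τ (wordProd a x s) := by
  rw [map_wordProd τ h1 hmul]
  exact wordProd_congr fun l _ hl => by simp [mInsert, hl]

lemma wordProd_mInsert_right (a : ℕ → W) (s k m : ℕ) (hk : 1 ≤ k) :
    wordProd (mInsert D τ a s k) (s + 1) (s + 1 + m) = wordProd a (s + k) (s + k + m) := by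
  have := wordProd_shift a (k - 1) (s + 1) (s + 1 + m)
  rw [show k - 1 + (s + 1) = s + k by omega, show k - 1 + (s + 1 + m) = s + k + m by omega] at this
  rw [← this]
  refine wordProd_congr fun l hl _ => ?_
  rw [mInsert, if_neg (by omega), if_neg (by omega)]
  congr 1
  omega

lemma wordProd_mInsert (h1 : τ 1 = 1) (hmul : ∀ x y, τ (x * y) = τ x * τ y)
    (a : ℕ → W) (s k m x : ℕ) (hk : 1 ≤ k) (hx : x ≤ s) :
    wordProd (mInsert D τ a s k) x (s + 1 + m) =
      τ (wordProd a x s) * mWord D τ a s (s + k) * wordProd a (s + k) (s + k + m) := by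
  rw [← wordProd_mul _ (show x ≤ s + 1 by omega) (show s + 1 ≤ s + 1 + m by omega),
    wordProd_succ _ hx, wordProd_mInsert_left h1 hmul, wordProd_mInsert_right _ _ _ _ hk]
  simp [mInsert]

/-- Conjugating `D` by the products: the operations `m_n` recover `D` of a product. -/
lemma sum_mWord (h1 : τ 1 = 1) (hmul : ∀ x y, τ (x * y) = τ x * τ y) (hD1 : D 1 = 0)
    (a : ℕ → W) {x y : ℕ} (h : x ≤ y) :
    ∑ s ∈ Finset.Ico x y, ∑ e ∈ Finset.Ico s y,
      τ (wordProd a x s) * mWord D τ a s (e + 1) * wordProd a (e + 1) y = D (wordProd a x y) := by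
  -- Multiplicativity of `τ` makes the summand the mixed second difference of prefix · `D`(middle) ·
  -- suffix.
  have key := sum_triangle_telescope
    (fun s e => τ (wordProd a x s) * D (wordProd a s e) * wordProd a e y)
    (fun s e hse => by simp [wordProd_of_le a hse, hD1]) h
  rw [wordProd_of_le a le_rfl, wordProd_of_le a le_rfl, h1, one_mul, mul_one] at key
  rw [← key]
  refine Finset.sum_congr rfl fun s hs => Finset.sum_congr rfl fun e he => ?_
  rw [Finset.mem_Ico] at hs he
  rw [wordProd_succ a hs.1, hmul, wordProd_eq_mul a he.2, mWord, Nat.add_sub_cancel]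
  noncomm_ring

/-- The four terms of the outer operation drop the first letter, the last letter, both or neither
from the argument of `D`. The case distinctions record when the dropped letter is the inner value
itself, which happens for `s = 0` and for `e = n`. The sign in the case `e = n` comes from moving
`D` past `τ`. -/
lemma mWord_mInsert (h1 : τ 1 = 1) (hmul : ∀ x y, τ (x * y) = τ x * τ y) (hD1 : D 1 = 0)
    (hDτ : ∀ x, D (τ x) = - τ (D x)) (a : ℕ → W) {n s e : ℕ} (hse : s ≤ e) (hen : e ≤ n) :
    mWord D τ (mInsert D τ a s (e + 1 - s)) 0 (s + 1 + (n - e)) =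
      D (τ (wordProd a 0 s) * mWord D τ a s (e + 1) * wordProd a (e + 1) (n + 1))
      - (if s = 0 then τ (mWord D τ a 0 (e + 1)) *
          (D (wordProd a (e + 1) (n + 1)) - D (wordProd a (e + 1) n) * a n)
        else τ (τ (a 0)) *
          D (τ (wordProd a 1 s) * mWord D τ a s (e + 1) * wordProd a (e + 1) (n + 1)))
      + (if e = n then
          τ (D (wordProd a 0 s) - τ (a 0) * D (wordProd a 1 s)) * mWord D τ a s (n + 1)
        else - (D (τ (wordProd a 0 s) * mWord D τ a s (e + 1) * wordProd a (e + 1) n) * a n))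
      + (if 1 ≤ s ∧ e < n then τ (τ (a 0)) *
          D (τ (wordProd a 1 s) * mWord D τ a s (e + 1) * wordProd a (e + 1) n) * a n
        else 0) := by
  have hk : s + (e + 1 - s) = e + 1 := by omega
  have hP : ∀ x ≤ s, ∀ m, wordProd (mInsert D τ a s (e + 1 - s)) x (s + 1 + m) =
      τ (wordProd a x s) * mWord D τ a s (e + 1) * wordProd a (e + 1) (e + 1 + m) := by
    intro x hx m
    rw [wordProd_mInsert h1 hmul a s _ m x (by omega) hx, hk]
  have hR : ∀ m, wordProd (mInsert D τ a s (e + 1 - s)) (s + 1) (s + 1 + m) =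
      wordProd a (e + 1) (e + 1 + m) := by
    intro m
    rw [wordProd_mInsert_right a s _ m (by omega), hk]
  have hL : ∀ x, wordProd (mInsert D τ a s (e + 1 - s)) x s = τ (wordProd a x s) :=
    fun x => wordProd_mInsert_left h1 hmul a s _ x
  have hmid : mInsert D τ a s (e + 1 - s) s = mWord D τ a s (e + 1) := by
    simp [mInsert, hk]
  generalize hb : mInsert D τ a s (e + 1 - s) = b at *
  rcases Nat.eq_zero_or_pos s with rfl | hs
  · rw [mWord, hP 0 le_rfl, zero_add, hR, hmid, show e + 1 + (n - e) = n + 1 by omega,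
      Nat.add_sub_cancel_left]
    rcases hen.eq_or_lt with rfl | hlt
    · rw [Nat.sub_self, hL]
      simp only [wordProd_of_le _ (le_refl _), wordProd_of_le _ (Nat.zero_le _), h1, hD1,
        wordProd_of_le _ (Nat.le_succ _), hmid]
      simp
    · obtain ⟨k, hk⟩ : ∃ k, n = e + 1 + k := ⟨n - e - 1, by omega⟩
      rw [show n - e = 0 + 1 + k by omega, hP 0 le_rfl]
      have : b (0 + 1 + k) = a n := by
        rw [← hb, mInsert, if_neg (by omega), if_neg (by omega)]
        congr 1
        omega
      have hR' := hR k
      rw [zero_add] at hR'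
      rw [this, zero_add, hR', ← hk, if_pos rfl, if_neg (by omega), if_neg (by omega)]
      noncomm_ring
  · have hb0 : b 0 = τ (a 0) := by rw [← hb, mInsert, if_pos hs]
    rw [mWord, hP 0 (Nat.zero_le _), zero_add, hP 1 hs, hb0,
      show e + 1 + (n - e) = n + 1 by omega, if_neg (by omega)]
    rcases hen.eq_or_lt with rfl | hlt
    · rw [Nat.sub_self, add_zero, Nat.add_sub_cancel, hL, hL, hmid, if_pos rfl, if_neg (by omega),
        hDτ, hDτ, map_sub, hmul]
      noncomm_ring
    · obtain ⟨k, hk⟩ : ∃ k, n = e + 1 + k := ⟨n - e - 1, by omega⟩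
      have : b (s + 1 + k) = a n := by
        rw [← hb, mInsert, if_neg (by omega), if_neg (by omega)]
        congr 1
        omega
      rw [show s + 1 + (n - e) - 1 = s + 1 + k by omega, hP 0 (Nat.zero_le _), hP 1 hs, this,
        ← hk, if_neg (by omega), if_pos ⟨hs, hlt⟩]
      noncomm_ring

/-- Summation by parts: the increment of `G s * H s` is `M₁ s * H (s + 1) - G s * M₂ s`, since the
terms with `b` and `c` cancel, and both end values vanish. -/
lemma sum_range_telescope_mul (G H M₁ M₂ : ℕ → W) (b c : ℕ → W) (n : ℕ) (hG : G 0 = 0)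
    (hH : H n = 0) (hM₁ : ∀ e < n, M₁ e = G (e + 1) - G e * b e)
    (hM₂ : ∀ s < n, M₂ s = H s - c s * H (s + 1)) (hbc : ∀ s < n, b s = c s) :
    ∑ s ∈ Finset.range n, G s * M₂ s = ∑ e ∈ Finset.range n, M₁ e * H (e + 1) := by
  have := Finset.sum_range_sub (fun s => G s * H s) n
  rw [hG, hH, mul_zero, zero_mul, sub_zero] at this
  rw [← sub_eq_zero, ← Finset.sum_sub_distrib, ← neg_eq_zero, ← Finset.sum_neg_distrib, ← this]
  refine Finset.sum_congr rfl fun s hs => ?_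
  rw [Finset.mem_range] at hs
  rw [hM₁ s hs, hM₂ s hs, hbc s hs]
  noncomm_ring

theorem sum_mWord_mInsert (h1 : τ 1 = 1) (hmul : ∀ x y, τ (x * y) = τ x * τ y) (hD1 : D 1 = 0)
    (hDτ : ∀ x, D (τ x) = - τ (D x)) (a : ℕ → W)
    (hDD : ∀ i j, D (D (wordProd a i j)) = 0) (n : ℕ) :
    ∑ s ∈ Finset.Ico 0 (n + 1), ∑ e ∈ Finset.Ico s (n + 1),
      mWord D τ (mInsert D τ a s (e + 1 - s)) 0 (s + 1 + (n - e)) = 0 := by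
  -- The terms with the inner value inside the outer `D` assemble, by `sum_mWord`, to `D` applied
  -- twice to a word.
  have hsum : ∀ x y, x ≤ y → ∑ s ∈ Finset.Ico x y, ∑ e ∈ Finset.Ico s y,
      D (τ (wordProd a x s) * mWord D τ a s (e + 1) * wordProd a (e + 1) y) = 0 := by
    intro x y hxy
    simp only [← map_sum, sum_mWord h1 hmul hD1 a hxy, hDD]
  have hlast : ∀ x ≤ n, ∀ F G : ℕ → ℕ → W,
      ∑ s ∈ Finset.Ico x (n + 1), ∑ e ∈ Finset.Ico s (n + 1), (if e = n then F s e else G s e) =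
      ∑ s ∈ Finset.Ico x (n + 1), F s n
        + ∑ s ∈ Finset.Ico x n, ∑ e ∈ Finset.Ico s n, G s e := by
    intro x hx F G
    rw [Finset.sum_Ico_succ_top hx (fun s => F s n), add_assoc,
      Finset.sum_Ico_succ_top hx,
      Finset.sum_congr rfl (g := fun s => F s n + ∑ e ∈ Finset.Ico s n, G s e),
      Finset.sum_add_distrib]
    · rw [Nat.Ico_succ_singleton, Finset.sum_singleton, if_pos rfl]
      abel
    · intro s hs
      rw [Finset.mem_Ico] at hs
      rw [Finset.sum_Ico_succ_top (by omega), if_pos rfl, add_comm]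
      congr 1
      refine Finset.sum_congr rfl fun e he => if_neg ?_
      rw [Finset.mem_Ico] at he
      omega
  have hfirst : ∀ y, 0 < y → ∀ F G : ℕ → ℕ → W,
      ∑ s ∈ Finset.Ico 0 y, ∑ e ∈ Finset.Ico s y, (if s = 0 then F s e else G s e) =
      ∑ e ∈ Finset.Ico 0 y, F 0 e + ∑ s ∈ Finset.Ico 1 y, ∑ e ∈ Finset.Ico s y, G s e := by
    intro y hy F G
    rw [Finset.sum_eq_sum_Ico_succ_bot hy]
    congr 1
    refine Finset.sum_congr rfl fun s hs => Finset.sum_congr rfl fun e he => if_neg ?_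
    rw [Finset.mem_Ico] at hs
    omega
  -- Without `s = 0` and `e = n` the summation range is exactly the set of subwords of `a_1 ⋯
  -- a_{n-1}`, so `hsum` applies to that shorter word.
  have hboth : ∑ s ∈ Finset.Ico 0 (n + 1), ∑ e ∈ Finset.Ico s (n + 1),
      (if 1 ≤ s ∧ e < n then τ (τ (a 0)) *
          D (τ (wordProd a 1 s) * mWord D τ a s (e + 1) * wordProd a (e + 1) n) * a n
        else 0) = 0 := by
    have e1 : ∀ s e : ℕ, e ∈ Finset.Ico s (n + 1) → (if 1 ≤ s ∧ e < n then τ (τ (a 0)) *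
          D (τ (wordProd a 1 s) * mWord D τ a s (e + 1) * wordProd a (e + 1) n) * a n
        else 0) = if e = n then 0 else if s = 0 then 0 else τ (τ (a 0)) *
          D (τ (wordProd a 1 s) * mWord D τ a s (e + 1) * wordProd a (e + 1) n) * a n := by
      intro s e he
      rw [Finset.mem_Ico] at he
      split_ifs <;> first | rfl | omega
    rw [Finset.sum_congr rfl fun s _ => Finset.sum_congr rfl fun e he => e1 s e he,
      hlast 0 (Nat.zero_le _), Finset.sum_const_zero, zero_add]
    rcases Nat.eq_zero_or_pos n with rfl | hn
    · simp
    · rw [hfirst n hn, Finset.sum_const_zero, zero_add]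
      simp only [← Finset.sum_mul, ← Finset.mul_sum, hsum 1 n hn, mul_zero, zero_mul]
  rw [Finset.sum_congr rfl fun s hs => Finset.sum_congr rfl fun e he =>
    mWord_mInsert (n := n) h1 hmul hD1 hDτ a (Finset.mem_Ico.1 he).1
      (Nat.lt_succ_iff.1 (Finset.mem_Ico.1 he).2)]
  simp only [Finset.sum_add_distrib, Finset.sum_sub_distrib]
  rw [hsum 0 _ (Nat.zero_le _), hboth, hfirst _ (Nat.succ_pos n), hlast 0 (Nat.zero_le _)]
  simp only [← Finset.sum_mul, ← Finset.mul_sum, Finset.sum_neg_distrib]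
  rw [hsum 0 n (Nat.zero_le _), hsum 1 (n + 1) (by omega)]
  simp only [Nat.Ico_zero_eq_range, mul_zero, zero_mul, neg_zero, add_zero, zero_sub]
  -- Two boundary sums are left: inner value as last letter, and inner value as first letter. Each
  -- inner value is a twisted difference of the factor appearing in the other sum, so summation by
  -- parts identifies them.
  rw [neg_add_eq_zero, eq_comm]
  refine sum_range_telescope_mul
    (fun s => τ (D (wordProd a 0 s) - τ (a 0) * D (wordProd a 1 s)))
    (fun e => D (wordProd a e (n + 1)) - D (wordProd a e n) * a n)
    _ _ (fun s => τ (a s)) (fun s => τ (a s)) (n + 1) ?_ ?_ ?_ ?_ fun _ _ => rfl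
  · simp [wordProd_of_le, hD1]
  · simp [wordProd_of_le, hD1]
  · intro e he
    rw [← hmul, ← map_sub]
    congr 1
    rw [mWord, Nat.add_sub_cancel, zero_add]
    noncomm_ring
  · intro s hs
    rw [mWord, Nat.add_sub_cancel]
    noncomm_ring

end Words

/-! ### The operations `mOp` as operations on words -/

section Operations

variable {K : Type*} [Field K] {W : Type*} [Ring W] [Module K W]

lemma gammaOp_eq_wordProd (μ : W →ₗ[K] W →ₗ[K] W) (hμ : ∀ x y, μ x y = x * y) (b : ℕ → W) (n : ℕ) :
    gammaOp μ n (fun l => b l) = wordProd b 0 (n + 1) := by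
  induction n with
  | zero => simp [gammaOp, wordProd]
  | succ n ih =>
    rw [gammaOp, hμ, wordProd_succ _ (Nat.zero_le _)]
    simp only [Fin.val_castSucc, Fin.val_last]
    rw [ih]

lemma gammaOp_eq_wordProd_shift (μ : W →ₗ[K] W →ₗ[K] W) (hμ : ∀ x y, μ x y = x * y) (b : ℕ → W)
    (n : ℕ) : gammaOp μ n (fun l => b (l + 1)) = wordProd b 1 (n + 2) := by
  rw [gammaOp_eq_wordProd μ hμ (fun l => b (l + 1))]
  have := wordProd_shift b 1 0 (n + 1)
  rw [show 1 + (n + 1) = n + 2 by omega] at this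
  rw [← this]
  exact wordProd_congr fun l _ _ => by rw [add_comm]

/-- One formula covers all lengths: empty products are `1`, so `D 1 = 0` kills the terms that are
missing from `m_1` and `m_2`. -/
lemma mOp_eq_mWord (μ : W →ₗ[K] W →ₗ[K] W) (hμ : ∀ x y, μ x y = x * y) (D τ : W →ₗ[K] W)
    (hD1 : D 1 = 0) (b : ℕ → W) (n : ℕ) (hn : 1 ≤ n) :
    mOp μ D τ n (fun l => b l) = mWord D.toAddMonoidHom τ.toAddMonoidHom b 0 n := by
  have w1 : ∀ i, wordProd b i (i + 1) = b i := fun i => by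
    rw [wordProd_succ _ le_rfl, wordProd_of_le _ le_rfl, one_mul]
  have w2 : ∀ i, wordProd b i (i + 2) = b i * b (i + 1) := fun i => by
    rw [wordProd_succ _ (by omega), w1]
  match n, hn with
  | 1, _ =>
    have := w1 0
    simp_all [mOp, mWord, wordProd_of_le]
  | 2, _ =>
    have := w1 0
    have := w1 1
    have := w2 0
    simp_all [mOp, mWord, wordProd_of_le]
    abel
  | n + 3, _ =>
    rw [mOp]
    simp only [Fin.val_castSucc, Fin.val_succ, Fin.val_last, Fin.val_zero]
    rw [gammaOp_eq_wordProd μ hμ, gammaOp_eq_wordProd μ hμ, gammaOp_eq_wordProd_shift μ hμ,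
      gammaOp_eq_wordProd_shift μ hμ, mWord]
    simp only [hμ, LinearMap.toAddMonoidHom_coe, zero_add]
    rw [show n + 3 - 1 = n + 2 by omega]
    abel

theorem sum_mOp_insert (μ : W →ₗ[K] W →ₗ[K] W) (hμ : ∀ x y, μ x y = x * y) (D τ : W →ₗ[K] W)
    (h1 : τ 1 = 1) (hmul : ∀ x y, τ (x * y) = τ x * τ y) (hD1 : D 1 = 0)
    (hDτ : ∀ x, D (τ x) = - τ (D x)) (a : ℕ → W)
    (hDD : ∀ i j, D (D (wordProd a i j)) = 0) (n : ℕ) (hn : 1 ≤ n) :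
    ∑ i ∈ Finset.range n, ∑ k ∈ Finset.Icc 1 (n - i),
      mOp μ D τ (i + 1 + (n - i - k)) (fun l => if (l : ℕ) < i then τ (a l) else
        if (l : ℕ) = i then mOp μ D τ k (fun r => a (i + r)) else a (l + k - 1)) = 0 := by
  obtain ⟨n, rfl⟩ : ∃ m, n = m + 1 := ⟨n - 1, by omega⟩
  rw [← sum_mWord_mInsert (D := D.toAddMonoidHom) (τ := τ.toAddMonoidHom) h1 hmul hD1 hDτ a hDD n,
    Nat.Ico_zero_eq_range]
  refine Finset.sum_congr rfl fun i hi => ?_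
  rw [Finset.mem_range] at hi
  -- The inner subword is recorded by its last index `e = i + k - 1` instead of its length `k`.
  refine Finset.sum_nbij' (fun k => i + k - 1) (fun e => e + 1 - i) ?_ ?_ ?_ ?_ ?_
  · intro k hk; simp only [Finset.mem_Icc, Finset.mem_Ico] at *; omega
  · intro k hk; simp only [Finset.mem_Icc, Finset.mem_Ico] at *; omega
  · intro k hk; simp only [Finset.mem_Icc] at *; omega
  · intro k hk; simp only [Finset.mem_Ico] at *; omega
  · intro k hk
    simp only [Finset.mem_Icc] at hk
    rw [mOp_eq_mWord μ hμ D τ hD1 (fun l => if l < i then τ (a l) else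
        if l = i then mOp μ D τ k (fun r => a (i + r)) else a (l + k - 1)) _ (by omega),
      mOp_eq_mWord μ hμ D τ hD1 (fun r => a (i + r)) k hk.1,
      show i + k - 1 + 1 - i = k by omega, show n - (i + k - 1) = n + 1 - i - k by omega]
    congr 1
    funext l
    simp only [mInsert, LinearMap.toAddMonoidHom_coe]
    split_ifs with h2 h3
    · rfl
    · obtain ⟨k, rfl⟩ : ∃ m, k = m + 1 := ⟨k - 1, by omega⟩
      simp only [mWord, Nat.add_sub_cancel, ← add_assoc]
      rw [wordProd_shift, wordProd_shift, wordProd_shift, wordProd_shift]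
      simp [add_assoc]
    · rfl

end Operations

/-! ## Cochains as functions of sequences -/

section Sequences

variable {K : Type*} [Field K] {A : Type*} [Ring A] [Algebra K A]

/-- The value of an `n`-cochain on the first `n` entries of a sequence. -/
def ev {n : ℕ} (f : Cochain K A n) (a : ℕ → A) : A := f (fun i => a i)

/-- The sequence `a_k, a_{k+1}, …`. -/
def shift {α : Type*} (k : ℕ) (a : ℕ → α) (l : ℕ) : α := a (k + l)

/-- The sequence with `a_i, …, a_{i+q-1}` replaced by the single entry `u`. -/
def blockAt {α : Type*} (q i : ℕ) (u : α) (a : ℕ → α) (l : ℕ) : α :=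
  if l < i then a l else if l = i then u else a (l + q - 1)

/-- The sequence with `a_i, a_{i+1}` replaced by their product. -/
def mergeAt {α : Type*} [Mul α] (i : ℕ) (a : ℕ → α) (l : ℕ) : α :=
  if l < i then a l else if l = i then a i * a (i + 1) else a (l + 1)

/-- The word `a_0 ⋯ a_{N-1}` with its last `t` letters moved to the front. -/
def rotate {α : Type*} (N t : ℕ) (a : ℕ → α) (l : ℕ) : α :=
  if l < t then a (N - t + l) else a (l - t)

/-- The part `∑_j (-1)^j F(…, a_j a_{j+1}, …)` of the Hochschild coboundary of a function of
`n` letters. -/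
def innerD {M : Type*} [AddCommGroup M] [Module K M] (n : ℕ) (F : (ℕ → A) → M) (a : ℕ → A) : M :=
  ∑ j ∈ Finset.range n, ((-1 : K) ^ j) • F (mergeAt j a)

lemma ev_congr {n : ℕ} (f : Cochain K A n) {a b : ℕ → A} (h : ∀ l < n, a l = b l) :
    ev f a = ev f b := by
  unfold ev
  congr 1
  funext i
  exact h i i.2

lemma cochain_ext {n : ℕ} {f g : Cochain K A n} (h : ∀ a, ev f a = ev g a) : f = g := by
  ext b
  have := h (fun l => if hl : l < n then b ⟨l, hl⟩ else 0)
  simpa [ev] using this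

@[simp] lemma ev_zero {n : ℕ} (a : ℕ → A) : ev (0 : Cochain K A n) a = 0 := rfl

@[simp] lemma ev_add {n : ℕ} (f g : Cochain K A n) (a : ℕ → A) :
    ev (f + g) a = ev f a + ev g a := rfl

@[simp] lemma ev_neg {n : ℕ} (f : Cochain K A n) (a : ℕ → A) : ev (-f) a = - ev f a := rfl

@[simp] lemma ev_sub {n : ℕ} (f g : Cochain K A n) (a : ℕ → A) :
    ev (f - g) a = ev f a - ev g a := rfl

@[simp] lemma ev_smul {n : ℕ} (c : K) (f : Cochain K A n) (a : ℕ → A) :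
    ev (c • f) a = c • ev f a := rfl

@[simp] lemma ev_sum {n : ℕ} {ι : Type*} (s : Finset ι) (f : ι → Cochain K A n) (a : ℕ → A) :
    ev (∑ i ∈ s, f i) a = ∑ i ∈ s, ev (f i) a := by
  simp [ev]

lemma ev_cup {p q : ℕ} (f : Cochain K A p) (g : Cochain K A q) (a : ℕ → A) :
    ev (cup K A p q f g) a = ev f a * ev g (shift p a) := by
  simp [ev, cup_apply, shift]

lemma ev_compAt {p q r : ℕ} (h : r + 1 = p + q) (f : Cochain K A p) (g : Cochain K A q)
    (i : Fin p) (a : ℕ → A) :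
    ev (compAt h f g i) a = ev f (blockAt q i (ev g (shift i a)) a) := by
  simp only [ev, compAt, MultilinearMap.coe_mk]
  congr 1
  funext l
  simp only [compArgs, blockAt, shift, Fin.lt_def, Fin.ext_iff]
  split_ifs <;> rfl

lemma ev_circ {p q r : ℕ} (h : r + 1 = p + q) (f : Cochain K A p) (g : Cochain K A q)
    (a : ℕ → A) :
    ev (circ h f g) a = ∑ i ∈ Finset.range p,
      ((-1 : K) ^ (i * (q + 1))) • ev f (blockAt q i (ev g (shift i a)) a) := by
  rw [circ, ev_sum, Finset.sum_range]
  simp only [ev_smul, ev_compAt]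

lemma ev_hochD {n : ℕ} (f : Cochain K A n) (a : ℕ → A) :
    ev (hochD K A n f) a = a 0 * ev f (shift 1 a) - innerD (K := K) n (ev f) a
      + ((-1 : K) ^ (n + 1)) • (ev f a * a n) := by
  have h1 : ev (leftAct K A f) a = a 0 * ev f (shift 1 a) := by
    simp only [ev, leftAct_apply, shift, Fin.val_zero, Fin.val_succ]
    congr 3
    funext i
    rw [add_comm]
  have h2 : ev (rightAct K A f) a = ev f a * a n := by
    simp only [ev, rightAct_apply, Fin.val_castSucc, Fin.val_last]
  have h3 : ∀ i : Fin n, ev (compAt (p := n) (q := 2) (r := n + 1) rfl f (mulCochain K A) i) a =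
      ev f (mergeAt i a) := by
    intro i
    rw [ev_compAt]
    congr 1
    funext l
    simp [blockAt, mergeAt, mulCochain, ev, shift, List.ofFn_succ]
  simp only [hochD, LinearMap.coe_mk, AddHom.coe_mk, ev_add, ev_smul, ev_sum, h1, h2, h3, innerD]
  rw [Finset.sum_range, sub_eq_add_neg, ← Finset.sum_neg_distrib]
  simp only [pow_succ, mul_neg_one, neg_smul]

lemma mem_normalized_iff {n : ℕ} {f : Cochain K A n} :
    f ∈ normalized K A n ↔ ∀ a : ℕ → A, ∀ i < n, a i = 1 → ev f a = 0 := by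
  constructor
  · intro h a i hi ha
    exact h _ ⟨⟨i, hi⟩, ha⟩
  · rintro h b ⟨i, hi⟩
    have := h (fun l => if hl : l < n then b ⟨l, hl⟩ else 0) i i.2 (by simpa using hi)
    simpa [ev] using this

variable (K A) in
/-- The unit of `A` as a `0`-cochain. -/
def oneCochain : Cochain K A 0 := MultilinearMap.constOfIsEmpty K _ 1

@[simp] lemma ev_oneCochain (a : ℕ → A) : ev (oneCochain K A) a = 1 := rfl

/-- Insertion of `1` at position `k`. -/
def insertOne {α : Type*} [One α] (k : ℕ) (a : ℕ → α) (l : ℕ) : α :=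
  if l < k then a l else if l = k then 1 else a (l - 1)

lemma insertOne_of_eq_one {a : ℕ → A} {k : ℕ} (h : a k = 1) :
    insertOne k (fun l => if l < k then a l else a (l + 1)) = a := by
  funext l
  unfold insertOne
  split_ifs with h1 h2
  · simp [h1]
  · rw [h2, h]
  · have h3 : ¬ l - 1 < k := by omega
    simp only [h3, if_false]
    congr 1; omega

/-- The cochain `(a_0, …, a_{n-1}) ↦ f(a_0, …, a_{k-1}, 1, a_k, …)`. -/
lemma exists_ev_insertOne {n : ℕ} (f : Cochain K A (n + 1)) {k : ℕ} (hk : k ≤ n) :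
    ∃ g : Cochain K A n, ∀ a, ev g a = ev f (insertOne k a) := by
  refine ⟨compAt (p := n + 1) (q := 0) (r := n) rfl f (oneCochain K A) ⟨k, by omega⟩, fun a => ?_⟩
  rw [ev_compAt]
  rfl

lemma neg_one_pow_congr' {m n : ℕ} (h : m % 2 = n % 2) : (-1 : K) ^ m = (-1) ^ n :=
  neg_one_pow_congr (by rw [Nat.even_iff, Nat.even_iff, h])

lemma neg_one_pow_eq_neg {m n : ℕ} (h : (m + 1) % 2 = n % 2) : (-1 : K) ^ m = - (-1) ^ n := by
  rw [← neg_one_pow_congr' h, pow_succ, mul_neg_one, neg_neg]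

end Sequences

/-! ### Cochains tested against the bilinear form, and rotations of words -/

section Form

variable {K : Type*} [Field K] {A : Type*} [Ring A] [Algebra K A]
variable {B : LinearMap.BilinForm K A}

lemma cochain_ext_form (hB : B.Nondegenerate) {n : ℕ} {f g : Cochain K A n}
    (h : ∀ a : ℕ → A, B (ev f a) (a n) = B (ev g a) (a n)) : f = g := by
  refine cochain_ext fun a => ?_
  rw [← sub_eq_zero]
  refine hB.1 _ fun x => ?_
  -- An `n`-cochain does not read the letter with index `n`, which is therefore free to be any test
  -- element.
  have := h (Function.update a n x)
  have e : ∀ f : Cochain K A n, ev f (Function.update a n x) = ev f a := fun f =>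
    ev_congr f fun l hl => Function.update_of_ne hl.ne _ _
  rw [e, e, Function.update_self] at this
  rw [map_sub, LinearMap.sub_apply, this, sub_self]

lemma ev_rotate {n : ℕ} (f : Cochain K A (n + 1)) (i : Fin (n + 1)) (a : ℕ → A) :
    f (fun l => a (l + i : Fin (n + 1))) = ev f (rotate (n + 1) (n + 1 - i) a) := by
  unfold ev
  congr 1
  funext l
  unfold rotate
  have hi := i.2
  have hl := l.2
  rw [Fin.val_add]
  split_ifs with h
  · rw [Nat.mod_eq_of_lt (by omega)]
    congr 1; omega
  · rw [Nat.mod_eq_sub_mod (by omega), Nat.mod_eq_of_lt (by omega)]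
    congr 1; omega

lemma sum_fin_eq_sum_Icc {M : Type*} [AddCommMonoid M] (n : ℕ) (F : ℕ → M) :
    ∑ i : Fin (n + 1), F (n + 1 - i) = ∑ t ∈ Finset.Icc 1 (n + 1), F t := by
  rw [← Finset.sum_range (fun i => F (n + 1 - i))]
  refine Finset.sum_nbij' (fun i => n + 1 - i) (fun t => n + 1 - t) ?_ ?_ ?_ ?_ fun _ _ => rfl
  all_goals
    intro i hi
    simp only [Finset.mem_range, Finset.mem_Icc] at *
    omega

variable [FiniteDimensional K A]

/-- Partial cyclic sums, dualized: the variant of the Connes operator with coefficients `c`. -/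
lemma exists_cyclic_cochain (hB : B.Nondegenerate) {n : ℕ} (f : Cochain K A (n + 1)) (c : ℕ → K) :
    ∃ g : Cochain K A n, ∀ a : ℕ → A, B (ev g a) (a n) =
      ∑ t ∈ Finset.Icc 1 (n + 1), c t * B (ev f (rotate (n + 1) t a)) 1 := by
  refine ⟨(B.toDual hB).symm.toLinearMap.compMultilinearMap (MultilinearMap.curryRight
    (∑ i : Fin (n + 1), c (n + 1 - i) •
      ((B.flip 1).compMultilinearMap f).domDomCongr (Equiv.addRight i))), fun a => ?_⟩
  rw [← sum_fin_eq_sum_Icc n (fun t => c t * B (ev f (rotate (n + 1) t a)) 1), ev]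
  simp only [LinearMap.compMultilinearMap_apply,
    LinearEquiv.coe_coe, LinearMap.BilinForm.apply_toDual_symm_apply,
    MultilinearMap.curryRight_apply]
  have : (Fin.snoc (fun i : Fin n => a i) (a n) : Fin (n + 1) → A) = fun i : Fin (n + 1) => a i :=
    Fin.snoc_init_self (fun i : Fin (n + 1) => a i)
  rw [this]
  simp [← ev_rotate]

/-- Moving the first `i` letters to the back is moving the last `t = n + 1 - i` letters to the
front. The signs agree because `n (n + 1)` is even. -/
lemma connes_ev (hB : B.Nondegenerate) {n : ℕ} (f : Cochain K A (n + 1)) (a : ℕ → A) :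
    B (ev (connes B hB n f) a) (a n) = (-1) ^ n *
      ∑ t ∈ Finset.Icc 1 (n + 1), (-1) ^ (t * n) * B (ev f (rotate (n + 1) t a)) 1 := by
  have := connes_spec B hB n f (fun i => a i)
  simp only [Fin.val_castSucc, Fin.val_last] at this
  rw [ev, this, ← sum_fin_eq_sum_Icc n (fun t => (-1) ^ (t * n) * B (ev f (rotate (n + 1) t a)) 1),
    Finset.mul_sum]
  refine Finset.sum_congr rfl fun i _ => ?_
  rw [ev_rotate, ← mul_assoc, ← pow_add]
  congr 1
  apply neg_one_pow_congr'
  have hi := i.2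
  generalize (i : ℕ) = j at hi
  obtain ⟨k, rfl⟩ : ∃ k, n = j + k := ⟨n - j, by omega⟩
  rw [show j + k + 1 - j = k + 1 by omega]
  have : (j + 1) * (j + k) + (j + k + (k + 1) * (j + k)) =
    2 * (j + k) + (j + k) * (j + k + 1) := by ring
  have h2 := (Nat.even_mul_succ_self (j + k)).two_dvd
  omega

end Form

/-! ## The cosimplicial structure and normalization -/

section Cosimplicial

variable {K : Type*} [Field K] {A : Type*} [Ring A] [Algebra K A]

/-- The `i`-th coface of a function of `n` letters. -/
def coface (n i : ℕ) (F : (ℕ → A) → A) (a : ℕ → A) : A :=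
  if i = 0 then a 0 * F (shift 1 a) else if i ≤ n then F (mergeAt (i - 1) a) else F a * a n

/-- `F` depends on the first `n` letters only. -/
def DependsOnFirst {M : Type*} (n : ℕ) (F : (ℕ → A) → M) : Prop :=
  ∀ a b : ℕ → A, (∀ l < n, a l = b l) → F a = F b

lemma ev_dependsOnFirst {n : ℕ} (f : Cochain K A n) : DependsOnFirst n (ev f) :=
  fun _ _ h => ev_congr f h

lemma ev_hochD_coface {n : ℕ} (f : Cochain K A n) (a : ℕ → A) :
    ev (hochD K A n f) a =
      ∑ i ∈ Finset.range (n + 2), ((-1 : K) ^ i) • coface n i (ev f) a := by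
  rw [ev_hochD, Finset.sum_range_succ, Finset.sum_range_succ']
  have h1 : coface n 0 (ev f) a = a 0 * ev f (shift 1 a) := by simp [coface]
  have h2 : coface n (n + 1) (ev f) a = ev f a * a n := by simp [coface]
  have h3 : ∑ i ∈ Finset.range n, ((-1 : K) ^ (i + 1)) • coface n (i + 1) (ev f) a =
      - innerD (K := K) n (ev f) a := by
    rw [innerD, ← Finset.sum_neg_distrib]
    refine Finset.sum_congr rfl fun i hi => ?_
    rw [Finset.mem_range] at hi
    rw [coface, if_neg (by omega), if_pos (by omega), pow_succ, mul_neg_one, neg_smul]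
    rfl
  rw [h1, h2, h3, pow_zero, one_smul]
  abel

lemma mergeAt_mergeAt (a : ℕ → A) {i j : ℕ} (h : i ≤ j) :
    mergeAt i (mergeAt (j + 1) a) = mergeAt j (mergeAt i a) := by
  funext l
  unfold mergeAt
  rcases h.eq_or_lt with rfl | h
  · grind [mul_assoc]
  · grind

/-- A cosimplicial identity. Associativity enters where two merges overlap or two outer factors
meet. -/
lemma coface_coface {n : ℕ} {F : (ℕ → A) → A} (hF : DependsOnFirst n F) {i j : ℕ} (hij : i ≤ j)
    (hj : j ≤ n + 1) :
    coface (n + 1) (j + 1) (coface n i F) = coface (n + 1) i (coface n j F) := by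
  funext a
  rcases Nat.eq_zero_or_pos i with rfl | hi
  · rcases hj.eq_or_lt with rfl | hj'
    · simp [coface, shift, mul_assoc, add_comm]
    · rw [coface, if_neg (by omega), if_pos (by omega), Nat.add_sub_cancel, coface, if_pos rfl,
        coface, if_pos rfl]
      rcases Nat.eq_zero_or_pos j with rfl | hj0
      · rw [coface, if_pos rfl]
        simp only [mergeAt, lt_irrefl, if_false, if_true, shift, zero_add, mul_assoc, add_zero]
        congr 3
        funext l
        simp [shift, mergeAt, add_comm, add_left_comm]
      · rw [coface, if_neg (by omega), if_pos (by omega)]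
        congr 1
        · simp [mergeAt, hj0]
        · congr 1
          funext l
          unfold shift mergeAt
          grind
  · rcases hj.eq_or_lt with rfl | hj'
    · rcases hij.eq_or_lt with rfl | hij'
      · rw [coface, if_neg (by omega), if_neg (by omega), coface, if_neg (by omega),
          if_neg (by omega), coface, if_neg (by omega), if_pos (by omega), coface,
          if_neg (by omega), if_neg (by omega), Nat.add_sub_cancel, mul_assoc]
        congr 1
        · exact hF _ _ fun l hl => by simp [mergeAt, hl]
        · simp [mergeAt]
      · rw [coface, if_neg (by omega), if_neg (by omega), coface, if_neg (by omega),
          if_pos (by omega), coface, if_neg (by omega), if_pos (by omega), coface,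
          if_neg (by omega), if_neg (by omega)]
        congr 1
        rw [mergeAt, if_neg (by omega), if_neg (by omega)]
    · rw [coface, if_neg (by omega), if_pos (by omega), coface, if_neg (by omega),
          if_pos (by omega), coface, if_neg (by omega), if_pos (by omega), coface,
          if_neg (by omega), if_pos (by omega), Nat.add_sub_cancel]
      congr 1
      have := mergeAt_mergeAt a (show i - 1 ≤ j - 1 by omega)
      rwa [Nat.sub_add_cancel (by omega)] at this

/-- Inserting `1` is a codegeneracy: the cofaces `k` and `k + 1` multiply the inserted `1` with a
neighbour and undo the insertion; all others commute with it up to a shift of index. -/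
lemma coface_insertOne {n : ℕ} {F : (ℕ → A) → A} (hF : DependsOnFirst n F) {k : ℕ} (hk : k ≤ n)
    {i : ℕ} (hi : i ≤ n + 1) (a : ℕ → A) :
    coface n i F (insertOne k a) =
      if i < k then coface (n - 1) i (fun b => F (insertOne (k - 1) b)) a
      else if i ≤ k + 1 then F a
      else coface (n - 1) (i - 1) (fun b => F (insertOne k b)) a := by
  rcases Nat.eq_zero_or_pos i with rfl | hi0
  · rcases Nat.eq_zero_or_pos k with rfl | hk0
    · rw [if_neg (by omega), if_pos (by omega), coface, if_pos rfl]
      simp only [insertOne, lt_irrefl, if_false, if_true, one_mul]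
      congr 1
      funext l
      simp [shift, insertOne]
    · rw [if_pos hk0, coface, if_pos rfl, coface, if_pos rfl]
      congr 1
      · simp [insertOne, hk0]
      · congr 1
        funext l
        unfold shift insertOne
        grind
  · rcases hi.eq_or_lt with rfl | hi'
    · rw [if_neg (by omega), coface, if_neg (by omega), if_neg (by omega)]
      split_ifs with h
      · obtain rfl : n = k := by omega
        rw [insertOne, if_neg (by omega), if_pos rfl, mul_one]
        exact hF _ _ fun l hl => by simp [insertOne, hl]
      · rw [Nat.add_sub_cancel, coface, if_neg (by omega), if_neg (by omega)]
        congr 1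
        rw [insertOne, if_neg (by omega), if_neg (by omega)]
    · rw [coface, if_neg (by omega), if_pos (by omega)]
      split_ifs with h1 h2
      · rw [coface, if_neg (by omega), if_pos (by omega)]
        congr 1
        funext l
        unfold mergeAt insertOne
        grind
      · congr 1
        funext l
        unfold mergeAt insertOne
        grind
      · rw [coface, if_neg (by omega), if_pos (by omega)]
        congr 1
        funext l
        unfold mergeAt insertOne
        grind

lemma insertOne_insertOne {α : Type*} [One α] (a : ℕ → α) {j k : ℕ} (h : j < k) :
    insertOne k (insertOne j a) = insertOne j (insertOne (k - 1) a) := by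
  funext l
  unfold insertOne
  grind

/-- The pairs `(j + 1, i)` and `(i, j)` with `i ≤ j` carry equal values and opposite signs. -/
lemma sum_coface_coface (n : ℕ) {M : Type*} [AddCommGroup M] [Module K M] (X : ℕ → ℕ → M)
    (h : ∀ i j, i ≤ j → j ≤ n + 1 → X (j + 1) i = X i j) :
    ∑ j ∈ Finset.range (n + 3), ((-1 : K) ^ j) •
      ∑ i ∈ Finset.range (n + 2), ((-1 : K) ^ i) • X j i = 0 := by
  simp only [Finset.smul_sum, smul_smul]
  rw [← Finset.sum_product']
  refine Finset.sum_involution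
    (fun x _ => if x.2 < x.1 then (x.2, x.1 - 1) else (x.2 + 1, x.1)) ?_ ?_ ?_ ?_
  · rintro ⟨j, i⟩ hx
    simp only [Finset.mem_product, Finset.mem_range] at hx
    dsimp only
    split_ifs with hlt
    · obtain ⟨j, rfl⟩ : ∃ m, j = m + 1 := ⟨j - 1, by omega⟩
      rw [Nat.add_sub_cancel, h i j (by omega) (by omega), ← add_smul, ← pow_add, ← pow_add]
      rw [show j + 1 + i = i + j + 1 by ring, pow_succ]
      simp
    · rw [h j i (by omega) (by omega), ← add_smul, ← pow_add, ← pow_add]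
      rw [show i + 1 + j = j + i + 1 by ring, pow_succ]
      simp
  · rintro ⟨j, i⟩ hx _ heq
    dsimp only at heq
    split_ifs at heq <;> simp only [Prod.mk.injEq] at heq <;> omega
  · rintro ⟨j, i⟩ hx
    simp only [Finset.mem_product, Finset.mem_range] at hx ⊢
    split_ifs <;> dsimp only <;> omega
  · rintro ⟨j, i⟩ hx
    dsimp only
    split_ifs with h1 h2 h2 <;> simp only [Prod.mk.injEq] <;> grind

lemma ev_hochD_fun {n : ℕ} (f : Cochain K A n) :
    ev (hochD K A n f) = fun a => ∑ i ∈ Finset.range (n + 2), ((-1 : K) ^ i) •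
      coface n i (ev f) a :=
  funext fun a => ev_hochD_coface f a

lemma coface_sum_smul (n j : ℕ) {ι : Type*} (s : Finset ι) (c : ι → K)
    (F : ι → (ℕ → A) → A) (a : ℕ → A) :
    coface n j (fun a => ∑ i ∈ s, c i • F i a) a = ∑ i ∈ s, c i • coface n j (F i) a := by
  unfold coface
  split_ifs
  · simp [Finset.mul_sum]
  · rfl
  · simp [Finset.sum_mul]

lemma hochD_hochD {n : ℕ} (f : Cochain K A n) : hochD K A (n + 1) (hochD K A n f) = 0 := by
  refine cochain_ext fun a => ?_
  rw [ev_hochD_coface, ev_hochD_fun, ev_zero]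
  simp only [coface_sum_smul]
  exact sum_coface_coface n (fun j i => coface (n + 1) j (coface n i (ev f)) a)
    fun i j hij hj => congrFun (coface_coface (ev_dependsOnFirst f) hij hj) a

/-- The two cofaces that undo the insertion are consecutive, so they cancel in the alternating sum.
-/
lemma ev_hochD_insertOne {n : ℕ} (f : Cochain K A n) {k : ℕ} (hk : k ≤ n) (a : ℕ → A) :
    ev (hochD K A n f) (insertOne k a) =
      ∑ i ∈ Finset.range k, ((-1 : K) ^ i) •
        coface (n - 1) i (fun b => ev f (insertOne (k - 1) b)) a
      - ∑ i ∈ Finset.Ico (k + 1) (n + 1), ((-1 : K) ^ i) •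
        coface (n - 1) i (fun b => ev f (insertOne k b)) a := by
  rw [ev_hochD_coface, ← Finset.sum_range_add_sum_Ico _ (show k ≤ n + 2 by omega),
    Finset.sum_eq_sum_Ico_succ_bot (by omega), Finset.sum_eq_sum_Ico_succ_bot (by omega),
    sub_eq_add_neg]
  congr 1
  · refine Finset.sum_congr rfl fun i hi => ?_
    rw [Finset.mem_range] at hi
    rw [coface_insertOne (ev_dependsOnFirst f) hk (by omega), if_pos hi]
  · rw [coface_insertOne (ev_dependsOnFirst f) hk (by omega), if_neg (by omega),
      if_pos (by omega), coface_insertOne (ev_dependsOnFirst f) hk (by omega),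
      if_neg (by omega), if_pos (by omega), pow_succ, mul_neg_one, neg_smul, ← add_assoc,
      add_neg_cancel, zero_add, ← Finset.sum_Ico_add' _ (k + 1) (n + 1) 1,
      ← Finset.sum_neg_distrib]
    refine Finset.sum_congr rfl fun i hi => ?_
    rw [Finset.mem_Ico] at hi
    rw [coface_insertOne (ev_dependsOnFirst f) hk (by omega), if_neg (by omega),
      if_neg (by omega), Nat.add_sub_cancel, pow_succ, mul_neg_one, neg_smul]

lemma coface_zero (n i : ℕ) (a : ℕ → A) : coface n i (fun _ => 0) a = 0 := by
  simp [coface]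

lemma mem_normalized_iff_insertOne {n : ℕ} {f : Cochain K A n} :
    f ∈ normalized K A n ↔ ∀ k < n, ∀ a, ev f (insertOne k a) = 0 := by
  rw [mem_normalized_iff]
  constructor
  · intro h k hk a
    exact h _ k hk (by simp [insertOne])
  · intro h a k hk ha
    rw [← insertOne_of_eq_one ha]
    exact h k hk _

lemma hochD_mem_normalized {n : ℕ} {f : Cochain K A n} (hf : f ∈ normalized K A n) :
    hochD K A n f ∈ normalized K A (n + 1) := by
  rw [mem_normalized_iff_insertOne] at *
  intro k hk a
  rw [ev_hochD_insertOne f (by omega)]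
  have h1 : ∑ i ∈ Finset.range k, ((-1 : K) ^ i) •
      coface (n - 1) i (fun b => ev f (insertOne (k - 1) b)) a = 0 := by
    refine Finset.sum_eq_zero fun i hi => ?_
    rw [Finset.mem_range] at hi
    simp only [hf (k - 1) (by omega), coface_zero, smul_zero]
  have h2 : ∑ i ∈ Finset.Ico (k + 1) (n + 1), ((-1 : K) ^ i) •
      coface (n - 1) i (fun b => ev f (insertOne k b)) a = 0 := by
    refine Finset.sum_eq_zero fun i hi => ?_
    rw [Finset.mem_Ico] at hi
    simp only [hf k (by omega), coface_zero, smul_zero]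
  rw [h1, h2, sub_zero]

/-- One step of the normalization: subtracting a coboundary makes a cochain vanish on words with
a `1` in position `k`. -/
lemma normalize_step {m : ℕ} (f : Cochain K A (m + 1)) {k : ℕ} (hk : k ≤ m)
    (hδ : hochD K A (m + 1) f ∈ normalized K A (m + 2))
    (hf : ∀ j < k, ∀ a, ev f (insertOne j a) = 0) :
    ∃ g : Cochain K A m, ∀ j < k + 1, ∀ a, ev (f - hochD K A m g) (insertOne j a) = 0 := by
  -- The correcting cochain is the `k`-th codegeneracy of `f`, up to the sign `(-1)^k`.
  obtain ⟨g, hg⟩ := exists_ev_insertOne f hk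
  have hgz : ∀ j < k, ∀ a, ev g (insertOne j a) = 0 := by
    intro j hj a
    rw [hg, insertOne_insertOne a hj, hf j hj]
  have hfirst : ∀ j ≤ k, ∀ a, ∑ i ∈ Finset.range j, ((-1 : K) ^ i) •
      coface (m - 1) i (fun b => ev g (insertOne (j - 1) b)) a = 0 := by
    intro j hj a
    refine Finset.sum_eq_zero fun i hi => ?_
    rw [Finset.mem_range] at hi
    simp only [hgz (j - 1) (by omega), coface_zero, smul_zero]
  have hlt : ∀ j < k, ∀ a, ev (hochD K A m g) (insertOne j a) = 0 := by
    intro j hj a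
    rw [ev_hochD_insertOne g (by omega), hfirst j hj.le, zero_sub, neg_eq_zero]
    refine Finset.sum_eq_zero fun i hi => ?_
    simp only [hgz j hj, coface_zero, smul_zero]
  -- Evaluating the normalized `δ f` with a `1` in position `k` gives a relation for `g` alone, the
  -- lower cofaces vanishing by `hf`.
  have hrel : ∀ a, ∑ i ∈ Finset.Ico (k + 1) (m + 2), ((-1 : K) ^ i) • coface m i (ev g) a = 0 := by
    intro a
    have h := mem_normalized_iff_insertOne.1 hδ k (by omega) a
    rw [ev_hochD_insertOne f (by omega), Finset.sum_eq_zero, zero_sub, neg_eq_zero] at h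
    · simp only [← hg] at h
      exact h
    · intro i hi
      rw [Finset.mem_range] at hi
      simp only [hf (k - 1) (by omega), coface_zero, smul_zero]
  -- A second `1` inserted in position `k` turns the first term of `hrel` into `g` itself and the
  -- others into the terms of `δ g`.
  have heq : ∀ a, ev (hochD K A m g) (insertOne k a) = ((-1 : K) ^ k) • ev f (insertOne k a) := by
    intro a
    have h := hrel (insertOne k a)
    rw [Finset.sum_eq_sum_Ico_succ_bot (by omega),
      coface_insertOne (ev_dependsOnFirst g) hk (by omega), if_neg (by omega), if_pos (by omega),
      ← Finset.sum_Ico_add' _ (k + 1) (m + 1) 1] at h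
    rw [ev_hochD_insertOne g hk, hfirst k le_rfl, zero_sub, ← hg, ← sub_eq_zero,
      ← h, pow_succ, mul_neg_one, neg_smul]
    have : ∀ i ∈ Finset.Ico (k + 1) (m + 1), ((-1 : K) ^ (i + 1)) •
        coface m (i + 1) (ev g) (insertOne k a) = - (((-1 : K) ^ i) •
        coface (m - 1) i (fun b => ev g (insertOne k b)) a) := by
      intro i hi
      rw [Finset.mem_Ico] at hi
      rw [coface_insertOne (ev_dependsOnFirst g) hk (by omega), if_neg (by omega),
        if_neg (by omega), Nat.add_sub_cancel, pow_succ, mul_neg_one, neg_smul]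
    rw [Finset.sum_congr rfl this, Finset.sum_neg_distrib]
    abel
  refine ⟨((-1 : K) ^ k) • g, fun j hj a => ?_⟩
  rw [map_smul, ev_sub, ev_smul]
  rcases Nat.lt_succ_iff_lt_or_eq.1 hj with h | rfl
  · rw [hf j h, hlt j h, smul_zero, sub_zero]
  · rw [heq, smul_smul, ← mul_pow, neg_one_mul, neg_neg, one_pow, one_smul, sub_self]

/-- A cochain with normalized coboundary is normalized up to a coboundary. -/
theorem exists_sub_mem_normalized {n : ℕ} (f : Cochain K A n)
    (hδ : hochD K A n f ∈ normalized K A (n + 1)) :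
    ∃ h ∈ coboundaries K A n, f - h ∈ normalized K A n := by
  cases n with
  | zero => exact ⟨0, zero_mem _, fun a ⟨i, _⟩ => i.elim0⟩
  | succ m =>
    have : ∀ k ≤ m + 1, ∃ g : Cochain K A m,
        ∀ j < k, ∀ a, ev (f - hochD K A m g) (insertOne j a) = 0 := by
      intro k
      induction k with
      | zero => exact fun _ => ⟨0, fun j hj => by omega⟩
      | succ k ih =>
        intro hk
        obtain ⟨g, hg⟩ := ih (by omega)
        obtain ⟨g', hg'⟩ := normalize_step (f - hochD K A m g) (k := k) (by omega)
          (by rwa [map_sub, hochD_hochD, sub_zero]) hg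
        exact ⟨g + g', fun j hj a => by rw [map_add, ← sub_sub]; exact hg' j hj a⟩
    obtain ⟨g, hg⟩ := this (m + 1) le_rfl
    exact ⟨_, ⟨g, rfl⟩, mem_normalized_iff_insertOne.2 hg⟩

lemma coboundaries_le_cocycles (n : ℕ) : coboundaries K A n ≤ cocycles K A n := by
  cases n with
  | zero => exact bot_le
  | succ n =>
    rintro _ ⟨f, rfl⟩
    exact hochD_hochD f

end Cosimplicial

/-! ## The Connes operator and the coboundary -/

section Cyclic

variable {K : Type*} [Field K] {A : Type*} [Ring A]

/-- The word `a_1, …, a_{N-1}, a_N a_0`. -/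
def closeUp (N : ℕ) (a : ℕ → A) (l : ℕ) : A := if l + 1 < N then a (l + 1) else a N * a 0

/-- The coboundary of a cochain in terms of the associated functional of `N` letters. -/
def dualD (N : ℕ) (ψ : (ℕ → A) → K) (a : ℕ → A) : K :=
  ψ (closeUp N a) - innerD (K := K) N ψ a

lemma dualD_add (N : ℕ) (ψ φ : (ℕ → A) → K) (a : ℕ → A) :
    dualD N (fun b => ψ b + φ b) a = dualD N ψ a + dualD N φ a := by
  simp only [dualD, innerD, smul_add, Finset.sum_add_distrib]
  ring

lemma dualD_mul (N : ℕ) (c : K) (ψ : (ℕ → A) → K) (a : ℕ → A) :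
    dualD N (fun b => c * ψ b) a = c * dualD N ψ a := by
  simp only [dualD, innerD, smul_eq_mul, mul_sub, Finset.mul_sum, mul_left_comm]

lemma dualD_sum (N : ℕ) {ι : Type*} (s : Finset ι) (c : ι → K) (ψ : ι → (ℕ → A) → K) (a : ℕ → A) :
    dualD N (fun b => ∑ i ∈ s, c i * ψ i b) a = ∑ i ∈ s, c i * dualD N (ψ i) a := by
  classical
  induction s using Finset.induction_on with
  | empty => simp [dualD, innerD]
  | insert i s hi ih =>
    simp only [Finset.sum_insert hi]
    rw [dualD_add, dualD_mul, ih]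

/-- A merge among the last `t + 1` letters of the shortened word uses `t + 2` letters of the
original word, so it is a merge of the rotation by `t + 2`. The other merges belong to the rotation
by `t + 1`, the closing product `a_N a_0` being its merge at position `t`. -/
lemma dualD_rotate {N : ℕ} {ψ : (ℕ → A) → K} (hψ : DependsOnFirst N ψ) {t : ℕ} (ht : t + 1 ≤ N)
    (a : ℕ → A) :
    dualD N (fun b => ψ (rotate N (t + 1) b)) a =
      ∑ j ∈ Finset.Ico t N, (-1) ^ (j + t) * ψ (mergeAt j (rotate (N + 1) (t + 1) a)) +
      ∑ j ∈ Finset.range (t + 1),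
        (-1) ^ (j + N + t) * ψ (mergeAt j (rotate (N + 1) (t + 2) a)) := by
  have h1 : ψ (rotate N (t + 1) (closeUp N a)) = ψ (mergeAt t (rotate (N + 1) (t + 1) a)) := by
    refine hψ _ _ fun l hl => ?_
    unfold rotate closeUp mergeAt
    grind
  have h2 : ∀ j ∈ Finset.range (N - (t + 1)), ((-1 : K) ^ j) • ψ (rotate N (t + 1) (mergeAt j a)) =
      - ((-1) ^ (j + (t + 1) + t) * ψ (mergeAt (j + (t + 1)) (rotate (N + 1) (t + 1) a))) := by
    intro j hj
    rw [Finset.mem_range] at hj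
    have : rotate N (t + 1) (mergeAt j a) =
        mergeAt (j + (t + 1)) (rotate (N + 1) (t + 1) a) := by
      funext l
      unfold rotate mergeAt
      grind
    rw [this, smul_eq_mul, ← neg_mul]
    congr 1
    exact neg_one_pow_eq_neg (by omega)
  have h3 : ∀ j ∈ Finset.range (t + 1), ((-1 : K) ^ (N - (t + 1) + j)) •
      ψ (rotate N (t + 1) (mergeAt (N - (t + 1) + j) a)) =
      - ((-1) ^ (j + N + t) * ψ (mergeAt j (rotate (N + 1) (t + 2) a))) := by
    intro j hj
    rw [Finset.mem_range] at hj
    have : ψ (rotate N (t + 1) (mergeAt (N - (t + 1) + j) a)) =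
        ψ (mergeAt j (rotate (N + 1) (t + 2) a)) := by
      refine hψ _ _ fun l hl => ?_
      unfold rotate mergeAt
      grind
    rw [this, smul_eq_mul, ← neg_mul]
    congr 1
    exact neg_one_pow_eq_neg (by omega)
  have hN : N = N - (t + 1) + (t + 1) := by omega
  rw [dualD, innerD, h1, Finset.sum_eq_sum_Ico_succ_bot (by omega)]
  conv_lhs => rw [hN, Finset.sum_range_add, ← hN]
  rw [Finset.sum_congr rfl h2, Finset.sum_congr rfl h3, Finset.sum_neg_distrib,
    Finset.sum_neg_distrib, Finset.range_eq_Ico, Finset.sum_Ico_add'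
      (fun j => (-1 : K) ^ (j + t) * ψ (mergeAt j (rotate (N + 1) (t + 1) a))), ← hN, zero_add,
      show (-1 : K) ^ (t + t) = 1 from Even.neg_one_pow ⟨t, rfl⟩]
  ring

/-- The coboundary of a partial cyclic sum. -/
lemma dualD_sum_rotate {N : ℕ} {ψ : (ℕ → A) → K} (hψ : DependsOnFirst N ψ) {m : ℕ} (hm : m ≤ N)
    (a : ℕ → A) :
    dualD N (fun b => ∑ t ∈ Finset.Icc 1 m, (-1) ^ (t * (N + 1)) * ψ (rotate N t b)) a =
      ∑ t ∈ Finset.Icc 1 m, (-1) ^ (t * N + 1) * innerD (K := K) N ψ (rotate (N + 1) t a) +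
      (-1) ^ ((m + 1) * N + 1) *
        ∑ j ∈ Finset.range m, (-1) ^ j * ψ (mergeAt j (rotate (N + 1) (m + 1) a)) := by
  induction m with
  | zero => simp [dualD, innerD]
  | succ m ih =>
    -- The new rotation supplies the merges at positions `j ≥ m`, completing those at `j < m` left
    -- over from the previous step to a full `innerD`, and leaves its own incomplete remainder.
    simp only [Finset.sum_Icc_succ_top (show 1 ≤ m + 1 by omega)]
    rw [dualD_add, ih (by omega), dualD_mul, dualD_rotate hψ hm, innerD,
      ← Finset.sum_range_add_sum_Ico _ (show m ≤ N by omega),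
      mul_add ((-1 : K) ^ ((m + 1) * (N + 1)))]
    have h1 : (-1 : K) ^ ((m + 1) * (N + 1)) * ∑ j ∈ Finset.Ico m N,
        (-1) ^ (j + m) * ψ (mergeAt j (rotate (N + 1) (m + 1) a)) = (-1) ^ ((m + 1) * N + 1) *
        ∑ j ∈ Finset.Ico m N, (-1 : K) ^ j • ψ (mergeAt j (rotate (N + 1) (m + 1) a)) := by
      rw [Finset.mul_sum, Finset.mul_sum]
      refine Finset.sum_congr rfl fun j _ => ?_
      rw [smul_eq_mul, ← mul_assoc, ← mul_assoc, ← pow_add, ← pow_add]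
      congr 1
      apply neg_one_pow_congr'
      rw [show (m + 1) * (N + 1) + (j + m) = (m + 1) * N + 1 + j + 2 * m by ring]
      omega
    have h2 : (-1 : K) ^ ((m + 1) * (N + 1)) * ∑ j ∈ Finset.range (m + 1),
        (-1) ^ (j + N + m) * ψ (mergeAt j (rotate (N + 1) (m + 2) a)) =
        (-1) ^ ((m + 1 + 1) * N + 1) *
        ∑ j ∈ Finset.range (m + 1), (-1 : K) ^ j * ψ (mergeAt j (rotate (N + 1) (m + 2) a)) := by
      rw [Finset.mul_sum, Finset.mul_sum]
      refine Finset.sum_congr rfl fun j _ => ?_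
      rw [← mul_assoc, ← mul_assoc, ← pow_add, ← pow_add]
      congr 1
      apply neg_one_pow_congr'
      rw [show (m + 1) * (N + 1) + (j + N + m) = (m + 1 + 1) * N + 1 + j + 2 * m by ring]
      omega
    rw [h1, h2]
    simp only [smul_eq_mul]
    ring

end Cyclic

/-! ### Anticommutation of `Δ` with `δ`, and `Δ² = 0` on normalized cochains -/

section Form

variable {K : Type*} [Field K] {A : Type*} [Ring A] [Algebra K A]
variable {B : LinearMap.BilinForm K A}

/-- The functional `a ↦ ⟨F(a), 1⟩`. -/
def lam (B : LinearMap.BilinForm K A) (F : (ℕ → A) → A) (a : ℕ → A) : K := B (F a) 1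

lemma DependsOnFirst.lam {n : ℕ} {F : (ℕ → A) → A} (hF : DependsOnFirst n F) :
    DependsOnFirst n (lam B F) := fun a b h => by
  rw [HochschildBV.lam, HochschildBV.lam, hF a b h]

lemma innerD_lam (n : ℕ) (F : (ℕ → A) → A) (a : ℕ → A) :
    innerD (K := K) n (lam B F) a = lam B (innerD (K := K) n F) a := by
  simp [innerD, lam]

lemma form_mul_left (hsymm : B.IsSymm) (hinv : ∀ a b c : A, B (a * b) c = B a (b * c))
    (a b c : A) : B (a * b) c = B b (c * a) := by
  rw [← hsymm.eq, ← hinv, ← hsymm.eq]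

/-- Invariance and symmetry move the outer factors `a_0` and `a_n` next to the last letter, so that
all terms of the coboundary become merges of neighbours on a circle. -/
lemma hochD_form (hsymm : B.IsSymm) (hinv : ∀ a b c : A, B (a * b) c = B a (b * c)) {n : ℕ}
    (f : Cochain K A n) (a : ℕ → A) :
    B (ev (hochD K A n f) a) (a (n + 1)) = dualD (n + 1) (fun b => B (ev f b) (b n)) a := by
  rw [ev_hochD, dualD, show innerD (K := K) (n + 1) (fun b => B (ev f b) (b n)) a = _ from
    Finset.sum_range_succ _ _]
  simp only [map_add, map_sub, map_smul, LinearMap.add_apply, LinearMap.sub_apply,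
    LinearMap.smul_apply]
  rw [hinv (ev f a), form_mul_left hsymm hinv]
  have h1 : ev f (shift 1 a) = ev f (closeUp (n + 1) a) :=
    ev_congr f fun l hl => by simp [shift, closeUp, hl, add_comm]
  have h2 : closeUp (n + 1) a n = a (n + 1) * a 0 := by simp [closeUp]
  have h3 : ev f (mergeAt n a) = ev f a := ev_congr f fun l hl => by simp [mergeAt, hl]
  have h4 : mergeAt n a n = a n * a (n + 1) := by simp [mergeAt]
  rw [h1, h2, h3, h4, innerD, map_sum, LinearMap.sum_apply]
  have h5 : ∀ j ∈ Finset.range n, B (((-1 : K) ^ j) • ev f (mergeAt j a)) (a (n + 1)) =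
      ((-1 : K) ^ j) • B (ev f (mergeAt j a)) (mergeAt j a n) := by
    intro j hj
    rw [Finset.mem_range] at hj
    rw [map_smul, LinearMap.smul_apply, mergeAt, if_neg (by omega), if_neg (by omega)]
  rw [Finset.sum_congr rfl h5]
  simp only [pow_succ, smul_eq_mul]
  ring

lemma lam_hochD (hsymm : B.IsSymm) (hinv : ∀ a b c : A, B (a * b) c = B a (b * c)) {n : ℕ}
    (f : Cochain K A n) (a : ℕ → A) :
    lam B (ev (hochD K A n f)) a = B (ev f (shift 1 a)) (a 0)
      - lam B (innerD (K := K) n (ev f)) a + (-1) ^ (n + 1) * B (ev f a) (a n) := by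
  rw [lam, ev_hochD]
  simp only [map_add, map_sub, map_smul, LinearMap.add_apply, LinearMap.sub_apply,
    LinearMap.smul_apply]
  rw [hinv (ev f a), form_mul_left hsymm hinv, one_mul, mul_one]
  rfl

lemma rotate_self {α : Type*} (N : ℕ) (a : ℕ → α) {l : ℕ} (h : l < N) : rotate N N a l = a l := by
  simp [rotate, h]

lemma rotate_zero {α : Type*} (N : ℕ) (a : ℕ → α) : rotate N 0 a = a := by
  funext l
  simp [rotate]

variable [FiniteDimensional K A]

lemma connes_lam (hB : B.Nondegenerate) {n : ℕ} (f : Cochain K A (n + 1)) (a : ℕ → A) :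
    B (ev (connes B hB n f) a) (a n) = (-1) ^ n *
      ∑ t ∈ Finset.Icc 1 (n + 1), (-1) ^ (t * n) * lam B (ev f) (rotate (n + 1) t a) :=
  connes_ev hB f a

/-- The Connes operator anticommutes with the coboundary. -/
theorem hochD_connes (hsymm : B.IsSymm) (hinv : ∀ a b c : A, B (a * b) c = B a (b * c))
    (hB : B.Nondegenerate) {n : ℕ} (f : Cochain K A (n + 1)) :
    hochD K A n (connes B hB n f) = - connes B hB (n + 1) (hochD K A (n + 1) f) := by
  rw [eq_neg_iff_add_eq_zero]
  refine cochain_ext_form hB fun a => ?_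
  rw [ev_add, map_add, LinearMap.add_apply, hochD_form hsymm hinv, connes_lam, ev_zero, map_zero,
    LinearMap.zero_apply]
  simp only [connes_lam, lam_hochD hsymm hinv]
  rw [dualD_mul]
  have h1 := dualD_sum_rotate (K := K) (N := n + 1) ((ev_dependsOnFirst f).lam (B := B))
    le_rfl a
  have h2 : ∀ t, (-1 : K) ^ (t * (n + 1 + 1)) = (-1) ^ (t * n) := fun t =>
    neg_one_pow_congr' (by rw [show t * (n + 1 + 1) = t * n + 2 * t by ring]; omega)
  simp only [h2] at h1
  have h3 := Finset.sum_Icc_succ_top (show 1 ≤ n + 1 + 1 by omega)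
    (fun t => (-1 : K) ^ (t * (n + 1) + 1) *
      innerD (K := K) (n + 1) (lam B (ev f)) (rotate (n + 2) t a))
  rw [innerD] at h3
  simp only [smul_eq_mul] at h3
  rw [h1, ← h3]
  simp only [innerD_lam]
  -- Paired with `1`, the two outer terms of `δ f` at a rotation are values of one function at
  -- consecutive rotations. They telescope once around the circle, back to the starting value.
  set θ : ℕ → K := fun t => (-1) ^ (t * (n + 1)) *
    B (ev f (rotate (n + 2) t a)) (rotate (n + 2) t a (n + 1)) with hθ
  have h4 : ∀ t ∈ Finset.Icc 1 (n + 2), (-1 : K) ^ (t * (n + 1)) *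
      (B (ev f (shift 1 (rotate (n + 2) t a))) (rotate (n + 2) t a 0)
      - lam B (innerD (K := K) (n + 1) (ev f)) (rotate (n + 2) t a) + (-1) ^ (n + 1 + 1) *
        B (ev f (rotate (n + 2) t a)) (rotate (n + 2) t a (n + 1))) =
      (-1) ^ n * (θ t - θ (t - 1)) + (-1 : K) ^ (t * (n + 1) + 1) *
        lam B (innerD (K := K) (n + 1) (ev f)) (rotate (n + 2) t a) := by
    intro t ht
    rw [Finset.mem_Icc] at ht
    obtain ⟨t, rfl⟩ : ∃ s, t = s + 1 := ⟨t - 1, by omega⟩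
    have e1 : ev f (shift 1 (rotate (n + 2) (t + 1) a)) = ev f (rotate (n + 2) t a) :=
      ev_congr f fun l hl => by unfold shift rotate; grind
    have e2 : rotate (n + 2) (t + 1) a 0 = rotate (n + 2) t a (n + 1) := by
      unfold rotate; grind
    have e3 : (-1 : K) ^ ((t + 1) * (n + 1)) = - ((-1) ^ n * (-1) ^ (t * (n + 1))) := by
      rw [← pow_add]
      refine neg_one_pow_eq_neg ?_
      rw [show (t + 1) * (n + 1) + 1 = n + t * (n + 1) + 2 by ring]
      omega
    have e4 : (-1 : K) ^ (n + 1 + 1) = (-1) ^ n := neg_one_pow_congr' (by omega)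
    rw [e1, e2, hθ]
    simp only [Nat.add_sub_cancel]
    rw [e4, pow_succ _ ((t + 1) * (n + 1)), e3]
    ring
  rw [Finset.sum_congr rfl h4, Finset.sum_add_distrib, ← Finset.mul_sum]
  have h5 : ∑ t ∈ Finset.Icc 1 (n + 2), (θ t - θ (t - 1)) = 0 := by
    have : ∑ t ∈ Finset.Icc 1 (n + 2), (θ t - θ (t - 1)) =
        ∑ t ∈ Finset.range (n + 2), (θ (t + 1) - θ t) := by
      refine Finset.sum_nbij' (fun t => t - 1) (fun t => t + 1) ?_ ?_ ?_ ?_ ?_ <;>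
        intro t ht <;> simp only [Finset.mem_Icc, Finset.mem_range] at * <;> try omega
      rw [Nat.sub_add_cancel (by omega)]
    rw [this, Finset.sum_range_sub, sub_eq_zero, hθ]
    simp only [rotate_zero, rotate_self _ _ (show n + 1 < n + 2 by omega)]
    congr 1
    · apply neg_one_pow_congr'
      have := (Nat.even_mul_succ_self (n + 1)).two_dvd
      rw [show n + 1 + 1 = n + 2 by rfl] at this
      rw [mul_comm, zero_mul]
      omega
    · rw [ev_congr f fun l hl => rotate_self _ a (show l < n + 2 by omega)]
  rw [h5, pow_succ]
  ring

lemma connes_mem_normalized (hB : B.Nondegenerate) {n : ℕ} {f : Cochain K A (n + 1)}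
    (hf : f ∈ normalized K A (n + 1)) : connes B hB n f ∈ normalized K A n := by
  rw [mem_normalized_iff] at *
  intro a i hi ha
  refine hB.1 _ fun x => ?_
  have := connes_lam hB f (Function.update a n x)
  rw [Function.update_self, ev_congr _ fun l hl => Function.update_of_ne hl.ne _ _] at this
  rw [this, Finset.sum_eq_zero, mul_zero]
  intro t ht
  rw [Finset.mem_Icc] at ht
  rw [lam, hf _ (if i + t < n + 1 then i + t else i + t - (n + 1)) (by split_ifs <;> omega)]
  · simp
  · rw [← ha, rotate]
    split_ifs <;> first | omega | (rw [Function.update_of_ne (by omega)]; congr 1; omega)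

/-- The Connes operator squares to zero on normalized cochains. -/
lemma connes_connes (hB : B.Nondegenerate) {n : ℕ} {f : Cochain K A (n + 2)}
    (hf : f ∈ normalized K A (n + 2)) : connes B hB n (connes B hB (n + 1) f) = 0 := by
  rw [mem_normalized_iff] at hf
  refine cochain_ext_form hB fun a => ?_
  rw [connes_lam, ev_zero, map_zero, LinearMap.zero_apply, Finset.sum_eq_zero, mul_zero]
  intro t _
  -- The `1` paired with `Δ f` is treated as one more letter of the word; after rotation by `s` it
  -- is the argument of `f` with index `s - 1`.
  have := connes_lam hB f (Function.update (rotate (n + 1) t a) (n + 1) 1)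
  rw [Function.update_self, ev_congr _ fun l hl => Function.update_of_ne hl.ne _ _] at this
  rw [lam, this, Finset.sum_eq_zero, mul_zero, mul_zero]
  intro s hs
  rw [Finset.mem_Icc] at hs
  rw [lam, hf _ (s - 1) (by omega)]
  · simp
  · rw [rotate, if_pos (by omega), show n + 1 + 1 - s + (s - 1) = n + 1 by omega,
      Function.update_self]

end Form

/-! ## The bracket up to homotopy -/

section Composition

variable {K : Type*} [Field K] {A : Type*} [Ring A] [Algebra K A]

/-- The word in which the `p` letters from position `k` on are replaced by the value of `f`. -/
def applyAt {p : ℕ} (f : Cochain K A p) (k : ℕ) (a : ℕ → A) : ℕ → A :=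
  blockAt p k (ev f (shift k a)) a

lemma exists_ev_blockAt_linear {q : ℕ} (g : Cochain K A q) {j : ℕ} (hj : j < q) (p : ℕ)
    (a : ℕ → A) : ∃ φ : A →ₗ[K] A, ∀ u, ev g (blockAt p j u a) = φ u := by
  refine ⟨g.toLinearMap (fun i => blockAt p j 0 a i) ⟨j, hj⟩, fun u => ?_⟩
  rw [MultilinearMap.toLinearMap_apply, ev]
  congr 1
  funext l
  by_cases h : l = ⟨j, hj⟩
  · subst h
    simp [blockAt]
  · rw [Function.update_of_ne h]
    have : (l : ℕ) ≠ j := fun e => h (Fin.ext e)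
    simp [blockAt, this]

lemma innerD_of_cocycle {p : ℕ} {f : Cochain K A p} (hf : f ∈ cocycles K A p) (a : ℕ → A) :
    innerD (K := K) p (ev f) a = a 0 * ev f (shift 1 a) + ((-1 : K) ^ (p + 1)) • (ev f a * a p) := by
  have := ev_hochD f a
  rw [LinearMap.mem_ker.1 hf, ev_zero] at this
  rw [eq_comm, ← sub_eq_zero, this]
  abel

lemma applyAt_mergeAt_of_lt {p : ℕ} (f : Cochain K A p) {i j : ℕ} (h : i < j) (a : ℕ → A) :
    applyAt f j (mergeAt i a) = mergeAt i (applyAt f (j + 1) a) := by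
  have : shift j (mergeAt i a) = shift (j + 1) a := by
    funext l
    unfold shift mergeAt
    grind
  unfold applyAt
  rw [this]
  funext l
  unfold blockAt mergeAt
  grind

lemma applyAt_mergeAt_of_ge {p : ℕ} (f : Cochain K A p) {j l : ℕ} (h : j < l) (a : ℕ → A) :
    applyAt f j (mergeAt (l + p - 1) a) = mergeAt l (applyAt f j a) := by
  have : ev f (shift j (mergeAt (l + p - 1) a)) = ev f (shift j a) := by
    refine ev_congr f fun i hi => ?_
    unfold shift mergeAt
    grind
  unfold applyAt
  rw [this]
  funext l
  unfold blockAt mergeAt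
  grind

lemma applyAt_mergeAt_inside {p : ℕ} (f : Cochain K A p) {j x : ℕ} (h : x < p) (a : ℕ → A) :
    applyAt f j (mergeAt (j + x) a) = blockAt (p + 1) j (ev f (mergeAt x (shift j a))) a := by
  have : shift j (mergeAt (j + x) a) = mergeAt x (shift j a) := by
    funext l
    unfold shift mergeAt
    grind
  unfold applyAt
  rw [this]
  funext l
  unfold blockAt mergeAt
  grind

/-- Merges outside the block fed to `f` are merges of the composed word. Those inside the block are
traded, by the cocycle identity for `f`, for the two outer products, which are again merges of
composed words, with the block at `j + 1` and at `j`. -/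
lemma innerD_comp {p q r : ℕ} (h : r + 1 = q + p) {f : Cochain K A p} (hf : f ∈ cocycles K A p)
    (g : Cochain K A q) {j : ℕ} (hj : j < q) (a : ℕ → A) :
    innerD (K := K) r (fun b => ev g (applyAt f j b)) a =
      ∑ l ∈ Finset.range (j + 1), ((-1 : K) ^ l) • ev g (mergeAt l (applyAt f (j + 1) a)) +
      ((-1 : K) ^ (p + 1)) •
        ∑ l ∈ Finset.Ico j q, ((-1 : K) ^ l) • ev g (mergeAt l (applyAt f j a)) := by
  have hr : r = j + p + (q - (j + 1)) := by omega
  have h1 : ∑ i ∈ Finset.range j, ((-1 : K) ^ i) • ev g (applyAt f j (mergeAt i a)) =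
      ∑ l ∈ Finset.range j, ((-1 : K) ^ l) • ev g (mergeAt l (applyAt f (j + 1) a)) := by
    refine Finset.sum_congr rfl fun i hi => ?_
    rw [applyAt_mergeAt_of_lt f (Finset.mem_range.1 hi)]
  have h2 : ∑ i ∈ Finset.range (q - (j + 1)), ((-1 : K) ^ (j + p + i)) •
      ev g (applyAt f j (mergeAt (j + p + i) a)) = ((-1 : K) ^ (p + 1)) •
        ∑ l ∈ Finset.Ico (j + 1) q, ((-1 : K) ^ l) • ev g (mergeAt l (applyAt f j a)) := by
    rw [Finset.sum_Ico_eq_sum_range, Finset.smul_sum]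
    refine Finset.sum_congr rfl fun i _ => ?_
    have := applyAt_mergeAt_of_ge f (show j < j + 1 + i by omega) a
    rw [show j + 1 + i + p - 1 = j + p + i by omega] at this
    rw [this, smul_smul, ← pow_add]
    congr 1
    exact neg_one_pow_congr' (by omega)
  have h3 : ∑ x ∈ Finset.range p, ((-1 : K) ^ (j + x)) • ev g (applyAt f j (mergeAt (j + x) a)) =
      ((-1 : K) ^ j) • ev g (mergeAt j (applyAt f (j + 1) a)) +
      ((-1 : K) ^ (p + 1)) • ((-1 : K) ^ j) • ev g (mergeAt j (applyAt f j a)) := by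
    obtain ⟨φ, hφ⟩ := exists_ev_blockAt_linear g hj (p + 1) a
    have e1 : mergeAt j (applyAt f (j + 1) a) =
        blockAt (p + 1) j (shift j a 0 * ev f (shift 1 (shift j a))) a := by
      have : shift 1 (shift j a) = shift (j + 1) a := by
        funext l; simp [shift, add_assoc]
      rw [this]
      funext l
      unfold applyAt mergeAt blockAt shift
      grind
    have e2 : mergeAt j (applyAt f j a) =
        blockAt (p + 1) j (ev f (shift j a) * shift j a p) a := by
      funext l
      unfold applyAt mergeAt blockAt shift
      grind
    rw [e1, e2, hφ, hφ, smul_comm, ← smul_add, ← map_smul, ← map_add, ← innerD_of_cocycle hf, innerD,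
      map_sum, Finset.smul_sum]
    refine Finset.sum_congr rfl fun x hx => ?_
    rw [applyAt_mergeAt_inside f (Finset.mem_range.1 hx), hφ, map_smul, smul_smul, pow_add]
  rw [innerD, hr, Finset.sum_range_add, Finset.sum_range_add, h1, h2, h3,
    Finset.sum_range_succ, Finset.sum_eq_sum_Ico_succ_bot hj, smul_add]
  abel

lemma sum_Ico_shift_add {M : Type*} [AddCommGroup M] (L U : ℕ → M) {t q : ℕ} (h : t ≤ q) :
    ∑ j ∈ Finset.Ico t q, (L (j + 1) + U j) =
      ∑ k ∈ Finset.Ico t (q + 1), (L k + U k) - L t - U q := by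
  induction q, h using Nat.le_induction with
  | base => simp
  | succ q hq ih =>
    rw [Finset.sum_Ico_succ_top hq, ih, Finset.sum_Ico_succ_top (by omega : t ≤ q + 1)]
    abel

/-- Neighbouring block positions contribute complementary sets of merges, which assemble to a full
`innerD` of `g`. Only the lower part at the first position `t` is missing; at `q` the upper part is
empty. -/
lemma sum_innerD_comp {p q r : ℕ} (h : r + 1 = q + p) {f : Cochain K A p}
    (hf : f ∈ cocycles K A p) (g : Cochain K A q) {t : ℕ} (ht : t ≤ q) (a : ℕ → A) :
    ∑ j ∈ Finset.Ico t q, ((-1 : K) ^ (j * (p + 1))) •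
      innerD (K := K) r (fun b => ev g (applyAt f j b)) a =
    ∑ k ∈ Finset.Ico t (q + 1), ((-1 : K) ^ ((k + 1) * (p + 1))) •
      innerD (K := K) q (ev g) (applyAt f k a) -
    ((-1 : K) ^ ((t + 1) * (p + 1))) •
      ∑ l ∈ Finset.range t, ((-1 : K) ^ l) • ev g (mergeAt l (applyAt f t a)) := by
  have key := sum_Ico_shift_add
    (fun k => ((-1 : K) ^ ((k + 1) * (p + 1))) •
      ∑ l ∈ Finset.range k, ((-1 : K) ^ l) • ev g (mergeAt l (applyAt f k a)))
    (fun k => ((-1 : K) ^ ((k + 1) * (p + 1))) •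
      ∑ l ∈ Finset.Ico k q, ((-1 : K) ^ l) • ev g (mergeAt l (applyAt f k a))) ht
  rw [Finset.Ico_self, Finset.sum_empty, smul_zero, sub_zero] at key
  have e1 : ∀ k ∈ Finset.Ico t (q + 1), ((-1 : K) ^ ((k + 1) * (p + 1))) •
      ∑ l ∈ Finset.range k, ((-1 : K) ^ l) • ev g (mergeAt l (applyAt f k a)) +
      ((-1 : K) ^ ((k + 1) * (p + 1))) •
      ∑ l ∈ Finset.Ico k q, ((-1 : K) ^ l) • ev g (mergeAt l (applyAt f k a)) =
      ((-1 : K) ^ ((k + 1) * (p + 1))) • innerD (K := K) q (ev g) (applyAt f k a) := by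
    intro k hk
    rw [Finset.mem_Ico] at hk
    rw [← smul_add, Finset.sum_range_add_sum_Ico _ (by omega), innerD]
  rw [Finset.sum_congr rfl e1] at key
  rw [← key]
  refine Finset.sum_congr rfl fun j hj => ?_
  rw [Finset.mem_Ico] at hj
  rw [innerD_comp h hf g hj.2, smul_add, smul_smul, ← pow_add]
  congr 2
  · exact neg_one_pow_congr' (by
      rw [show (j + 1 + 1) * (p + 1) = j * (p + 1) + 2 * (p + 1) by ring]; omega)
  · congr 1; ring

lemma ev_circ_applyAt {p q r : ℕ} (h : r + 1 = q + p) (g : Cochain K A q) (f : Cochain K A p)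
    (a : ℕ → A) : ev (circ h g f) a =
      ∑ j ∈ Finset.range q, ((-1 : K) ^ (j * (p + 1))) • ev g (applyAt f j a) :=
  ev_circ h g f a

lemma innerD_sum_smul {r : ℕ} {ι : Type*} (s : Finset ι) (c : ι → K)
    (F : ι → (ℕ → A) → A) (a : ℕ → A) :
    innerD (K := K) r (fun b => ∑ i ∈ s, c i • F i b) a =
      ∑ i ∈ s, c i • innerD (K := K) r (F i) a := by
  simp only [innerD, Finset.smul_sum]
  rw [Finset.sum_comm]
  exact Finset.sum_congr rfl fun _ _ => Finset.sum_congr rfl fun _ _ => smul_comm _ _ _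

lemma shift_applyAt {p : ℕ} (f : Cochain K A p) (k : ℕ) (a : ℕ → A) :
    shift 1 (applyAt f (k + 1) a) = applyAt f k (shift 1 a) := by
  have : shift k (shift 1 a) = shift (k + 1) a := by
    funext l; simp [shift, add_assoc, add_left_comm]
  unfold applyAt
  rw [this]
  funext l
  unfold shift blockAt
  grind

/-- The cup product of cocycles is commutative up to the coboundary of `g ∘ f`. -/
lemma ev_hochD_circ {p q r : ℕ} (h : r + 1 = q + p) {f : Cochain K A p}
    (hf : f ∈ cocycles K A p) {g : Cochain K A q} (hg : g ∈ cocycles K A q) (a : ℕ → A) :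
    ev (hochD K A r (circ h g f)) a = ((-1 : K) ^ p) • (ev f a * ev g (shift p a)) -
      ((-1 : K) ^ (p + p * q)) • (ev g a * ev f (shift q a)) := by
  have hfun : ev (circ h g f) =
      fun b => ∑ j ∈ Finset.range q, ((-1 : K) ^ (j * (p + 1))) • ev g (applyAt f j b) :=
    funext fun b => ev_circ_applyAt h g f b
  have hsum := sum_innerD_comp h hf g (Nat.zero_le q) a
  rw [Finset.range_zero, Finset.sum_empty, smul_zero, sub_zero, Nat.Ico_zero_eq_range,
    Nat.Ico_zero_eq_range] at hsum
  rw [ev_hochD, hfun, innerD_sum_smul, hsum]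
  -- The cocycle identity for `g` leaves outer products only. The left product at `k = 0` and the
  -- right product at `k = q` are the two cup products; the rest cancel against the outer terms of
  -- `δ(g ∘ f)`.
  simp only [innerD_of_cocycle hg, smul_add, Finset.sum_add_distrib]
  rw [Finset.sum_range_succ', Finset.sum_range_succ]
  have e1 : applyAt f 0 a 0 = ev f a := by
    have : shift 0 a = a := by funext l; simp [shift]
    simp [applyAt, blockAt, this]
  have e2 : ev g (shift 1 (applyAt f 0 a)) = ev g (shift p a) := by
    refine ev_congr g fun l _ => ?_
    unfold shift applyAt blockAt
    grind
  have e3 : applyAt f q a q = ev f (shift q a) := by simp [applyAt, blockAt]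
  have e4 : ev g (applyAt f q a) = ev g a :=
    ev_congr g fun l hl => by simp [applyAt, blockAt, hl]
  have e5 : ∀ k ∈ Finset.range q, ((-1 : K) ^ ((k + 1 + 1) * (p + 1))) •
      (applyAt f (k + 1) a 0 * ev g (shift 1 (applyAt f (k + 1) a))) =
      a 0 * ((-1 : K) ^ (k * (p + 1))) • ev g (applyAt f k (shift 1 a)) := by
    intro k _
    rw [shift_applyAt, mul_smul_comm]
    congr 1
    · apply neg_one_pow_congr'
      rw [show (k + 1 + 1) * (p + 1) = k * (p + 1) + 2 * (p + 1) by ring]; omega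
  have e6 : ∀ k ∈ Finset.range q, ((-1 : K) ^ ((k + 1) * (p + 1))) • ((-1 : K) ^ (q + 1)) •
      (ev g (applyAt f k a) * applyAt f k a q) =
      ((-1 : K) ^ (r + 1)) • (((-1 : K) ^ (k * (p + 1))) • ev g (applyAt f k a) * a r) := by
    intro k hk
    rw [Finset.mem_range] at hk
    rw [smul_mul_assoc, smul_smul, smul_smul, ← pow_add, ← pow_add]
    congr 1
    · apply neg_one_pow_congr'
      rw [h, show (k + 1) * (p + 1) + (q + 1) = q + p + k * (p + 1) + 2 by ring]
      omega
    · congr 1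
      simp only [applyAt, blockAt]
      rw [if_neg (by omega), if_neg (by omega)]
      congr 1
      omega
  rw [Finset.sum_congr rfl e5, Finset.sum_congr rfl e6, e1, e2, e3, e4, ← Finset.mul_sum,
    ← Finset.smul_sum, ← Finset.sum_mul, smul_smul, ← pow_add, zero_add, one_mul,
    neg_one_pow_eq_neg (K := K) (show (p + 1 + 1) % 2 = p % 2 by omega),
    neg_one_pow_congr' (K := K) (n := p + p * q) (show ((q + 1) * (p + 1) + (q + 1)) % 2 =
      (p + p * q) % 2 by
        rw [show (q + 1) * (p + 1) + (q + 1) = p + p * q + 2 * (q + 1) by ring]; omega)]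
  simp only [neg_smul]
  abel

end Composition

/-! ### The homotopy by partial rotations -/

section Homotopy

variable {K : Type*} [Field K] {A : Type*} [Ring A] [Algebra K A]
variable {B : LinearMap.BilinForm K A}

lemma dependsOnFirst_comp {p q r : ℕ} (h : r + 1 = q + p) (f : Cochain K A p) (g : Cochain K A q)
    {j : ℕ} (hj : j < q) : DependsOnFirst r (fun b => ev g (applyAt f j b)) := by
  intro a b hab
  refine ev_congr g fun l hl => ?_
  simp only [applyAt, blockAt]
  split_ifs with h1 h2
  · exact hab _ (by omega)
  · refine ev_congr f fun i hi => hab _ (by omega)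
  · exact hab _ (by omega)

/-- The homotopy between `g ∘ f` and the part of `Δ(g ⌣ f)` in which the last letter is an argument
of `g`, as a functional of `r` letters. -/
def homotopyForm (B : LinearMap.BilinForm K A) {p q : ℕ} (g : Cochain K A q) (f : Cochain K A p)
    (r : ℕ) (a : ℕ → A) : K :=
  ∑ j ∈ Finset.range q, (-1) ^ (j * (p + 1)) * ∑ t ∈ Finset.Icc 1 j, (-1) ^ (t * (r + 1)) *
    lam B (fun b => ev g (applyAt f j b)) (rotate r t a)

/-- The part of `Δ(g ⌣ f)` in which the last letter is an argument of `g`. -/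
def halfConnes (B : LinearMap.BilinForm K A) {p q : ℕ} (g : Cochain K A q) (f : Cochain K A p)
    (r : ℕ) (a : ℕ → A) : K :=
  ∑ t ∈ Finset.range q, (-1) ^ ((t + 1) * r) *
    lam B (fun b => ev g b * ev f (shift q b)) (rotate (r + 1) (t + 1) a)

lemma sum_Icc_one {M : Type*} [AddCommMonoid M] (n : ℕ) (F : ℕ → M) :
    ∑ t ∈ Finset.Icc 1 n, F t = ∑ s ∈ Finset.range n, F (s + 1) := by
  refine Finset.sum_nbij' (fun t => t - 1) (fun t => t + 1) ?_ ?_ ?_ ?_ ?_ <;>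
    intro t ht <;> simp only [Finset.mem_Icc, Finset.mem_range] at * <;> try omega
  rw [Nat.sub_add_cancel (by omega)]

lemma dualD_homotopyForm_aux {p q r : ℕ} (h : r + 1 = q + p) {f : Cochain K A p}
    (hf : f ∈ cocycles K A p) (g : Cochain K A q) (a : ℕ → A) :
    dualD r (homotopyForm B g f r) a = ∑ s ∈ Finset.range q, (-1) ^ ((s + 1) * r + 1) *
      (∑ k ∈ Finset.Ico (s + 1) (q + 1), (-1) ^ ((k + 1) * (p + 1)) *
        lam B (innerD (K := K) q (ev g)) (applyAt f k (rotate (r + 1) (s + 1) a)) -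
        (-1) ^ (s * (p + 1) + s) *
          lam B (ev g) (mergeAt s (applyAt f (s + 1) (rotate (r + 1) (s + 1) a)))) := by
  have step1 : dualD r (homotopyForm B g f r) a =
      ∑ j ∈ Finset.range q, ∑ s ∈ Finset.range j, (-1) ^ ((s + 1) * r + 1) *
        ((-1) ^ (j * (p + 1)) *
        lam B (innerD (K := K) r (fun b => ev g (applyAt f j b))) (rotate (r + 1) (s + 1) a)) +
      ∑ s ∈ Finset.range q, (-1) ^ ((s + 1) * r + 1) * ((-1) ^ (s * (p + 1)) *
        ∑ l ∈ Finset.range s, (-1) ^ l * lam B (ev g)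
          (mergeAt l (applyAt f (s + 1) (rotate (r + 1) (s + 1) a)))) := by
    unfold homotopyForm
    rw [dualD_sum, ← Finset.sum_add_distrib]
    refine Finset.sum_congr rfl fun j hj => ?_
    rw [Finset.mem_range] at hj
    rw [dualD_sum_rotate (dependsOnFirst_comp h f g hj).lam (by omega), sum_Icc_one, mul_add,
      Finset.mul_sum]
    simp only [innerD_lam]
    congr 1
    · exact Finset.sum_congr rfl fun s _ => by ring
    · rw [mul_left_comm]
      congr 2
      refine Finset.sum_congr rfl fun l hl => ?_
      rw [Finset.mem_range] at hl
      rw [lam, applyAt_mergeAt_of_lt f hl]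
      rfl
  have step2 : ∑ j ∈ Finset.range q, ∑ s ∈ Finset.range j, (-1) ^ ((s + 1) * r + 1) *
        ((-1) ^ (j * (p + 1)) *
        lam B (innerD (K := K) r (fun b => ev g (applyAt f j b))) (rotate (r + 1) (s + 1) a)) =
      ∑ s ∈ Finset.range q, ∑ j ∈ Finset.Ico (s + 1) q, (-1) ^ ((s + 1) * r + 1) *
        ((-1) ^ (j * (p + 1)) *
        lam B (innerD (K := K) r (fun b => ev g (applyAt f j b))) (rotate (r + 1) (s + 1) a)) := by
    refine Finset.sum_comm' fun j s => ?_
    simp only [Finset.mem_range, Finset.mem_Ico]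
    omega
  rw [step1, step2, ← Finset.sum_add_distrib]
  refine Finset.sum_congr rfl fun s hs => ?_
  rw [Finset.mem_range] at hs
  rw [← Finset.mul_sum, ← mul_add]
  congr 1
  -- The missing merges `l < s + 1` of this identity meet the leftover merges `l < s` of the partial
  -- rotation sums, so that only `l = s` survives.
  have h3 := sum_innerD_comp h hf g (show s + 1 ≤ q by omega) (rotate (r + 1) (s + 1) a)
  have h4 := congrArg (fun x => B x 1) h3
  simp only [map_sub, map_sum, map_smul, LinearMap.sub_apply, LinearMap.sum_apply,
    LinearMap.smul_apply, smul_eq_mul] at h4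
  simp only [lam]
  rw [h4, Finset.sum_range_succ, neg_one_pow_congr' (K := K) (n := s * (p + 1))
    (show ((s + 1 + 1) * (p + 1)) % 2 = (s * (p + 1)) % 2 by
      rw [show (s + 1 + 1) * (p + 1) = s * (p + 1) + 2 * (p + 1) by ring]; omega), pow_add _ _ s]
  ring

/-- The functional of `q` letters `a_p, …, a_{r-1}, a_r f(a_0, …, a_{p-1})`. -/
def absorb {p : ℕ} (q : ℕ) (f : Cochain K A p) (a : ℕ → A) (l : ℕ) : A :=
  if l + 1 < q then a (p + l) else a (p + l) * ev f a

/-- The rotation puts `a_r` at index `s`, directly before the block `a_0, …, a_{p-1}`, so the merge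
at `s` forms `a_r f(a_0, …, a_{p-1})`. -/
lemma ev_mergeAt_applyAt_rotate {p q r : ℕ} (h : r + 1 = q + p) (f : Cochain K A p)
    (g : Cochain K A q) {s : ℕ} (hs : s < q) (a : ℕ → A) :
    ev g (mergeAt s (applyAt f (s + 1) (rotate (r + 1) (s + 1) a))) =
      ev g (rotate q (s + 1) (absorb q f a)) := by
  refine ev_congr g fun l hl => ?_
  have e0 : shift (s + 1) (rotate (r + 1) (s + 1) a) = a := by
    funext l
    have h1 : ¬ s + 1 + l < s + 1 := by omega
    simp [shift, rotate, h1]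
  rw [applyAt, e0]
  generalize hu : ev f a = u
  rcases lt_trichotomy l s with h1 | rfl | h1
  · have h2 : l < s + 1 := by omega
    have h3 : q - (s + 1) + l + 1 < q := by omega
    simp only [mergeAt, blockAt, rotate, absorb, h1, h2, h3, if_true]
    congr 1
    omega
  · have h3 : ¬ q - (l + 1) + l + 1 < q := by omega
    simp only [mergeAt, blockAt, rotate, absorb, h3, lt_irrefl, Nat.lt_succ_self, if_true,
      if_false, hu]
    congr 2
    omega
  · have h2 : ¬ l < s := by omega
    have h3 : ¬ l = s := by omega
    have h4 : ¬ l + 1 < s + 1 := by omega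
    have h5 : ¬ l + 1 = s + 1 := by omega
    have h6 : ¬ l < s + 1 := by omega
    have h7 : ¬ l + 1 + p - 1 < s + 1 := by omega
    have h8 : l - (s + 1) + 1 < q := by omega
    simp only [mergeAt, blockAt, rotate, absorb, h2, h3, h4, h5, h6, h7, h8, if_true, if_false]
    congr 1
    omega

lemma dualD_homotopyForm (hsymm : B.IsSymm) (hinv : ∀ a b c : A, B (a * b) c = B a (b * c))
    {p q r : ℕ} (h : r + 1 = q + p) {f : Cochain K A p}
    (hf : f ∈ cocycles K A p) {g : Cochain K A q} (hg : g ∈ cocycles K A q) (a : ℕ → A) :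
    dualD r (homotopyForm B g f r) a = (-1) ^ (p + q) * (B (ev (circ h g f) a) (a r) -
      (-1) ^ (q * (p + 1)) * halfConnes B g f r a) +
      (-1) ^ p * ∑ s ∈ Finset.range q, (-1) ^ ((s + 1) * (q + 1)) *
        lam B (ev g) (rotate q (s + 1) (absorb q f a)) := by
  rw [dualD_homotopyForm_aux h hf g a]
  set Φ : ℕ → ℕ → K := fun k t => B (ev g (applyAt f k (rotate (r + 1) t a)))
    (applyAt f k (rotate (r + 1) t a) q) with hΦ
  have h1 : ∀ s k, s ≤ k → k < q → lam B (innerD (K := K) q (ev g))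
      (applyAt f (k + 1) (rotate (r + 1) (s + 1) a)) = Φ k s + (-1) ^ (q + 1) * Φ (k + 1) (s + 1) := by
    intro s k hsk hk
    rw [lam, innerD_of_cocycle hg]
    simp only [map_add, map_smul, LinearMap.add_apply, LinearMap.smul_apply, smul_eq_mul]
    rw [form_mul_left hsymm hinv, one_mul, hinv, mul_one, shift_applyAt]
    have e1 : ev g (applyAt f k (shift 1 (rotate (r + 1) (s + 1) a))) =
        ev g (applyAt f k (rotate (r + 1) s a)) := by
      refine dependsOnFirst_comp h f g hk _ _ fun l hl => ?_
      unfold shift rotate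
      grind
    have e2 : applyAt f (k + 1) (rotate (r + 1) (s + 1) a) 0 =
        applyAt f k (rotate (r + 1) s a) q := by
      unfold applyAt blockAt rotate
      grind
    rw [e1, e2]
  -- By the cocycle identity for `g`, `Φ` at `(k, s)` occurs together with `Φ` at `(k + 1, s + 1)`,
  -- so the sums `T s` telescope. `T 0` is the pairing with `g ∘ f`, `T q` is empty, and the terms
  -- with `k = q`, where `f` has left the arguments of `g`, form `halfConnes`.
  set T : ℕ → K := fun s => ∑ k ∈ Finset.Ico s q, (-1) ^ (s * r + k * (p + 1)) * Φ k s with hT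
  have h2 : ∀ s ∈ Finset.range q, (-1) ^ ((s + 1) * r + 1) *
      ∑ k ∈ Finset.Ico (s + 1) (q + 1), (-1) ^ ((k + 1) * (p + 1)) *
        lam B (innerD (K := K) q (ev g)) (applyAt f k (rotate (r + 1) (s + 1) a)) =
      (-1) ^ (p + q) * (- (T (s + 1) - T s) -
        (-1) ^ (q * (p + 1)) * ((-1) ^ ((s + 1) * r) * Φ q (s + 1))) := by
    intro s hs
    rw [Finset.mem_range] at hs
    have e1 : (-1 : K) ^ (q * (p + 1)) * ((-1) ^ ((s + 1) * r) * Φ q (s + 1)) =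
        (-1) ^ ((s + 1) * r + q * (p + 1)) * Φ q (s + 1) := by
      rw [← mul_assoc, ← pow_add, add_comm]
    have e2 := Finset.sum_Ico_succ_top (show s + 1 ≤ q by omega)
      (fun k => (-1 : K) ^ ((s + 1) * r + k * (p + 1)) * Φ k (s + 1))
    rw [e1, neg_sub, sub_sub, hT]
    dsimp only
    rw [← e2, mul_sub, Finset.mul_sum, Finset.mul_sum, Finset.mul_sum,
      ← Finset.sum_Ico_add' _ s q 1, ← Finset.sum_Ico_add' _ s q 1, ← Finset.sum_sub_distrib]
    refine Finset.sum_congr rfl fun k hk => ?_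
    rw [Finset.mem_Ico] at hk
    rw [h1 s k hk.1 hk.2]
    have e3 : (-1 : K) ^ ((s + 1) * r + 1) * (-1) ^ ((k + 1 + 1) * (p + 1)) =
        (-1) ^ (p + q) * (-1) ^ (s * r + k * (p + 1)) := by
      rw [← pow_add, ← pow_add]
      apply neg_one_pow_congr'
      rw [show (s + 1) * r + 1 + (k + 1 + 1) * (p + 1) =
        s * r + (r + 1) + k * (p + 1) + 2 * (p + 1) by ring, h]
      omega
    have e4 : (-1 : K) ^ ((s + 1) * r + 1) * (-1) ^ ((k + 1 + 1) * (p + 1)) * (-1) ^ (q + 1) =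
        - ((-1) ^ (p + q) * (-1) ^ ((s + 1) * r + (k + 1) * (p + 1))) := by
      rw [← pow_add, ← pow_add, ← pow_add]
      apply neg_one_pow_eq_neg
      rw [show (s + 1) * r + 1 + (k + 1 + 1) * (p + 1) + (q + 1) =
        (s + 1) * r + (k + 1) * (p + 1) + p + q + 3 by ring]
      omega
    linear_combination Φ k s * e3 + Φ (k + 1) (s + 1) * e4
  have h3 : ∀ s ∈ Finset.range q, (-1) ^ ((s + 1) * r + 1) * ((-1) ^ (s * (p + 1) + s) *
      lam B (ev g) (mergeAt s (applyAt f (s + 1) (rotate (r + 1) (s + 1) a)))) =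
      - ((-1) ^ p * ((-1) ^ ((s + 1) * (q + 1)) *
        lam B (ev g) (rotate q (s + 1) (absorb q f a)))) := by
    intro s hs
    rw [Finset.mem_range] at hs
    rw [lam, ev_mergeAt_applyAt_rotate h f g hs, lam, ← mul_assoc, ← mul_assoc, ← neg_mul, ← pow_add, ← pow_add]
    congr 1
    apply neg_one_pow_eq_neg
    rw [show (s + 1) * r + 1 + (s * (p + 1) + s) + 1 =
      s * (r + 1) + (r + 1) + 1 + s * (p + 1) by ring, h,
      show s * (q + p) + (q + p) + 1 + s * (p + 1) = p + (s + 1) * (q + 1) + 2 * (s * p) by ring]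
    omega
  simp only [mul_sub]
  rw [Finset.sum_sub_distrib, Finset.sum_congr rfl h2, Finset.sum_congr rfl h3,
    Finset.sum_neg_distrib, ← Finset.mul_sum, ← Finset.mul_sum, Finset.sum_sub_distrib,
    Finset.sum_neg_distrib, Finset.sum_range_sub, ← Finset.mul_sum, sub_neg_eq_add]
  have hTq : T q = 0 := by simp [hT]
  have hT0 : T 0 = B (ev (circ h g f) a) (a r) := by
    rw [ev_circ_applyAt, hT]
    simp only [map_sum, map_smul, LinearMap.sum_apply, LinearMap.smul_apply, smul_eq_mul,
      Nat.Ico_zero_eq_range, zero_mul, zero_add]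
    refine Finset.sum_congr rfl fun k hk => ?_
    rw [Finset.mem_range] at hk
    rw [hΦ]
    simp only [rotate_zero]
    congr 2
    unfold applyAt blockAt
    grind
  have hH : ∑ t ∈ Finset.range q, (-1) ^ ((t + 1) * r) * Φ q (t + 1) = halfConnes B g f r a := by
    refine Finset.sum_congr rfl fun t _ => ?_
    have e1 : ∀ b, ev g (applyAt f q b) = ev g b := fun b =>
      ev_congr g fun l hl => by simp [applyAt, blockAt, hl]
    have e2 : ∀ b, applyAt f q b q = ev f (shift q b) := fun b => by simp [applyAt, blockAt]
    rw [hΦ, lam, hinv, mul_one]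
    simp only [e1, e2]
  rw [hTq, hT0, hH]
  ring

end Homotopy

/-! ### The bracket as the deviation of `Δ` from a derivation -/

section Bracket

variable {K : Type*} [Field K] {A : Type*} [Ring A] [Algebra K A]
variable {B : LinearMap.BilinForm K A}

/-- A cochain viewed in an equal degree. -/
def castCochain {m n : ℕ} (h : m = n) (f : Cochain K A m) : Cochain K A n :=
  f.domDomCongr (finCongr h)

@[simp] lemma ev_castCochain {m n : ℕ} (h : m = n) (f : Cochain K A m) (a : ℕ → A) :
    ev (castCochain h f) a = ev f a := by
  subst h
  rfl

lemma cup_commutative {m q r : ℕ} (h : r = m + q) {F : Cochain K A m} (hF : F ∈ cocycles K A m)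
    {g : Cochain K A q} (hg : g ∈ cocycles K A q) :
    castCochain h.symm (cup K A m q F g) - ((-1 : K) ^ (m * q)) •
      castCochain (by omega) (cup K A q m g F) ∈ coboundaries K A r := by
  cases r with
  -- There is no cochain of degree `-1` to serve as a homotopy, but equality is strict: a
  -- `0`-cocycle is a central element.
  | zero =>
    obtain rfl : m = 0 := by omega
    obtain rfl : q = 0 := by omega
    have : castCochain h.symm (cup K A 0 0 F g) - ((-1 : K) ^ (0 * 0)) •
      castCochain (by omega) (cup K A 0 0 g F) = 0 := by
      refine cochain_ext fun a => ?_
      have e : ∀ (f : Cochain K A 0) b, ev f b = f Fin.elim0 :=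
        fun f b => congrArg f (Subsingleton.elim _ _)
      have h1 := ev_hochD F (fun _ => ev g a)
      rw [LinearMap.mem_ker.1 hF] at h1
      simp only [innerD, Finset.range_zero, Finset.sum_empty, zero_add, pow_one, neg_smul, one_smul,
        sub_zero, ev_zero, e] at h1
      simp only [ev_sub, ev_castCochain, ev_cup, mul_zero, pow_zero, one_smul,
        ev_zero]
      simp only [e]
      rw [← neg_eq_zero, h1]
      abel
    rw [this]
    exact zero_mem _
  | succ n =>
    refine ⟨((-1 : K) ^ m) • circ (h.trans (add_comm m q)) g F, cochain_ext fun a => ?_⟩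
    rw [map_smul, ev_smul, ev_hochD_circ _ hF hg, smul_sub, smul_smul, smul_smul, ← pow_add,
      ← pow_add, Even.neg_one_pow ⟨m, rfl⟩, one_smul]
    simp only [ev_sub, ev_smul, ev_castCochain, ev_cup]
    congr 2
    exact neg_one_pow_congr' (by omega)

variable [FiniteDimensional K A]

/-- The values of `Δ f`, which is `0` for `f` of degree `0`. -/
def connesEv (B : LinearMap.BilinForm K A) (hB : B.Nondegenerate) :
    {p : ℕ} → Cochain K A p → (ℕ → A) → A
  | 0, _ => fun _ => 0
  | _ + 1, f => ev (connes B hB _ f)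

/-- By nondegeneracy the partial rotation sums are dual to genuine cochains, and `dualD` is the
coboundary of these. -/
lemma exists_coboundary_homotopyForm (hsymm : B.IsSymm)
    (hinv : ∀ a b c : A, B (a * b) c = B a (b * c)) (hB : B.Nondegenerate) {p q r : ℕ}
    (h : r + 1 = q + p) (f : Cochain K A p) (g : Cochain K A q) :
    ∃ X ∈ coboundaries K A r, ∀ a, B (ev X a) (a r) = dualD r (homotopyForm B g f r) a := by
  cases r with
  | zero =>
    -- In degree `0` necessarily `q ≤ 1`, so the only index is `j = 0`, whose sum of rotations is
    -- empty.
    refine ⟨0, zero_mem _, fun a => ?_⟩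
    have hz : ∀ b, homotopyForm B g f 0 b = 0 := fun b => by
      refine Finset.sum_eq_zero fun j hj => ?_
      rw [Finset.mem_range] at hj
      obtain rfl : j = 0 := by omega
      simp
    simp [dualD, innerD, hz]
  | succ n =>
    have hex : ∀ j : Fin q, ∃ X : Cochain K A n, ∀ a, B (ev X a) (a n) =
        ∑ t ∈ Finset.Icc 1 (j : ℕ), (-1) ^ (t * (n + 1 + 1)) *
          lam B (fun b => ev g (applyAt f j b)) (rotate (n + 1) t a) := by
      intro j
      have hj := j.2
      obtain ⟨X, hX⟩ := exists_cyclic_cochain hB (compAt h g f j)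
        (fun t => if t ≤ j then (-1) ^ (t * (n + 1 + 1)) else 0)
      refine ⟨X, fun a => ?_⟩
      rw [hX]
      refine (Finset.sum_subset_zero_on_sdiff (fun t ht => ?_) (fun t ht => ?_)
        fun t ht => ?_).symm
      · simp only [Finset.mem_Icc] at *; omega
      · simp only [Finset.mem_sdiff, Finset.mem_Icc] at ht
        rw [if_neg (by omega), zero_mul]
      · rw [Finset.mem_Icc] at ht
        rw [if_pos ht.2, ev_compAt]
        rfl
    choose X hX using hex
    refine ⟨hochD K A n (∑ j : Fin q, ((-1 : K) ^ ((j : ℕ) * (p + 1))) • X j), ⟨_, rfl⟩, fun a => ?_⟩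
    rw [hochD_form hsymm hinv]
    congr 1
    funext b
    simp only [ev_sum, ev_smul, map_sum, map_smul, LinearMap.sum_apply, LinearMap.smul_apply,
      smul_eq_mul, hX, homotopyForm, Finset.sum_range]

/-- The sum is `Δ g` paired with the last absorbed letter `a_r f(…)`; cyclic invariance of the form
moves `f(…)` in front of `Δ g`. -/
lemma sum_lam_rotate_absorb (hsymm : B.IsSymm) (hinv : ∀ a b c : A, B (a * b) c = B a (b * c))
    (hB : B.Nondegenerate) {p q r : ℕ} (h : r + 1 = q + p) (f : Cochain K A p)
    (g : Cochain K A q) (a : ℕ → A) :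
    ∑ s ∈ Finset.range q, (-1) ^ ((s + 1) * (q + 1)) *
        lam B (ev g) (rotate q (s + 1) (absorb q f a)) =
      (-1) ^ (q + 1) * B (ev f a * connesEv B hB g (shift p a)) (a r) := by
  cases q with
  | zero => simp [connesEv]
  | succ n =>
    have h1 := connes_lam hB g (absorb (n + 1) f a)
    rw [ev_congr (b := shift p a) _ fun l hl => by simp [absorb, shift, hl], sum_Icc_one] at h1
    have h2 : absorb (n + 1) f a n = a r * ev f a := by
      simp only [absorb, lt_irrefl, if_false]
      congr 2
      omega
    rw [h2, ← form_mul_left hsymm hinv] at h1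
    rw [connesEv, h1, ← mul_assoc, ← pow_add, Even.neg_one_pow ⟨n + 1, by ring⟩, one_mul]
    refine Finset.sum_congr rfl fun s _ => ?_
    congr 1
    exact neg_one_pow_congr' (by
      rw [show (s + 1) * (n + 1 + 1) = (s + 1) * n + 2 * (s + 1) by ring]; omega)

lemma exists_halfConnes (hsymm : B.IsSymm) (hinv : ∀ a b c : A, B (a * b) c = B a (b * c))
    (hB : B.Nondegenerate) {p q r : ℕ} (h : r + 1 = q + p) {f : Cochain K A p}
    (hf : f ∈ cocycles K A p) {g : Cochain K A q} (hg : g ∈ cocycles K A q) :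
    ∃ X ∈ coboundaries K A r, ∀ a, halfConnes B g f r a =
      B (((-1 : K) ^ (q * (p + 1))) • (ev (circ h g f) a - ev f a * connesEv B hB g (shift p a))
        + ev X a) (a r) := by
  obtain ⟨X, hX, hX'⟩ := exists_coboundary_homotopyForm hsymm hinv hB h f g
  refine ⟨(-(-1 : K) ^ (p + q + q * (p + 1))) • X, Submodule.smul_mem _ _ hX, fun a => ?_⟩
  have h1 := dualD_homotopyForm hsymm hinv h hf hg a
  rw [← hX', sum_lam_rotate_absorb hsymm hinv hB h] at h1
  simp only [map_add, map_sub, map_smul, LinearMap.add_apply, LinearMap.sub_apply,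
    LinearMap.smul_apply, smul_eq_mul, ev_smul]
  rw [h1]
  have e1 : (-1 : K) ^ (p + q) * (-1) ^ (p + q) = 1 := by
    rw [← pow_add, Even.neg_one_pow ⟨_, rfl⟩]
  have e2 : (-1 : K) ^ (q * (p + 1)) * (-1) ^ (q * (p + 1)) = 1 := by
    rw [← pow_add, Even.neg_one_pow ⟨_, rfl⟩]
  have e3 : (-1 : K) ^ p * (-1) ^ (q + 1) = - (-1) ^ (p + q) := by
    rw [← pow_add]
    exact neg_one_pow_eq_neg (by omega)
  rw [pow_add _ (p + q)]
  set C := B (ev (circ h g f) a) (a r)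
  set M := B (ev f a * connesEv B hB g (shift p a)) (a r)
  set H := halfConnes B g f r a
  set s := (-1 : K) ^ (q * (p + 1))
  set u := (-1 : K) ^ (p + q)
  linear_combination (-H * u * u) * e2 + (- H + s * C - s * M) * e1 + (u * s * M) * e3

/-- The first `p` rotations place the last letter among the arguments of `f`, the remaining `q`
among those of `g`. In the second group, `⟨x y, 1⟩ = ⟨y x, 1⟩` exchanges the factors. -/
lemma connes_cup (hsymm : B.IsSymm) (hinv : ∀ a b c : A, B (a * b) c = B a (b * c))
    (hB : B.Nondegenerate) {p q r : ℕ} (h : r + 1 = p + q) (f : Cochain K A p)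
    (g : Cochain K A q) (a : ℕ → A) :
    B (ev (connes B hB r (castCochain h.symm (cup K A p q f g))) a) (a r) =
      (-1) ^ r * (halfConnes B f g r a + (-1) ^ (p * r) * halfConnes B g f r a) := by
  have hc : ev (castCochain h.symm (cup K A p q f g)) = fun b => ev f b * ev g (shift p b) := by
    funext b
    rw [ev_castCochain, ev_cup]
  rw [connes_lam, sum_Icc_one, hc]
  conv_lhs => rw [h, Finset.sum_range_add, ← h]
  congr 2
  · rw [halfConnes, Finset.mul_sum]
    refine Finset.sum_congr rfl fun s hs => ?_
    rw [Finset.mem_range] at hs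
    rw [← mul_assoc, ← pow_add]
    congr 1
    · congr 1; ring
    · simp only [lam]
      rw [form_mul_left hsymm hinv, one_mul, hinv, mul_one]
      congr 1
      · congr 1
        refine ev_congr g fun l hl => ?_
        unfold shift rotate
        grind
      · refine ev_congr f fun l hl => ?_
        unfold shift rotate
        grind

lemma connes_mem_cocycles (hsymm : B.IsSymm) (hinv : ∀ a b c : A, B (a * b) c = B a (b * c))
    (hB : B.Nondegenerate) {n : ℕ} {f : Cochain K A (n + 1)} (hf : f ∈ cocycles K A (n + 1)) :
    connes B hB n f ∈ cocycles K A n := by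
  refine LinearMap.mem_ker.2 ?_
  rw [hochD_connes hsymm hinv hB, LinearMap.mem_ker.1 hf, map_zero, neg_zero]

lemma connes_hochD_zero (hsymm : B.IsSymm) (hinv : ∀ a b c : A, B (a * b) c = B a (b * c))
    (hB : B.Nondegenerate) (g : Cochain K A 0) : connes B hB 0 (hochD K A 0 g) = 0 := by
  refine cochain_ext_form hB fun a => ?_
  rw [connes_lam]
  have e : ∀ b, ev g b = g Fin.elim0 := fun b => congrArg g (Subsingleton.elim _ _)
  simp only [lam_hochD hsymm hinv, e]
  simp [lam, innerD]

/-- On cocycles, the deviation of `Δ` from being a derivation is the Gerstenhaber bracket, up to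
sign and coboundaries. -/
theorem exists_connes_cup_eq (hsymm : B.IsSymm)
    (hinv : ∀ a b c : A, B (a * b) c = B a (b * c)) (hB : B.Nondegenerate) {p q r : ℕ}
    (h : r + 1 = p + q) {f : Cochain K A p} (hf : f ∈ cocycles K A p) {g : Cochain K A q}
    (hg : g ∈ cocycles K A q) :
    ∃ X ∈ coboundaries K A r, ∀ a, ev (connes B hB r (castCochain h.symm (cup K A p q f g))) a =
      connesEv B hB f a * ev g (shift (p - 1) a) +
      ((-1 : K) ^ p) • (ev f a * connesEv B hB g (shift p a)) +
      ((-1 : K) ^ ((p + 1) * q + 1)) • ev (gerstenhaber h f g) a + ev X a := by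
  obtain ⟨X₁, hX₁, h₁⟩ := exists_halfConnes hsymm hinv hB (h.trans (add_comm p q)) hf hg
  obtain ⟨X₂, hX₂, h₂⟩ := exists_halfConnes hsymm hinv hB h hg hf
  obtain ⟨M₁, hM₁⟩ : ∃ M : Cochain K A r, ∀ a, ev M a = ev f a * connesEv B hB g (shift p a) := by
    cases q with
    | zero => exact ⟨0, fun a => by simp [connesEv]⟩
    | succ n =>
      refine ⟨castCochain (by omega) (cup K A p n f (connes B hB n g)), fun a => ?_⟩
      rw [ev_castCochain, ev_cup, connesEv]
  -- The half belonging to `f` produces `g ⌣ Δ f`, whereas the derivation rule asks for `Δ f ⌣ g`.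
  -- As `Δ f` is a cocycle, the two differ by a sign and a coboundary.
  obtain ⟨M₂, M₃, hM₂, hM₃, hM⟩ : ∃ M₂ M₃ : Cochain K A r,
      (∀ a, ev M₂ a = ev g a * connesEv B hB f (shift q a)) ∧
      (∀ a, ev M₃ a = connesEv B hB f a * ev g (shift (p - 1) a)) ∧
      M₃ - ((-1 : K) ^ ((p + 1) * q)) • M₂ ∈ coboundaries K A r := by
    cases p with
    | zero => exact ⟨0, 0, fun a => by simp [connesEv], fun a => by simp [connesEv], by simp⟩
    | succ n =>
      refine ⟨castCochain (by omega) (cup K A q n g (connes B hB n f)),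
        castCochain (by omega) (cup K A n q (connes B hB n f) g), fun a => ?_, fun a => ?_, ?_⟩
      · rw [ev_castCochain, ev_cup, connesEv]
      · rw [ev_castCochain, ev_cup, connesEv, Nat.add_sub_cancel]
      · rw [neg_one_pow_congr' (K := K) (n := n * q) (by
          rw [show (n + 1 + 1) * q = n * q + 2 * q by ring]; omega)]
        exact cup_commutative (by omega) (connes_mem_cocycles hsymm hinv hB hf) hg
  have key : connes B hB r (castCochain h.symm (cup K A p q f g)) =
      ((-1 : K) ^ r) • ((((-1 : K) ^ (p * (q + 1))) • (circ h f g - M₂) + X₂) +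
        ((-1 : K) ^ (p * r)) •
          (((-1 : K) ^ (q * (p + 1))) • (circ (h.trans (add_comm p q)) g f - M₁) + X₁)) := by
    refine cochain_ext_form hB fun a => ?_
    rw [connes_cup hsymm hinv hB h, h₁, h₂]
    simp only [ev_add, ev_sub, ev_smul, hM₁, hM₂, map_add, map_smul, LinearMap.add_apply,
      LinearMap.smul_apply, smul_eq_mul]
  refine ⟨((-1 : K) ^ r) • X₂ + ((-1 : K) ^ (r + p * r)) • X₁ -
    (M₃ - ((-1 : K) ^ ((p + 1) * q)) • M₂), Submodule.sub_mem _ (Submodule.add_mem _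
      (Submodule.smul_mem _ _ hX₂) (Submodule.smul_mem _ _ hX₁)) hM, fun a => ?_⟩
  rw [key, ← hM₁, ← hM₃]
  have hpp := (Nat.even_mul_succ_self p).two_dvd
  have s1 : (-1 : K) ^ r * (-1) ^ (p * (q + 1)) = (-1) ^ ((p + 1) * q + 1) := by
    rw [← pow_add]
    apply neg_one_pow_congr'
    rw [show p * (q + 1) = p * q + p by ring, show (p + 1) * q + 1 = p * q + q + 1 by ring]
    omega
  have s2 : (-1 : K) ^ r * (-1) ^ (p * (q + 1)) = - (-1) ^ ((p + 1) * q) := by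
    rw [s1, pow_succ, mul_neg_one]
  have s3 : (-1 : K) ^ r * ((-1) ^ (p * r) * (-1) ^ (q * (p + 1))) = - (-1) ^ p := by
    rw [← pow_add, ← pow_add]
    apply neg_one_pow_eq_neg
    have : p * r + p = p * (p + 1) + p * q - p := by
      rw [show p * r + p = p * (r + 1) by ring, h, mul_add, mul_add]
      omega
    rw [show q * (p + 1) = p * q + q by ring]
    have h4 : p ≤ p * (p + 1) := Nat.le_mul_of_pos_right _ (by omega)
    omega
  have s4 : (-1 : K) ^ ((p + 1) * q + 1) * (-1) ^ ((p + 1) * (q + 1)) = (-1) ^ p := by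
    rw [← pow_add]
    apply neg_one_pow_congr'
    rw [show (p + 1) * q + 1 + (p + 1) * (q + 1) = p + 2 * ((p + 1) * q + 1) by ring]
    omega
  simp only [gerstenhaber, ev_add, ev_sub, ev_smul, smul_add, smul_sub, smul_smul, s1, s4,
    pow_add _ r, s3, neg_smul, ev_neg]
  rw [← s1, s2]
  simp only [neg_smul]
  abel

end Bracket

/-! ## Multilinearity and closure properties of the operations `m_n` -/

section Operations

variable {K : Type*} [Field K] {W : Type*} [AddCommGroup W] [Module K W]
variable (μ : W →ₗ[K] W →ₗ[K] W) (D τ : W →ₗ[K] W)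

/-- `a ↦ g(a_0, …, a_{n-1}) a_n` -/
def mulLast {n : ℕ} (g : MultilinearMap K (fun _ : Fin n => W) W) :
    MultilinearMap K (fun _ : Fin (n + 1) => W) W :=
  MultilinearMap.uncurryRight (M := fun _ => W) (μ.compMultilinearMap g)

/-- `a ↦ τ(a_0) g(a_1, …, a_n)` -/
def mulFirst {n : ℕ} (g : MultilinearMap K (fun _ : Fin n => W) W) :
    MultilinearMap K (fun _ : Fin (n + 1) => W) W :=
  LinearMap.uncurryLeft (M := fun _ => W)
    { toFun := fun x => (μ (τ x)).compMultilinearMap g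
      map_add' := fun x y => by ext; simp
      map_smul' := fun c x => by ext; simp }

/-- `gammaOp` as a multilinear map. -/
def gammaMulti : (n : ℕ) → MultilinearMap K (fun _ : Fin (n + 1) => W) W
  | 0 => MultilinearMap.ofSubsingleton K W W (0 : Fin 1) LinearMap.id
  | n + 1 => mulLast μ (gammaMulti n)

/-- `mOp` as a multilinear map. -/
def mMulti : (n : ℕ) → MultilinearMap K (fun _ : Fin n => W) W
  | 0 => 0
  | 1 => MultilinearMap.ofSubsingleton K W W (0 : Fin 1) D
  | 2 => D.compMultilinearMap (gammaMulti μ 1)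
      - mulLast μ (MultilinearMap.ofSubsingleton K W W (0 : Fin 1) D)
      - mulFirst μ τ (MultilinearMap.ofSubsingleton K W W (0 : Fin 1) D)
  | n + 3 => D.compMultilinearMap (gammaMulti μ (n + 2))
      - mulLast μ (D.compMultilinearMap (gammaMulti μ (n + 1)))
      - mulFirst μ τ (D.compMultilinearMap (gammaMulti μ (n + 1)))
      + mulLast μ (mulFirst μ τ (D.compMultilinearMap (gammaMulti μ n)))

lemma gammaMulti_apply (n : ℕ) (a : Fin (n + 1) → W) : gammaMulti μ n a = gammaOp μ n a := by
  induction n with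
  | zero => simp [gammaMulti, gammaOp]
  | succ n ih =>
    rw [gammaMulti, gammaOp, mulLast, MultilinearMap.uncurryRight_apply,
      LinearMap.compMultilinearMap_apply, ih]
    rfl

lemma mMulti_apply (n : ℕ) (a : Fin n → W) : mMulti μ D τ n a = mOp μ D τ n a := by
  match n with
  | 0 => rfl
  | 1 => simp [mMulti, mOp]
  | 2 =>
    simp only [mMulti, mOp, sub_apply, LinearMap.compMultilinearMap_apply,
      gammaMulti_apply]
    rfl
  | n + 3 =>
    simp only [mMulti, mOp, sub_apply, add_apply,
      LinearMap.compMultilinearMap_apply, gammaMulti_apply, mulLast, mulFirst,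
      MultilinearMap.uncurryRight_apply, LinearMap.uncurryLeft_apply, LinearMap.coe_mk,
      AddHom.coe_mk]
    rfl

variable {μ D τ}

lemma gammaOp_mem {Z : Submodule K W} (hμ : ∀ x ∈ Z, ∀ y ∈ Z, μ x y ∈ Z) {n : ℕ}
    {a : Fin (n + 1) → W} (ha : ∀ i, a i ∈ Z) : gammaOp μ n a ∈ Z := by
  induction n with
  | zero => exact ha 0
  | succ n ih => exact hμ _ (ih fun i => ha _) _ (ha _)

lemma mOp_mem {Z : Submodule K W} (hμ : ∀ x ∈ Z, ∀ y ∈ Z, μ x y ∈ Z) (hD : ∀ x ∈ Z, D x ∈ Z)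
    (hτ : ∀ x ∈ Z, τ x ∈ Z) {n : ℕ} {a : Fin n → W} (ha : ∀ i, a i ∈ Z) : mOp μ D τ n a ∈ Z := by
  match n with
  | 0 => exact Z.zero_mem
  | 1 => exact hD _ (ha 0)
  | 2 =>
    exact Z.sub_mem (Z.sub_mem (hD _ (hμ _ (ha 0) _ (ha 1))) (hμ _ (hD _ (ha 0)) _ (ha 1)))
      (hμ _ (hτ _ (ha 0)) _ (hD _ (ha 1)))
  | n + 3 =>
    refine Z.add_mem (Z.sub_mem (Z.sub_mem ?_ ?_) ?_) ?_
    · exact hD _ (gammaOp_mem hμ ha)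
    · exact hμ _ (hD _ (gammaOp_mem hμ fun i => ha _)) _ (ha _)
    · exact hμ _ (hτ _ (ha 0)) _ (hD _ (gammaOp_mem hμ fun i => ha _))
    · exact hμ _ (hμ _ (hτ _ (ha 0)) _ (hD _ (gammaOp_mem hμ fun i => ha _))) _ (ha _)

/-- The operations are compatible with congruence modulo an ideal `I` of a subalgebra `Z`. -/
lemma mOp_sub_mem {Z I : Submodule K W} (hμ : ∀ x ∈ Z, ∀ y ∈ Z, μ x y ∈ Z)
    (hD : ∀ x ∈ Z, D x ∈ Z) (hτ : ∀ x ∈ Z, τ x ∈ Z) (hμl : ∀ x ∈ I, ∀ y ∈ Z, μ x y ∈ I)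
    (hμr : ∀ x ∈ Z, ∀ y ∈ I, μ x y ∈ I) (hDI : ∀ x ∈ I, D x ∈ I) (hτI : ∀ x ∈ I, τ x ∈ I)
    {n : ℕ} {a b : Fin n → W} (ha : ∀ i, a i ∈ Z) (hb : ∀ i, b i ∈ Z)
    (hab : ∀ i, a i - b i ∈ I) : mOp μ D τ n a - mOp μ D τ n b ∈ I := by
  -- Congruence modulo `I` inside `Z` is preserved by every building block of `mOp`.
  set R : W → W → Prop := fun x y => x ∈ Z ∧ y ∈ Z ∧ x - y ∈ I with hR
  have rμ : ∀ {x y x' y'}, R x x' → R y y' → R (μ x y) (μ x' y') := by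
    rintro x y x' y' ⟨h1, h2, h3⟩ ⟨h4, h5, h6⟩
    refine ⟨hμ _ h1 _ h4, hμ _ h2 _ h5, ?_⟩
    have : μ x y - μ x' y' = μ (x - x') y + μ x' (y - y') := by
      simp only [map_sub, LinearMap.sub_apply]
      abel
    rw [this]
    exact I.add_mem (hμl _ h3 _ h4) (hμr _ h2 _ h6)
  have rD : ∀ {x x'}, R x x' → R (D x) (D x') := by
    rintro x x' ⟨h1, h2, h3⟩
    exact ⟨hD _ h1, hD _ h2, by rw [← map_sub]; exact hDI _ h3⟩
  have rτ : ∀ {x x'}, R x x' → R (τ x) (τ x') := by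
    rintro x x' ⟨h1, h2, h3⟩
    exact ⟨hτ _ h1, hτ _ h2, by rw [← map_sub]; exact hτI _ h3⟩
  have radd : ∀ {x y x' y'}, R x x' → R y y' → R (x + y) (x' + y') := by
    rintro x y x' y' ⟨h1, h2, h3⟩ ⟨h4, h5, h6⟩
    exact ⟨Z.add_mem h1 h4, Z.add_mem h2 h5, by
      rw [add_sub_add_comm]; exact I.add_mem h3 h6⟩
  have rsub : ∀ {x y x' y'}, R x x' → R y y' → R (x - y) (x' - y') := by
    rintro x y x' y' ⟨h1, h2, h3⟩ ⟨h4, h5, h6⟩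
    exact ⟨Z.sub_mem h1 h4, Z.sub_mem h2 h5, by
      rw [sub_sub_sub_comm]; exact I.sub_mem h3 h6⟩
  have rγ : ∀ {n : ℕ} {a b : Fin (n + 1) → W}, (∀ i, R (a i) (b i)) →
      R (gammaOp μ n a) (gammaOp μ n b) := by
    intro n a b hab
    induction n with
    | zero => exact hab 0
    | succ n ih => exact rμ (ih fun i => hab _) (hab _)
  have h : ∀ i, R (a i) (b i) := fun i => ⟨ha i, hb i, hab i⟩
  suffices R (mOp μ D τ n a) (mOp μ D τ n b) from this.2.2
  match n with
  | 0 => exact ⟨Z.zero_mem, Z.zero_mem, by simp [mOp]⟩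
  | 1 => exact rD (h 0)
  | 2 => exact rsub (rsub (rD (rμ (h 0) (h 1))) (rμ (rD (h 0)) (h 1))) (rμ (rτ (h 0)) (rD (h 1)))
  | n + 3 =>
    exact radd (rsub (rsub (rD (rγ h)) (rμ (rD (rγ fun i => h _)) (h _)))
      (rμ (rτ (h 0)) (rD (rγ fun i => h _)))) (rμ (rμ (rτ (h 0)) (rD (rγ fun i => h _))) (h _))

end Operations

/-! ### Graded submodules and the sign operator on direct sums -/

section Total

variable {K : Type*} [Field K] {V : ℕ → Type*} [∀ i, AddCommGroup (V i)] [∀ i, Module K (V i)]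

/-- The elements of a graded module all of whose components lie in given submodules. -/
def totalSub (S : ∀ n, Submodule K (V n)) : Submodule K (⨁ n, V n) :=
  LinearMap.range (DirectSum.lmap fun n => (S n).subtype)

lemma totalSub_le {S : ∀ n, Submodule K (V n)} {T : Submodule K (⨁ n, V n)}
    (h : ∀ n, ∀ f ∈ S n, DirectSum.lof K ℕ V n f ∈ T) : totalSub S ≤ T := by
  rintro _ ⟨z, rfl⟩
  induction z using DirectSum.induction_on with
  | zero => rw [map_zero]; exact T.zero_mem
  | of n x =>
    have := h n x x.2
    rwa [← DirectSum.lof_eq_of K, DirectSum.lmap_lof]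
  | add x y hx hy => rw [map_add]; exact T.add_mem hx hy

lemma mem_totalSub_iff {S : ∀ n, Submodule K (V n)} {x : ⨁ n, V n} :
    x ∈ totalSub S ↔ ∀ n, x n ∈ S n := by
  classical
  constructor
  · rintro ⟨z, rfl⟩ n
    rw [DirectSum.lmap_apply]
    exact (z n).2
  · intro h
    rw [← DirectSum.sum_support_of x]
    refine Submodule.sum_mem _ fun n _ => ⟨DirectSum.lof K ℕ (fun n => S n) n ⟨x n, h n⟩, ?_⟩
    rw [DirectSum.lmap_lof]
    rfl

lemma lof_mem_totalSub {S : ∀ n, Submodule K (V n)} {n : ℕ} {f : V n} (hf : f ∈ S n) :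
    DirectSum.lof K ℕ V n f ∈ totalSub S :=
  ⟨DirectSum.lof K ℕ (fun n => S n) n ⟨f, hf⟩, by rw [DirectSum.lmap_lof]; rfl⟩

@[simp] lemma parity_lof (n : ℕ) (f : V n) :
    parity K V (DirectSum.lof K ℕ V n f) = ((-1 : K) ^ n) • DirectSum.lof K ℕ V n f := by
  rw [parity, DirectSum.lmap_lof]
  simp

lemma parity_apply (x : ⨁ n, V n) (n : ℕ) : parity K V x n = ((-1 : K) ^ n) • x n := by
  rw [parity, DirectSum.lmap_apply]
  simp

lemma parity_parity (x : ⨁ n, V n) : parity K V (parity K V x) = x := by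
  refine DFinsupp.ext fun n => ?_
  rw [parity_apply, parity_apply, smul_smul, ← pow_add, Even.neg_one_pow ⟨n, rfl⟩, one_smul]

lemma lmap_parity {V' : ℕ → Type*} [∀ i, AddCommGroup (V' i)] [∀ i, Module K (V' i)]
    (φ : ∀ n, V n →ₗ[K] V' n) (x : ⨁ n, V n) :
    DirectSum.lmap φ (parity K V x) = parity K V' (DirectSum.lmap φ x) := by
  refine DFinsupp.ext fun n => ?_
  rw [parity_apply, DirectSum.lmap_apply, DirectSum.lmap_apply, parity_apply, map_smul]

end Total

/-! ## The total space of Hochschild cochains -/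

section Total

variable {K : Type*} [Field K] {A : Type*} [Ring A] [Algebra K A]

/-- The inclusion of the `n`-cochains into the total space. -/
abbrev incl (n : ℕ) (f : Cochain K A n) : ⨁ n, Cochain K A n :=
  DirectSum.lof K ℕ (fun n => Cochain K A n) n f

lemma incl_eq_incl {m n : ℕ} (h : m = n) {f : Cochain K A m} {g : Cochain K A n}
    (hfg : ∀ a, ev f a = ev g a) : incl m f = incl n g := by
  subst h
  rw [cochain_ext hfg]

lemma incl_castCochain {m n : ℕ} (h : m = n) (f : Cochain K A m) :
    incl n (castCochain h f) = incl m f :=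
  incl_eq_incl h.symm fun a => by simp

@[simp] lemma cupTotal_incl {p q : ℕ} (f : Cochain K A p) (g : Cochain K A q) :
    cupTotal K A (incl p f) (incl q g) = incl (p + q) (cup K A p q f g) := by
  simp [cupTotal, incl]

/-- Induction on elements of the total space. -/
lemma total_induction {P : (⨁ n, Cochain K A n) → Prop} (x : ⨁ n, Cochain K A n)
    (h0 : P 0) (hof : ∀ n f, P (incl n f)) (hadd : ∀ x y, P x → P y → P (x + y)) : P x := by
  induction x using DirectSum.induction_on with
  | zero => exact h0
  | of n x => exact hof n x
  | add x y hx hy => exact hadd x y hx hy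

lemma shift_shift {α : Type*} (p q : ℕ) (a : ℕ → α) : shift q (shift p a) = shift (p + q) a := by
  funext l
  simp [shift, add_assoc]

lemma shift_zero {α : Type*} (a : ℕ → α) : shift 0 a = a := by
  funext l
  simp [shift]

lemma cupTotal_assoc (x y z : ⨁ n, Cochain K A n) :
    cupTotal K A (cupTotal K A x y) z = cupTotal K A x (cupTotal K A y z) := by
  induction x using total_induction with
  | h0 => simp
  | hadd x x' h h' => simp only [map_add, LinearMap.add_apply, h, h']
  | hof p f =>
    induction y using total_induction with
    | h0 => simp
    | hadd x x' h h' => simp only [map_add, LinearMap.add_apply, h, h']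
    | hof q g =>
      induction z using total_induction with
      | h0 => simp
      | hadd x x' h h' => simp only [map_add, h, h']
      | hof r h =>
        rw [cupTotal_incl, cupTotal_incl, cupTotal_incl, cupTotal_incl]
        exact incl_eq_incl (add_assoc _ _ _) fun a => by
          simp only [ev_cup, mul_assoc, shift_shift]

lemma cupTotal_one_left (x : ⨁ n, Cochain K A n) :
    cupTotal K A (incl 0 (oneCochain K A)) x = x := by
  induction x using total_induction with
  | h0 => simp
  | hadd x x' h h' => simp only [map_add, h, h']
  | hof p f =>
    rw [cupTotal_incl]
    exact incl_eq_incl (zero_add _) fun a => by simp [ev_cup, shift_zero]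

lemma cupTotal_one_right (x : ⨁ n, Cochain K A n) :
    cupTotal K A x (incl 0 (oneCochain K A)) = x := by
  induction x using total_induction with
  | h0 => simp
  | hadd x x' h h' => simp only [map_add, LinearMap.add_apply, h, h']
  | hof p f =>
    rw [cupTotal_incl]
    exact incl_eq_incl (add_zero _) fun a => by rw [ev_cup, ev_oneCochain, mul_one]

variable (K A) in
/-- The ring of Hochschild cochains under the cup product. -/
@[reducible] def cochainRing : Ring (⨁ n, Cochain K A n) :=
  { (inferInstance : AddCommGroup (⨁ n, Cochain K A n)) with
    mul := fun x y => cupTotal K A x y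
    one := incl 0 (oneCochain K A)
    mul_assoc := cupTotal_assoc
    one_mul := cupTotal_one_left
    mul_one := cupTotal_one_right
    left_distrib := fun x y z => map_add (cupTotal K A x) y z
    right_distrib := fun x y z => by
      change cupTotal K A (x + y) z = cupTotal K A x z + cupTotal K A y z
      rw [map_add, LinearMap.add_apply]
    zero_mul := fun x => by
      change cupTotal K A 0 x = 0
      rw [map_zero, LinearMap.zero_apply]
    mul_zero := fun x => map_zero (cupTotal K A x) }

lemma parity_cupTotal (x y : ⨁ n, Cochain K A n) :
    parity K (fun n => Cochain K A n) (cupTotal K A x y) =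
      cupTotal K A (parity K (fun n => Cochain K A n) x) (parity K (fun n => Cochain K A n) y) := by
  induction x using total_induction with
  | h0 => simp
  | hadd x x' h h' => simp only [map_add, LinearMap.add_apply, h, h']
  | hof p f =>
    induction y using total_induction with
    | h0 => simp
    | hadd x x' h h' => simp only [map_add, h, h']
    | hof q g =>
      simp only [cupTotal_incl, parity_lof, map_smul, LinearMap.smul_apply, smul_smul, pow_add,
        mul_comm]

variable (K A) in
/-- The Hochschild coboundary on the total space. -/
def hochTotal : (⨁ n, Cochain K A n) →ₗ[K] (⨁ n, Cochain K A n) :=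
  DirectSum.toModule K ℕ _ fun n =>
    (DirectSum.lof K ℕ (fun n => Cochain K A n) (n + 1)) ∘ₗ hochD K A n

@[simp] lemma hochTotal_incl {n : ℕ} (f : Cochain K A n) :
    hochTotal K A (incl n f) = incl (n + 1) (hochD K A n f) := by
  simp [hochTotal, incl]

lemma ev_hochD_cup {p q : ℕ} (f : Cochain K A p) (g : Cochain K A q) (a : ℕ → A) :
    ev (hochD K A (p + q) (cup K A p q f g)) a =
      ev (hochD K A p f) a * ev g (shift (p + 1) a) +
        ((-1 : K) ^ p) • (ev f a * ev (hochD K A q g) (shift p a)) := by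
  have h1 : ∑ j ∈ Finset.range p, ((-1 : K) ^ j) • ev (cup K A p q f g) (mergeAt j a) =
      innerD (K := K) p (ev f) a * ev g (shift (p + 1) a) := by
    rw [innerD, Finset.sum_mul]
    refine Finset.sum_congr rfl fun j hj => ?_
    rw [Finset.mem_range] at hj
    rw [ev_cup, smul_mul_assoc]
    congr 3
    funext l
    unfold shift mergeAt
    grind
  have h2 : ∑ j ∈ Finset.range q, ((-1 : K) ^ (p + j)) •
      ev (cup K A p q f g) (mergeAt (p + j) a) =
      ((-1 : K) ^ p) • (ev f a * innerD (K := K) q (ev g) (shift p a)) := by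
    rw [innerD, Finset.mul_sum, Finset.smul_sum]
    refine Finset.sum_congr rfl fun j _ => ?_
    rw [ev_cup, mul_smul_comm, smul_smul, pow_add]
    congr 2
    · exact ev_congr f fun l hl => by unfold mergeAt; grind
    · congr 1
      funext l
      unfold shift mergeAt
      grind
  rw [ev_hochD, innerD, Finset.sum_range_add, h1, h2, ev_hochD, ev_hochD, ev_cup, ev_cup,
    shift_shift, shift_shift, add_comm 1 p]
  have e1 : shift p a 0 = a p := by simp [shift]
  have e2 : shift p a q = a (p + q) := rfl
  have e3 : (-1 : K) ^ (p + q + 1) = (-1) ^ p * (-1) ^ (q + 1) := by rw [← pow_add, add_assoc]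
  rw [e1, e2, e3, pow_succ _ p]
  simp only [add_mul, sub_mul, mul_add, mul_sub, smul_add, smul_sub, smul_mul_assoc,
    mul_smul_comm, smul_smul, mul_neg_one, neg_smul, neg_mul, mul_assoc]
  abel

lemma hochTotal_cupTotal (x y : ⨁ n, Cochain K A n) :
    hochTotal K A (cupTotal K A x y) = cupTotal K A (hochTotal K A x) y +
      cupTotal K A (parity K (fun n => Cochain K A n) x) (hochTotal K A y) := by
  induction x using total_induction with
  | h0 => simp
  | hadd x x' h h' => simp only [map_add, LinearMap.add_apply, h, h']; abel
  | hof p f =>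
    induction y using total_induction with
    | h0 => simp
    | hadd x x' h h' => simp only [map_add, h, h']; abel
    | hof q g =>
      simp only [cupTotal_incl, parity_lof, map_smul, LinearMap.smul_apply, hochTotal_incl]
      rw [← incl_castCochain (show p + 1 + q = p + q + 1 by omega),
        ← incl_castCochain (show p + (q + 1) = p + q + 1 by omega), ← map_smul, ← map_add]
      exact incl_eq_incl rfl fun a => by
        simp only [ev_hochD_cup, ev_add, ev_smul, ev_castCochain, ev_cup]

lemma hochTotal_parity (x : ⨁ n, Cochain K A n) :
    hochTotal K A (parity K (fun n => Cochain K A n) x) =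
      - parity K (fun n => Cochain K A n) (hochTotal K A x) := by
  induction x using total_induction with
  | h0 => simp
  | hadd x x' h h' => simp only [map_add, h, h']; abel
  | hof p f =>
    simp only [parity_lof, map_smul, hochTotal_incl, pow_succ, mul_neg_one, neg_smul, neg_neg]

lemma hochTotal_apply_succ (x : ⨁ n, Cochain K A n) (n : ℕ) :
    hochTotal K A x (n + 1) = hochD K A n (x n) := by
  induction x using total_induction with
  | h0 => simp
  | hadd x x' h h' => simp only [map_add, DirectSum.add_apply, h, h']
  | hof p f =>
    rw [hochTotal_incl]
    by_cases h : p = n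
    · subst h
      simp only [incl, DirectSum.lof_apply]
    · simp only [incl, DirectSum.lof_eq_of]
      rw [DirectSum.of_eq_of_ne _ _ _ (by omega), DirectSum.of_eq_of_ne _ _ _ (by omega), map_zero]

lemma hochTotal_apply_zero (x : ⨁ n, Cochain K A n) : hochTotal K A x 0 = 0 := by
  induction x using total_induction with
  | h0 => simp
  | hadd x x' h h' => simp only [map_add, DirectSum.add_apply, h, h', add_zero]
  | hof p f =>
    rw [hochTotal_incl]
    simp only [incl, DirectSum.lof_eq_of]
    rw [DirectSum.of_eq_of_ne _ _ _ (by omega)]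

lemma totalSub_cocycles :
    totalSub (fun n => cocycles K A n) = LinearMap.ker (hochTotal K A) := by
  ext x
  rw [mem_totalSub_iff, LinearMap.mem_ker]
  constructor
  · intro h
    refine DFinsupp.ext fun n => ?_
    cases n with
    | zero => exact hochTotal_apply_zero x
    | succ n => exact (hochTotal_apply_succ x n).trans (LinearMap.mem_ker.1 (h n))
  · intro h n
    refine LinearMap.mem_ker.2 ?_
    rw [← hochTotal_apply_succ, h]
    rfl

lemma totalSub_coboundaries :
    totalSub (fun n => coboundaries K A n) = LinearMap.range (hochTotal K A) := by
  refine le_antisymm (totalSub_le fun n f hf => ?_) ?_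
  · cases n with
    | zero =>
      rw [(Submodule.mem_bot K).1 hf, map_zero]
      exact zero_mem _
    | succ n =>
      obtain ⟨g, rfl⟩ := hf
      exact ⟨incl n g, hochTotal_incl g⟩
  · rintro _ ⟨x, rfl⟩
    rw [mem_totalSub_iff]
    intro n
    cases n with
    | zero => rw [hochTotal_apply_zero]; exact zero_mem _
    | succ n => rw [hochTotal_apply_succ]; exact ⟨_, rfl⟩

lemma cupTotal_mem_normalized {x y : ⨁ n, Cochain K A n}
    (hx : x ∈ totalSub fun n => normalized K A n) (hy : y ∈ totalSub fun n => normalized K A n) :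
    cupTotal K A x y ∈ totalSub fun n => normalized K A n := by
  suffices h : totalSub (fun n => normalized K A n) ≤
      (totalSub fun n => normalized K A n).comap ((cupTotal K A).flip y) from h hx
  refine totalSub_le fun p f hf => ?_
  suffices h : totalSub (fun n => normalized K A n) ≤
      (totalSub fun n => normalized K A n).comap (cupTotal K A (incl p f)) from h hy
  refine totalSub_le fun q g hg => ?_
  rw [Submodule.mem_comap, cupTotal_incl]
  refine lof_mem_totalSub (S := fun n => normalized K A n) ?_
  rw [mem_normalized_iff] at *
  intro a i hi ha
  rw [ev_cup]
  by_cases h : i < p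
  · rw [hf a i h ha, zero_mul]
  · rw [hg (shift p a) (i - p) (by omega) (by rw [shift, ← ha]; congr 1; omega), mul_zero]

lemma parity_mem_totalSub {V : ℕ → Type*} [∀ i, AddCommGroup (V i)] [∀ i, Module K (V i)]
    {S : ∀ n, Submodule K (V n)} {x : ⨁ n, V n} (hx : x ∈ totalSub S) :
    parity K V x ∈ totalSub S := by
  rw [mem_totalSub_iff] at *
  intro n
  rw [parity_apply]
  exact Submodule.smul_mem _ _ (hx n)

lemma cupTotal_mem_cocycles {x y : ⨁ n, Cochain K A n}
    (hx : x ∈ totalSub fun n => cocycles K A n) (hy : y ∈ totalSub fun n => cocycles K A n) :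
    cupTotal K A x y ∈ totalSub fun n => cocycles K A n := by
  rw [totalSub_cocycles, LinearMap.mem_ker] at *
  rw [hochTotal_cupTotal, hx, hy]
  simp

lemma cupTotal_mem_coboundaries_left {x y : ⨁ n, Cochain K A n}
    (hx : x ∈ totalSub fun n => coboundaries K A n) (hy : y ∈ totalSub fun n => cocycles K A n) :
    cupTotal K A x y ∈ totalSub fun n => coboundaries K A n := by
  rw [totalSub_coboundaries] at *
  rw [totalSub_cocycles, LinearMap.mem_ker] at hy
  obtain ⟨x, rfl⟩ := hx
  refine ⟨cupTotal K A x y, ?_⟩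
  rw [hochTotal_cupTotal, hy]
  simp

lemma cupTotal_mem_coboundaries_right {x y : ⨁ n, Cochain K A n}
    (hx : x ∈ totalSub fun n => cocycles K A n) (hy : y ∈ totalSub fun n => coboundaries K A n) :
    cupTotal K A x y ∈ totalSub fun n => coboundaries K A n := by
  rw [totalSub_coboundaries] at *
  rw [totalSub_cocycles, LinearMap.mem_ker] at hx
  obtain ⟨y, rfl⟩ := hy
  refine ⟨cupTotal K A (parity K _ x) y, ?_⟩
  rw [hochTotal_cupTotal, hochTotal_parity, hx, parity_parity]
  simp

variable {B : LinearMap.BilinForm K A} [FiniteDimensional K A] (hB : B.Nondegenerate)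

@[simp] lemma connesTotal_incl_zero (f : Cochain K A 0) : connesTotal B hB (incl 0 f) = 0 := by
  simp [connesTotal, incl]

@[simp] lemma connesTotal_incl_succ {n : ℕ} (f : Cochain K A (n + 1)) :
    connesTotal B hB (incl (n + 1) f) = incl n (connes B hB n f) := by
  simp [connesTotal, incl]

lemma connesTotal_parity (x : ⨁ n, Cochain K A n) :
    connesTotal B hB (parity K (fun n => Cochain K A n) x) =
      - parity K (fun n => Cochain K A n) (connesTotal B hB x) := by
  induction x using total_induction with
  | h0 => simp
  | hadd x x' h h' => simp only [map_add, h, h']; abel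
  | hof p f =>
    cases p with
    | zero => simp [parity_lof]
    | succ p =>
      simp only [parity_lof, map_smul, map_neg, connesTotal_incl_succ, pow_succ, mul_neg_one,
        neg_smul]

lemma hochTotal_connesTotal (hsymm : B.IsSymm) (hinv : ∀ a b c : A, B (a * b) c = B a (b * c))
    (x : ⨁ n, Cochain K A n) :
    connesTotal B hB (hochTotal K A x) = - hochTotal K A (connesTotal B hB x) := by
  induction x using total_induction with
  | h0 => simp
  | hadd x x' h h' => simp only [map_add, h, h']; abel
  | hof p f =>
    cases p with
    | zero =>
      rw [hochTotal_incl, connesTotal_incl_succ, connes_hochD_zero hsymm hinv, connesTotal_incl_zero]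
      simp
    | succ p =>
      rw [hochTotal_incl, connesTotal_incl_succ, connesTotal_incl_succ, hochTotal_incl,
        hochD_connes hsymm hinv, incl, incl, map_neg, neg_neg]

lemma connesTotal_mem_cocycles (hsymm : B.IsSymm)
    (hinv : ∀ a b c : A, B (a * b) c = B a (b * c)) {x : ⨁ n, Cochain K A n}
    (hx : x ∈ totalSub fun n => cocycles K A n) :
    connesTotal B hB x ∈ totalSub fun n => cocycles K A n := by
  rw [totalSub_cocycles, LinearMap.mem_ker] at *
  rw [← neg_eq_zero, ← hochTotal_connesTotal hB hsymm hinv, hx, map_zero]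

lemma connesTotal_mem_coboundaries (hsymm : B.IsSymm)
    (hinv : ∀ a b c : A, B (a * b) c = B a (b * c)) {x : ⨁ n, Cochain K A n}
    (hx : x ∈ totalSub fun n => coboundaries K A n) :
    connesTotal B hB x ∈ totalSub fun n => coboundaries K A n := by
  rw [totalSub_coboundaries] at *
  obtain ⟨x, rfl⟩ := hx
  refine ⟨- connesTotal B hB x, ?_⟩
  rw [map_neg, hochTotal_connesTotal hB hsymm hinv]

lemma connesTotal_mem_normalized {x : ⨁ n, Cochain K A n}
    (hx : x ∈ totalSub fun n => normalized K A n) :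
    connesTotal B hB x ∈ totalSub fun n => normalized K A n := by
  suffices h : totalSub (fun n => normalized K A n) ≤
      (totalSub fun n => normalized K A n).comap (connesTotal B hB) from h hx
  refine totalSub_le fun p f hf => ?_
  rw [Submodule.mem_comap]
  cases p with
  | zero => rw [connesTotal_incl_zero]; exact zero_mem _
  | succ p =>
    rw [connesTotal_incl_succ]
    exact lof_mem_totalSub (S := fun n => normalized K A n) (connes_mem_normalized hB hf)

lemma connesTotal_connesTotal {x : ⨁ n, Cochain K A n}
    (hx : x ∈ totalSub fun n => normalized K A n) :
    connesTotal B hB (connesTotal B hB x) = 0 := by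
  suffices h : totalSub (fun n => normalized K A n) ≤
      LinearMap.ker (connesTotal B hB ∘ₗ connesTotal B hB) from h hx
  refine totalSub_le fun p f hf => ?_
  rw [LinearMap.mem_ker, LinearMap.comp_apply]
  match p, f, hf with
  | 0, f, hf => rw [connesTotal_incl_zero, map_zero]
  | 1, f, hf => rw [connesTotal_incl_succ, connesTotal_incl_zero]
  | p + 2, f, hf =>
    rw [connesTotal_incl_succ, connesTotal_incl_succ, connes_connes hB hf, incl, map_zero]

/-- The quadratic relations for the operations on normalized cochains. -/
theorem sum_hochOp_insert (a : ℕ → ⨁ n, Cochain K A n)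
    (ha : ∀ i, a i ∈ totalSub fun n => normalized K A n) (n : ℕ) (hn : 1 ≤ n) :
    ∑ i ∈ Finset.range n, ∑ k ∈ Finset.Icc 1 (n - i),
      hochOp B hB (i + 1 + (n - i - k)) (fun l => if (l : ℕ) < i then parity K _ (a l) else
        if (l : ℕ) = i then hochOp B hB k (fun r => a (i + r)) else a (l + k - 1)) = 0 := by
  -- The cup product ring is local to this proof; its additive group is that of the direct sum, so
  -- the `K`-module structure stays compatible.
  let _ := cochainRing K A
  have hmem : ∀ i j, wordProd a i j ∈ totalSub fun n => normalized K A n := by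
    intro i j
    rcases le_total j i with h | h
    · rw [wordProd_of_le _ h]
      exact lof_mem_totalSub (S := fun n => normalized K A n) fun _ ⟨i, _⟩ => i.elim0
    · induction j, h using Nat.le_induction with
      | base =>
        rw [wordProd_of_le _ le_rfl]
        exact lof_mem_totalSub (S := fun n => normalized K A n) fun _ ⟨i, _⟩ => i.elim0
      | succ j hj ih =>
        rw [wordProd_succ _ hj]
        exact cupTotal_mem_normalized ih (ha j)
  refine sum_mOp_insert (cupTotal K A) (fun _ _ => rfl) (connesTotal B hB) (parity K _) ?_
    parity_cupTotal (connesTotal_incl_zero hB _) (connesTotal_parity hB) a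
    (fun i j => connesTotal_connesTotal hB (hmem i j)) n hn
  exact (parity_lof 0 _).trans (by rw [pow_zero, one_smul]; rfl)

lemma hochOp_mem_normalized {k : ℕ} {x : Fin k → ⨁ n, Cochain K A n}
    (hx : ∀ i, x i ∈ totalSub fun n => normalized K A n) :
    hochOp B hB k x ∈ totalSub fun n => normalized K A n :=
  mOp_mem (fun _ hx _ hy => cupTotal_mem_normalized hx hy)
    (fun _ hx => connesTotal_mem_normalized hB hx) (fun _ hx => parity_mem_totalSub hx) hx

lemma hochOp_mem_cocycles (hsymm : B.IsSymm) (hinv : ∀ a b c : A, B (a * b) c = B a (b * c))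
    {k : ℕ} {x : Fin k → ⨁ n, Cochain K A n}
    (hx : ∀ i, x i ∈ totalSub fun n => cocycles K A n) :
    hochOp B hB k x ∈ totalSub fun n => cocycles K A n :=
  mOp_mem (fun _ hx _ hy => cupTotal_mem_cocycles hx hy)
    (fun _ hx => connesTotal_mem_cocycles hB hsymm hinv hx) (fun _ hx => parity_mem_totalSub hx) hx

lemma hochOp_sub_mem_coboundaries (hsymm : B.IsSymm)
    (hinv : ∀ a b c : A, B (a * b) c = B a (b * c)) {k : ℕ} {x y : Fin k → ⨁ n, Cochain K A n}
    (hx : ∀ i, x i ∈ totalSub fun n => cocycles K A n)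
    (hy : ∀ i, y i ∈ totalSub fun n => cocycles K A n)
    (hxy : ∀ i, x i - y i ∈ totalSub fun n => coboundaries K A n) :
    hochOp B hB k x - hochOp B hB k y ∈ totalSub fun n => coboundaries K A n :=
  mOp_sub_mem (fun _ hx _ hy => cupTotal_mem_cocycles hx hy)
    (fun _ hx => connesTotal_mem_cocycles hB hsymm hinv hx) (fun _ hx => parity_mem_totalSub hx)
    (fun _ hx _ hy => cupTotal_mem_coboundaries_left hx hy)
    (fun _ hx _ hy => cupTotal_mem_coboundaries_right hx hy)
    (fun _ hx => connesTotal_mem_coboundaries hB hsymm hinv hx)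
    (fun _ hx => parity_mem_totalSub hx) hx hy hxy

end Total

/-! ## Degrees of the operations -/

section Degree

variable {K : Type*} [Field K] {A : Type*} [Ring A] [Algebra K A]

variable (K A) in
/-- Elements of degree `d` of the total space. -/
def homSub (d : ℕ) : Submodule K (⨁ n, Cochain K A n) :=
  LinearMap.range (DirectSum.lof K ℕ (fun n => Cochain K A n) d)

variable (K A) in
/-- Elements of degree `d - 1` of the total space. -/
def lowSub : ℕ → Submodule K (⨁ n, Cochain K A n)
  | 0 => ⊥
  | d + 1 => homSub K A d

lemma cupTotal_mem_homSub {p q : ℕ} {x y : ⨁ n, Cochain K A n} (hx : x ∈ homSub K A p)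
    (hy : y ∈ homSub K A q) : cupTotal K A x y ∈ homSub K A (p + q) := by
  obtain ⟨f, rfl⟩ := hx
  obtain ⟨g, rfl⟩ := hy
  exact ⟨_, (cupTotal_incl f g).symm⟩

lemma cupTotal_mem_lowSub_left {p q : ℕ} {x y : ⨁ n, Cochain K A n} (hx : x ∈ lowSub K A p)
    (hy : y ∈ homSub K A q) : cupTotal K A x y ∈ lowSub K A (p + q) := by
  cases p with
  | zero =>
    rw [(Submodule.mem_bot K).1 hx, map_zero, LinearMap.zero_apply]
    exact zero_mem _
  | succ p =>
    rw [show p + 1 + q = p + q + 1 by omega]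
    exact cupTotal_mem_homSub hx hy

lemma cupTotal_mem_lowSub_right {p q : ℕ} {x y : ⨁ n, Cochain K A n} (hx : x ∈ homSub K A p)
    (hy : y ∈ lowSub K A q) : cupTotal K A x y ∈ lowSub K A (p + q) := by
  cases q with
  | zero =>
    rw [(Submodule.mem_bot K).1 hy, map_zero]
    exact zero_mem _
  | succ q => exact cupTotal_mem_homSub hx hy

lemma parity_mem_homSub {p : ℕ} {x : ⨁ n, Cochain K A n} (hx : x ∈ homSub K A p) :
    parity K (fun n => Cochain K A n) x ∈ homSub K A p := by
  obtain ⟨f, rfl⟩ := hx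
  rw [parity_lof]
  exact Submodule.smul_mem _ _ ⟨f, rfl⟩

lemma gammaOp_mem_homSub {n : ℕ} {a : Fin (n + 1) → ⨁ n, Cochain K A n} {d : Fin (n + 1) → ℕ}
    (ha : ∀ i, a i ∈ homSub K A (d i)) : gammaOp (cupTotal K A) n a ∈ homSub K A (∑ i, d i) := by
  induction n with
  | zero => simpa [gammaOp] using ha 0
  | succ n ih =>
    rw [Fin.sum_univ_castSucc]
    exact cupTotal_mem_homSub (ih fun i => ha _) (ha _)

lemma apply_eq_zero_of_mem_lowSub {d p : ℕ} {x : ⨁ n, Cochain K A n} (hx : x ∈ lowSub K A d)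
    (h : p + 1 ≠ d) : x p = 0 := by
  cases d with
  | zero => rw [(Submodule.mem_bot K).1 hx]; rfl
  | succ d =>
    obtain ⟨f, rfl⟩ := hx
    rw [DirectSum.lof_eq_of]
    exact DirectSum.of_eq_of_ne _ _ _ (by omega)

variable {B : LinearMap.BilinForm K A} [FiniteDimensional K A] (hB : B.Nondegenerate)

lemma connesTotal_mem_lowSub {d : ℕ} {x : ⨁ n, Cochain K A n} (hx : x ∈ homSub K A d) :
    connesTotal B hB x ∈ lowSub K A d := by
  obtain ⟨f, rfl⟩ := hx
  cases d with
  | zero => rw [connesTotal_incl_zero]; exact zero_mem _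
  | succ d => exact ⟨_, (connesTotal_incl_succ hB f).symm⟩

lemma hochOp_mem_lowSub {k : ℕ} {x : Fin k → ⨁ n, Cochain K A n} {d : Fin k → ℕ}
    (hx : ∀ i, x i ∈ homSub K A (d i)) : hochOp B hB k x ∈ lowSub K A (∑ i, d i) := by
  match k with
  | 0 => exact zero_mem _
  | 1 =>
    rw [Fin.sum_univ_one]
    exact connesTotal_mem_lowSub hB (hx 0)
  | 2 =>
    rw [Fin.sum_univ_two]
    exact sub_mem (sub_mem (connesTotal_mem_lowSub hB (cupTotal_mem_homSub (hx 0) (hx 1)))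
      (cupTotal_mem_lowSub_left (connesTotal_mem_lowSub hB (hx 0)) (hx 1)))
      (cupTotal_mem_lowSub_right (parity_mem_homSub (hx 0)) (connesTotal_mem_lowSub hB (hx 1)))
  | n + 3 =>
    refine add_mem (sub_mem (sub_mem ?_ ?_) ?_) ?_
    · exact connesTotal_mem_lowSub hB (gammaOp_mem_homSub hx)
    · rw [Fin.sum_univ_castSucc]
      exact cupTotal_mem_lowSub_left
        (connesTotal_mem_lowSub hB (gammaOp_mem_homSub fun i => hx _)) (hx _)
    · rw [Fin.sum_univ_succ]
      exact cupTotal_mem_lowSub_right (parity_mem_homSub (hx 0))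
        (connesTotal_mem_lowSub hB (gammaOp_mem_homSub fun i => hx _))
    · rw [Fin.sum_univ_castSucc, Fin.sum_univ_succ]
      exact cupTotal_mem_lowSub_left (cupTotal_mem_lowSub_right (parity_mem_homSub (hx 0))
        (connesTotal_mem_lowSub hB (gammaOp_mem_homSub fun i => hx _))) (hx _)

end Degree

/-! ## Transfer to normalized cochains and to cohomology -/

section Classes

variable {K : Type*} [Field K] {A : Type*} [Ring A] [Algebra K A]

lemma IsClassOf.sum {ι : Type*} (s : Finset ι) {x : ι → ⨁ n, Cochain K A n}
    {c : ι → ⨁ n, HH K A n} (h : ∀ i ∈ s, IsClassOf (x i) (c i)) :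
    IsClassOf (∑ i ∈ s, x i) (∑ i ∈ s, c i) := by
  classical
  induction s using Finset.induction_on with
  | empty => exact ⟨0, by simp, by simp⟩
  | insert i s hi ih =>
    obtain ⟨z, hz, hz'⟩ := h i (Finset.mem_insert_self i s)
    obtain ⟨w, hw, hw'⟩ := ih fun j hj => h j (Finset.mem_insert_of_mem hj)
    rw [Finset.sum_insert hi, Finset.sum_insert hi]
    exact ⟨z + w, by rw [map_add, hz, hw], by rw [map_add, hz', hw']⟩

lemma IsClassOf.eq_zero {c : ⨁ n, HH K A n} (h : IsClassOf (0 : ⨁ n, Cochain K A n) c) : c = 0 := by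
  obtain ⟨z, hz, rfl⟩ := h
  have hinj : Function.Injective (DirectSum.lmap fun n => (cocycles K A n).subtype) :=
    (DirectSum.lmap_injective _).2 fun n => (cocycles K A n).injective_subtype
  rw [hinj (hz.trans (map_zero _).symm), map_zero]

lemma IsClassOf.parity {x : ⨁ n, Cochain K A n} {c : ⨁ n, HH K A n} (h : IsClassOf x c) :
    IsClassOf (parity K (fun n => Cochain K A n) x) (parity K (fun n => HH K A n) c) := by
  obtain ⟨z, rfl, rfl⟩ := h
  exact ⟨HochschildBV.parity K (fun n => cocycles K A n) z, lmap_parity _ _, lmap_parity _ _⟩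

lemma IsClassOf.mem_cocycles {x : ⨁ n, Cochain K A n} {c : ⨁ n, HH K A n} (h : IsClassOf x c) :
    x ∈ totalSub fun n => cocycles K A n := by
  obtain ⟨z, hz, -⟩ := h
  exact ⟨z, hz⟩

/-- Two cocycles represent the same class if and only if they differ by a coboundary. -/
lemma IsClassOf.congr_iff {x y : ⨁ n, Cochain K A n} {c : ⨁ n, HH K A n} (hx : IsClassOf x c)
    (hy : y ∈ totalSub fun n => cocycles K A n) :
    IsClassOf y c ↔ x - y ∈ totalSub fun n => coboundaries K A n := by
  obtain ⟨z, rfl, rfl⟩ := hx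
  obtain ⟨w, rfl⟩ := hy
  have hinj : Function.Injective (DirectSum.lmap fun n => (cocycles K A n).subtype) :=
    (DirectSum.lmap_injective _).2 fun n => (cocycles K A n).injective_subtype
  rw [mem_totalSub_iff]
  have key : (∀ n, (DirectSum.lmap (fun n => (cocycles K A n).subtype) z -
      DirectSum.lmap (fun n => (cocycles K A n).subtype) w : ⨁ n, Cochain K A n) n ∈
        coboundaries K A n) ↔
      DirectSum.lmap (fun n => ((coboundaries K A n).submoduleOf (cocycles K A n)).mkQ) w =
      DirectSum.lmap (fun n => ((coboundaries K A n).submoduleOf (cocycles K A n)).mkQ) z := by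
    rw [DirectSum.lmap_eq_iff]
    refine forall_congr' fun n => ?_
    rw [eq_comm, Submodule.mkQ_apply, Submodule.mkQ_apply, Submodule.Quotient.eq]
    rfl
  rw [key]
  constructor
  · rintro ⟨w', h1, h2⟩
    rwa [hinj h1] at h2
  · intro h
    exact ⟨w, rfl, h⟩

end Classes

/-! ### Transport of the operations along linear maps -/

section Transfer

variable {K : Type*} [Field K] {A : Type*} [Ring A] [Algebra K A]
variable {B : LinearMap.BilinForm K A} [FiniteDimensional K A] (hB : B.Nondegenerate)
variable {V : ℕ → Type*} [∀ i, AddCommGroup (V i)] [∀ i, Module K (V i)]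

/-- The operations on a graded module `V` obtained from those on Hochschild cochains by means of
degreewise linear maps to and from `V`. -/
def transferOp (s : ∀ n, V n →ₗ[K] Cochain K A n) (ρ : ∀ n, Cochain K A n →ₗ[K] V n) (k : ℕ) :
    MultilinearMap K (fun _ : Fin k => ⨁ n, V n) (⨁ n, V n) :=
  (DirectSum.lmap ρ).compMultilinearMap
    ((mMulti (cupTotal K A) (connesTotal B hB) (parity K (fun n => Cochain K A n)) k).compLinearMap
      fun _ => DirectSum.lmap s)

lemma transferOp_apply (s : ∀ n, V n →ₗ[K] Cochain K A n) (ρ : ∀ n, Cochain K A n →ₗ[K] V n)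
    (k : ℕ) (x : Fin k → ⨁ n, V n) :
    transferOp hB s ρ k x =
      DirectSum.lmap ρ (hochOp B hB k fun i => DirectSum.lmap s (x i)) := by
  simp only [transferOp, LinearMap.compMultilinearMap_apply, MultilinearMap.compLinearMap_apply,
    mMulti_apply]
  rfl

lemma transferOp_degree (s : ∀ n, V n →ₗ[K] Cochain K A n) (ρ : ∀ n, Cochain K A n →ₗ[K] V n)
    (k : ℕ) (d : Fin k → ℕ) (x : ∀ i, V (d i)) (p : ℕ) (hp : p + 1 ≠ ∑ i, d i) :
    transferOp hB s ρ k (fun i => DirectSum.lof K ℕ V (d i) (x i)) p = 0 := by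
  rw [transferOp_apply, DirectSum.lmap_apply, apply_eq_zero_of_mem_lowSub
    (hochOp_mem_lowSub hB (d := d) fun i => ?_) hp, map_zero]
  rw [DirectSum.lmap_lof]
  exact ⟨_, rfl⟩

/-- The structure on normalized cochains. -/
theorem exists_normalized_structure :
    ∃ S : HomologicalAInfinity K (fun n => normalized K A n),
      ∀ k, ∀ x : Fin k → ⨁ n, normalized K A n,
        inclNormalized K A (S.op k x) = hochOp B hB k (fun i => inclNormalized K A (x i)) := by
  -- Any linear retraction serves: the operations preserve normalized cochains, so its other values
  -- do not matter.
  have hret : ∀ n, ∃ ρ : Cochain K A n →ₗ[K] normalized K A n,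
      ρ ∘ₗ (normalized K A n).subtype = LinearMap.id := fun n =>
    LinearMap.exists_leftInverse_of_injective _ (Submodule.ker_subtype _)
  choose ρ hρ using hret
  have hinc : ∀ k, ∀ x : Fin k → ⨁ n, normalized K A n,
      inclNormalized K A (transferOp hB (fun n => (normalized K A n).subtype) ρ k x) =
        hochOp B hB k (fun i => inclNormalized K A (x i)) := by
    intro k x
    rw [transferOp_apply]
    obtain ⟨z, hz⟩ := hochOp_mem_normalized hB (k := k)
      (x := fun i => inclNormalized K A (x i)) fun i => ⟨x i, rfl⟩
    change inclNormalized K A (DirectSum.lmap ρ (hochOp B hB k fun i => inclNormalized K A (x i)))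
      = _
    rw [← hz]
    refine DFinsupp.ext fun n => ?_
    simp only [inclNormalized, DirectSum.lmap_apply]
    have := LinearMap.congr_fun (hρ n) (z n)
    rw [LinearMap.comp_apply, LinearMap.id_apply] at this
    rw [this]
  have hinj : Function.Injective (inclNormalized K A) :=
    (DirectSum.lmap_injective _).2 fun n => (normalized K A n).injective_subtype
  refine ⟨⟨transferOp hB (fun n => (normalized K A n).subtype) ρ,
    fun k _ => transferOp_degree hB _ ρ k, fun n hn a => hinj ?_⟩, hinc⟩
  rw [map_zero, map_sum, ← sum_hochOp_insert hB (fun i => inclNormalized K A (a i))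
    (fun i => ⟨a i, rfl⟩) n hn]
  refine Finset.sum_congr rfl fun i _ => ?_
  rw [map_sum]
  refine Finset.sum_congr rfl fun k _ => ?_
  rw [hinc]
  congr 1
  funext l
  unfold insertArgs
  split_ifs
  · exact lmap_parity _ _
  · exact hinc _ _
  · rfl

/-- The structure on Hochschild cohomology. -/
theorem exists_cohomology_structure (hsymm : B.IsSymm)
    (hinv : ∀ a b c : A, B (a * b) c = B a (b * c)) :
    ∃ T : HomologicalAInfinity K (fun n => HH K A n),
      ∀ k, ∀ (x : Fin k → ⨁ n, Cochain K A n) (c : Fin k → ⨁ n, HH K A n),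
        (∀ i, IsClassOf (x i) (c i)) → IsClassOf (hochOp B hB k x) (T.op k c) := by
  -- Classes are represented linearly by normalized cocycles, on which the quadratic relations hold
  -- strictly.
  have hsec : ∀ n, ∃ s : HH K A n →ₗ[K] (cocycles K A n ⊓ normalized K A n : Submodule K _),
      (((coboundaries K A n).submoduleOf (cocycles K A n)).mkQ ∘ₗ
        Submodule.inclusion inf_le_left) ∘ₗ s = LinearMap.id := by
    intro n
    refine LinearMap.exists_rightInverse_of_surjective _ (LinearMap.range_eq_top.2 fun c => ?_)
    obtain ⟨f, rfl⟩ := Submodule.mkQ_surjective _ c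
    obtain ⟨h, hh, hf⟩ := exists_sub_mem_normalized (f : Cochain K A n) (by
      rw [LinearMap.mem_ker.1 f.2]; exact zero_mem _)
    refine ⟨⟨f - h, Submodule.sub_mem _ f.2 (coboundaries_le_cocycles n hh), hf⟩, ?_⟩
    rw [LinearMap.comp_apply, Submodule.mkQ_apply, Submodule.mkQ_apply, Submodule.Quotient.eq]
    change (f : Cochain K A n) - h - f ∈ coboundaries K A n
    simpa using hh
  -- The class map is extended arbitrarily from cocycles to all cochains; it is only evaluated on
  -- cocycles.
  have hret : ∀ n, ∃ ρ : Cochain K A n →ₗ[K] HH K A n,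
      ρ ∘ₗ (cocycles K A n).subtype =
        ((coboundaries K A n).submoduleOf (cocycles K A n)).mkQ := fun n =>
    LinearMap.exists_extend _
  choose s hs using hsec
  choose ρ hρ using hret
  set σ : ∀ n, HH K A n →ₗ[K] Cochain K A n := fun n => (Submodule.subtype _) ∘ₗ s n with hσ
  have hσN : ∀ c : ⨁ n, HH K A n,
      DirectSum.lmap σ c ∈ totalSub fun n => normalized K A n := by
    intro c
    rw [mem_totalSub_iff]
    intro n
    rw [DirectSum.lmap_apply]
    exact (s n (c n)).2.2
  have hσC : ∀ c : ⨁ n, HH K A n, IsClassOf (DirectSum.lmap σ c) c := by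
    intro c
    refine ⟨DirectSum.lmap (fun n => Submodule.inclusion inf_le_left ∘ₗ s n) c, ?_, ?_⟩
    · refine DFinsupp.ext fun n => ?_
      simp only [DirectSum.lmap_apply]
      rfl
    · refine DFinsupp.ext fun n => ?_
      simp only [DirectSum.lmap_apply]
      exact LinearMap.congr_fun (hs n) (c n)
  have hρC : ∀ x ∈ totalSub (fun n => cocycles K A n), IsClassOf x (DirectSum.lmap ρ x) := by
    rintro _ ⟨z, rfl⟩
    refine ⟨z, rfl, DFinsupp.ext fun n => ?_⟩
    simp only [DirectSum.lmap_apply]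
    exact (LinearMap.congr_fun (hρ n) (z n)).symm
  have hdesc : ∀ k, ∀ (x : Fin k → ⨁ n, Cochain K A n) (c : Fin k → ⨁ n, HH K A n),
      (∀ i, IsClassOf (x i) (c i)) → IsClassOf (hochOp B hB k x) (transferOp hB σ ρ k c) := by
    intro k x c hx
    have hy : ∀ i, DirectSum.lmap σ (c i) ∈ totalSub fun n => cocycles K A n :=
      fun i => (hσC (c i)).mem_cocycles
    have hx' : ∀ i, x i ∈ totalSub fun n => cocycles K A n := fun i => (hx i).mem_cocycles
    rw [transferOp_apply, (hρC _ (hochOp_mem_cocycles hB hsymm hinv hy)).congr_iff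
      (hochOp_mem_cocycles hB hsymm hinv hx')]
    exact hochOp_sub_mem_coboundaries hB hsymm hinv hy hx' fun i =>
      ((hσC (c i)).congr_iff (hx' i)).1 (hx i)
  refine ⟨⟨transferOp hB σ ρ, fun k _ => transferOp_degree hB σ ρ k, fun n hn c => ?_⟩, hdesc⟩
  apply IsClassOf.eq_zero
  -- The vanishing sum for the normalized representatives represents, term by term, the sum on
  -- classes. The descent `hdesc` is used for the inner and for the outer operation.
  rw [← sum_hochOp_insert hB (fun i => DirectSum.lmap σ (c i)) (fun i => hσN (c i)) n hn]
  refine IsClassOf.sum _ fun i _ => IsClassOf.sum _ fun k _ => hdesc _ _ _ fun l => ?_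
  unfold insertArgs
  split_ifs
  · exact (hσC _).parity
  · exact hdesc _ _ _ fun r => hσC _
  · exact hσC _

/-- On cocycles, `m_2` is the Gerstenhaber bracket up to sign and coboundaries. -/
theorem hochOp_two_sub_gerstenhaber_mem (hsymm : B.IsSymm)
    (hinv : ∀ a b c : A, B (a * b) c = B a (b * c)) {p q r : ℕ} (h : r + 1 = p + q)
    {f : Cochain K A p} (hf : f ∈ cocycles K A p) {g : Cochain K A q} (hg : g ∈ cocycles K A q) :
    hochOp B hB 2 ![incl p f, incl q g] -
      incl r (((-1 : K) ^ ((p + 1) * q + 1)) • gerstenhaber h f g) ∈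
        totalSub fun n => coboundaries K A n := by
  obtain ⟨X, hX, hX'⟩ := exists_connes_cup_eq hsymm hinv hB h hf hg
  obtain ⟨M₁, hM₁, hM₁'⟩ : ∃ M : Cochain K A r,
      cupTotal K A (connesTotal B hB (incl p f)) (incl q g) = incl r M ∧
      ∀ a, ev M a = connesEv B hB f a * ev g (shift (p - 1) a) := by
    cases p with
    | zero => exact ⟨0, by simp, fun a => by simp [connesEv]⟩
    | succ n =>
      refine ⟨castCochain (by omega) (cup K A n q (connes B hB n f) g), ?_, fun a => ?_⟩
      · rw [connesTotal_incl_succ, cupTotal_incl, incl_castCochain]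
      · rw [ev_castCochain, ev_cup, connesEv, Nat.add_sub_cancel]
  obtain ⟨M₂, hM₂, hM₂'⟩ : ∃ M : Cochain K A r,
      cupTotal K A (parity K _ (incl p f)) (connesTotal B hB (incl q g)) = incl r M ∧
      ∀ a, ev M a = ((-1 : K) ^ p) • (ev f a * connesEv B hB g (shift p a)) := by
    cases q with
    | zero => exact ⟨0, by simp, fun a => by simp [connesEv]⟩
    | succ n =>
      refine ⟨((-1 : K) ^ p) • castCochain (by omega) (cup K A p n f (connes B hB n g)), ?_,
        fun a => ?_⟩
      · rw [connesTotal_incl_succ, parity_lof, map_smul, LinearMap.smul_apply, cupTotal_incl,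
          ← incl_castCochain (show p + n = r by omega), ← map_smul]
      · rw [ev_smul, ev_castCochain, ev_cup, connesEv]
  have key : hochOp B hB 2 ![incl p f, incl q g] -
      incl r (((-1 : K) ^ ((p + 1) * q + 1)) • gerstenhaber h f g) = incl r X := by
    change connesTotal B hB (cupTotal K A (incl p f) (incl q g)) -
      cupTotal K A (connesTotal B hB (incl p f)) (incl q g) -
      cupTotal K A (parity K _ (incl p f)) (connesTotal B hB (incl q g)) - _ = _
    rw [hM₁, hM₂, cupTotal_incl, ← incl_castCochain h.symm, connesTotal_incl_succ, ← map_sub,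
      ← map_sub, ← map_sub]
    refine incl_eq_incl rfl fun a => ?_
    simp only [ev_sub, hX', hM₁', hM₂', ev_smul]
    abel
  rw [key]
  exact lof_mem_totalSub (S := fun n => coboundaries K A n) hX

end Transfer

end

end HochschildBV

/-! ### The theorem -/

open HochschildBV in
theorem theorem8 {K : Type*} [Field K] {A : Type*} [Ring A] [Algebra K A] [FiniteDimensional K A]
    (B : LinearMap.BilinForm K A) (hsymm : B.IsSymm)
    (hinv : ∀ a b c : A, B (a * b) c = B a (b * c)) (hB : B.Nondegenerate) :
    -- the normalized cochains form a subcomplex that computes Hochschild cohomology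
    ((∀ n, ∀ f ∈ normalized K A n, hochD K A n f ∈ normalized K A (n + 1)) ∧
      (∀ n, ∀ f ∈ cocycles K A n, ∃ g ∈ normalized K A n, f - g ∈ coboundaries K A n) ∧
      (∀ n, ∀ f : Cochain K A n, hochD K A n f ∈ normalized K A (n + 1) →
        ∃ g ∈ normalized K A n, hochD K A n g = hochD K A n f)) ∧
    -- the structures on normalized cochains and on cohomology
    ∃ (S : HomologicalAInfinity K (fun n => normalized K A n))
      (T : HomologicalAInfinity K (fun n => HH K A n)),
      -- on cochains it consists of the operations built from the cup product and `Δ`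
      (∀ k, 1 ≤ k → ∀ x : Fin k → ⨁ n, normalized K A n,
        inclNormalized K A (S.op k x) = hochOp B hB k (fun i => inclNormalized K A (x i))) ∧
      -- these operations descend to cohomology, where they give `T`
      (∀ k, 1 ≤ k → ∀ (x : Fin k → ⨁ n, Cochain K A n) (c : Fin k → ⨁ n, HH K A n),
        (∀ i, IsClassOf (x i) (c i)) → IsClassOf (hochOp B hB k x) (T.op k c)) ∧
      -- `m_1 = Δ`, on cochains and on cohomology
      (∀ x, inclNormalized K A (S.op 1 ![x]) = connesTotal B hB (inclNormalized K A x)) ∧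
      (∀ x c, IsClassOf x c → IsClassOf (connesTotal B hB x) (T.op 1 ![c])) ∧
      -- on cohomology, `m_2` is the Gerstenhaber bracket up to sign
      (∀ (p q r : ℕ) (h : r + 1 = p + q) (f : Cochain K A p) (g : Cochain K A q)
        (c d : ⨁ n, HH K A n),
        IsClassOf (DirectSum.lof K ℕ (fun n => Cochain K A n) p f) c →
        IsClassOf (DirectSum.lof K ℕ (fun n => Cochain K A n) q g) d →
        IsClassOf (DirectSum.lof K ℕ (fun n => Cochain K A n) r
            (((-1 : K) ^ ((p + 1) * q + 1)) • gerstenhaber h f g)) (T.op 2 ![c, d])) := by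
  obtain ⟨S, hS⟩ := exists_normalized_structure hB
  obtain ⟨T, hT⟩ := exists_cohomology_structure hB hsymm hinv
  refine ⟨⟨fun n f hf => hochD_mem_normalized hf, fun n f hf => ?_, fun n f hf => ?_⟩, S, T,
    fun k _ => hS k, fun k _ => hT k, fun x => hS 1 ![x], fun x c hx => ?_, ?_⟩
  · obtain ⟨h, hh, hfh⟩ := exists_sub_mem_normalized f (by
      rw [LinearMap.mem_ker.1 hf]; exact zero_mem _)
    exact ⟨f - h, hfh, by rwa [sub_sub_cancel]⟩
  · obtain ⟨h, hh, hfh⟩ := exists_sub_mem_normalized f hf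
    exact ⟨f - h, hfh, by
      rw [map_sub, LinearMap.mem_ker.1 (coboundaries_le_cocycles n hh), sub_zero]⟩
  · exact hT 1 ![x] ![c] fun i => by
      rw [Subsingleton.elim i 0]
      exact hx
  · intro p q r h f g c d hc hd
    have hof : ∀ {n : ℕ} {f : Cochain K A n} {c : ⨁ n, HH K A n},
        IsClassOf (DirectSum.lof K ℕ (fun n => Cochain K A n) n f) c → f ∈ cocycles K A n := by
      intro n f c hc
      have := mem_totalSub_iff.1 hc.mem_cocycles n
      rwa [DirectSum.lof_apply] at this
    have h2 := hT 2 ![incl p f, incl q g] ![c, d] fun i => by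
      fin_cases i
      · exact hc
      · exact hd
    have h3 := hochOp_two_sub_gerstenhaber_mem hB hsymm hinv h (hof hc) (hof hd)
    refine (h2.congr_iff ?_).2 h3
    have h4 := Submodule.sub_mem _ h2.mem_cocycles (show _ ∈ totalSub fun n => cocycles K A n from
      mem_totalSub_iff.2 fun n => coboundaries_le_cocycles n (mem_totalSub_iff.1 h3 n))
    rwa [sub_sub_cancel] at h4
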